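/- **Conventions.** For a self-adjoint operator $D$ on a Hilbert space $\mathcal H$ and a unital C*-algebra $\mathcal A\subset\mathcal B(\mathcal H)$ put $L_D(x)=\|[D,x]\|$, $x\in\mathcal A$ (with value $\infty$ if $x$ does not preserve $\mathrm{dom}\,D$ or the commutator is unbounded), and $B_{L_D}=\{x\in\mathcal A: L_D(x)\le1\}$. The *normic radius* of $B_{L_D}$ is the supremum of the quotient norms in $\mathcal A/\mathbb C1$ of its elements. $L_D$ is a *Lip-norm* ($(\mathcal A,L_D)$ is a quantum compact metric space) if the pseudometric $\rho(\varphi,\psi)=\sup\{|\varphi(x)-\psi(x)|:L_D(x)\le1\}$ induces the weak* topology on the state space; by Rieffel this is equivalent to total boundedness of $B_{L_D}$ in $\mathcal A/\mathbb C1$. Let $B\in M_p(\mathbb Z)$ with $r=|\det B|>1$ be purely expanding ($\|B^nv\|\to\infty$ for every $v\ne0$), $A=(B^T)^{-1}$. Identify $\widehat{\mathbb Z_B}$ with $A\mathbb Z^p/\mathbb Z^p$, let $s_1(k)\in[0,1)^p$ be the representative of $k\in\widehat{\mathbb Z_B}$ and $s_h(k)=A^{h-1}s_1(k)$. Let $\mathcal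 R$ be the hyperfinite II$_1$ factor, the weak closure of $\mathrm{UHF}(r^\infty)$ in the representation of its trace $\tau$; the limit operators $\widehat D_\infty$ in 1–3 act on $\mathcal H_0\otimes L^2(\mathcal R,\tau)$, where $\mathcal H_0$ is the Hilbert space of $D_0$. Consider the following four inductive systems $\mathcal A_0\subset\mathcal A_1\subset\cdots$, $\mathcal A_\infty=\varinjlim\mathcal A_n$. 1. *Tori.* $\mathcal A_n=C(\mathbb R^p/B^n\mathbb Z^p)$ on $\mathbb C^{2^{[p/2]}}\otimes L^2(\mathbb R^p/B^n\mathbb Z^p,r^{-n}dm)$, $D_n=-i\sum_a\varepsilon^a\otimes\partial_a$ with self-adjoint matrices $\varepsilon^a$ satisfying the Clifford relations, and $\widehat D_\infty=D_0\otimes I-2\pi\sum_a\varepsilon^a\otimes I\otimes\big(\sum_{h\ge1}I^{\otimes h-1}\otimes\mathrm{diag}(s_h(\cdot)^a)\big)$. Put $x_n(t)=e^{2\pi i\langle A^ne_1,t\rangle}$. 2. *Rational rotation algebras.* $p=2$, $\theta=m/q\in[0,1)$ with $m,q$ coprime, $\det B\equiv1$ mod $q$; with $U_0=\mathrm{diag}(e^{2\pi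 i(k-1)\theta})_{k=1}^q$ and $V_0$ the cyclic permutation matrix ($(V_0)_{hk}=1$ iff $k\equiv h+1$ mod $q$), $\mathcal A_n$ is the algebra of continuous $f:\mathbb R^2\to M_q(\mathbb C)$ with $f(t)=V_0^{g_1}U_0^{-g_2}f(t-g)U_0^{g_2}V_0^{-g_1}$ for all $g\in B^n\mathbb Z^2$, on $\mathbb C^2\otimes L^2(\mathcal A_n,\tau_n)$, where $\tau_n(f)=\frac1{qr^n}\int_{\mathbb R^2/B^n\mathbb Z^2}\mathrm{tr}f(t)\,dt$; $D_n=-ic\,(\varepsilon^1\otimes\partial_1+\varepsilon^2\otimes\partial_2)$ with $\partial_a=\partial/\partial t_a$ and any fixed normalisation $c\in\mathbb R\setminus\{0\}$, and $\widehat D_\infty$ is as in 1 (with the factor $2\pi$ replaced by $2\pi c$). Put $x_n(t)=e^{2\pi i\langle A^ne_1,t\rangle}1$. 3. *Crossed products.* $(\mathcal L_{\mathcal Z},\mathcal H,D)$ is a spectral triple, $\mathcal H\neq0$, over a unital C*-algebra $\mathcal Z\subset\mathcal B(\mathcal H)$; $G_n=A^n\mathbb Z^p$, $G_\infty=\bigcup_nG_n$;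 $\rho$ is an action of $G_\infty$ on $\mathcal Z$ and $\beta\in\mathrm{Aut}(\mathcal Z)$ with $\beta\rho_{Ag}\beta^{-1}=\rho_g$, such that $\sup_{g\in G_n}\|[D,\rho_g(a)]\|<\infty$ for all $n$ and $a\in\mathcal L_{\mathcal Z}$. $\mathcal A_n=\mathcal Z\rtimes_\rho G_n$ on $\mathcal H\otimes\mathbb C^{2^{\lceil p/2\rceil}}\otimes\ell^2(G_n)$, generated by $(\pi(z)\xi)(g)=\rho_g^{-1}(z)\xi(g)$ and $(U_h\xi)(g)=\xi(g-h)$; $D_n=D\otimes\varepsilon_1\otimes I+I\otimes M_\ell$ with $\ell(g)=\sum_\mu g_\mu\varepsilon_{\mu+1}$, where $\varepsilon_1,\dots,\varepsilon_{p+1}$ are self-adjoint Clifford generators; $\widehat D_\infty=D_0\otimes I+C$, where $C$ is the diagonal operator $\sum_{h\ge1}\ell(s_h(j_h))$. $\mathcal A_\infty$ acts on $\mathcal H_0\otimes L^2(\mathcal R,\tau)$ so that $U_h$, $h\in G_n$, is represented by the matrix $\big(U_{h+S(k)-S(j)}\,[h+S(k)-S(j)\in G_0]\big)_{j,k}$ over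 $\widehat{\mathbb Z_B}^{\,n}$, $S(j)=s_1(j_1)+\dots+s_n(j_n)$, and $\mathcal Z$ either by any faithful representation covariant with these unitaries or by the explicit one in which $z$ acts at $g\in G_0$ and at a pair $(x,y)$ of tail-equivalent sequences in $\widehat{\mathbb Z_B}$ (the points of the equivalence relation that defines $L^2(\mathcal R,\tau)$) as $\rho_d^{-1}(z)$, $d=g+\sum_h(s_h(x_h)-s_h(y_h))$. Put $x_n=U_{A^ne_1}$. 4. *UHF algebras.* $r\ge2$, $s>1$; $\mathcal A_n=\bigotimes_{k\ge-n}M_r(\mathbb C)$ acting on $L^2(\mathcal A_n,\tau)$ and $\mathcal A_\infty=\bigotimes_{k\in\mathbb Z}M_r(\mathbb C)$ acting on $L^2(\mathcal A_\infty,\tau)$; $D_n=\sum_{k\ge-n}r^{ks}Q_k$ and $\widehat D_\infty=\sum_{k\in\mathbb Z}r^{ks}Q_k$, where $Q_k=P_k-P_{k-1}$ and $P_k$ is the projection onto the closed subspace generated by the matrices in positions $\le k$ (for $\mathcal A_n$, $P_{-n-1}$ is the projection onto $\mathbb C1$). For any non-scalar $b\in M_r(\mathbb C)$ let $x_n$ be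 the matrix $b$ in position $-n$. **Theorem.** In each of the four cases the normic radii of the balls $B_{L_{D_n}}$ of $\mathcal A_n$ tend to $\infty$. More precisely, $0<L_{D_n}(x_n)<\infty$ and $0<L_{\widehat D_\infty}(x_n)<\infty$ for all $n$, with $L_{\widehat D_\infty}(x_n)=L_{D_n}(x_n)$ in cases 1–3; the elements $x_n/L_{D_n}(x_n)\in\mathcal A_n$ have $L_{D_n}$ equal to $1$ and the elements $x_n/L_{\widehat D_\infty}(x_n)\in\mathcal A_\infty$ have $L_{\widehat D_\infty}$ equal to $1$, while their quotient norms in $\mathcal A_n/\mathbb C1$, respectively in $\mathcal A_\infty/\mathbb C1$, tend to $\infty$. Consequently $B_{L_{\widehat D_\infty}}$ is not totally bounded in $\mathcal A_\infty/\mathbb C1$ and $L_{\widehat D_\infty}$ is not a Lip-norm on $\mathcal A_\infty$: the inductive limit is not a quantum compact metric space. -/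

import Mathlib

open Filter Topology MeasureTheory
open scoped ENNReal Matrix ContDiff

noncomputable section

namespace SelfCovering

/-! ### Seminorms of commutators, normic radii and Lip-norms -/

section General

/-- The bounded operator described by `P` (used only for properties `P` that determine the operator
uniquely); it is `0` if there is no such bounded operator. -/
def opOf {H : Type*} [NormedAddCommGroup H] [NormedSpace ℂ H]
    (P : (H →L[ℂ] H) → Prop) : H →L[ℂ] H :=
  open Classical in if h : ∃ T, P T then h.choose else 0

/-- `‖[D, x]‖` for a (usually unbounded) operator `D` and a bounded operator `x`: it is `∞` unless `x`
preserves the domain of `D`, and else the norm of `D x - x D` on the domain of `D`. -/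
def commSeminorm {H : Type*} [NormedAddCommGroup H] [NormedSpace ℂ H]
    (D : H →ₗ.[ℂ] H) (x : H →L[ℂ] H) : ℝ≥0∞ :=
  open Classical in
  if h : ∀ ξ : D.domain, x (ξ : H) ∈ D.domain then
    ⨆ ξ : D.domain, ⨆ _ : ‖(ξ : H)‖ ≤ 1, ‖D ⟨x (ξ : H), h ξ⟩ - x (D ξ)‖ₑ
  else ⊤

/-- The operator whose graph is (the closed linear span of) a given set of pairs. -/
def opOfGraph {H : Type*} [NormedAddCommGroup H] [NormedSpace ℂ H]
    (Γ : Set (H × H)) : H →ₗ.[ℂ] H :=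
  (Submodule.span ℂ Γ).topologicalClosure.toLinearPMap

/-- The unital C*-algebra of operators generated by a set of operators. -/
def cstarGen {H : Type*} [NormedAddCommGroup H] [InnerProductSpace ℂ H] [CompleteSpace H]
    (S : Set (H →L[ℂ] H)) : StarSubalgebra ℂ (H →L[ℂ] H) :=
  (StarAlgebra.adjoin ℂ S).topologicalClosure

/-- The seminorm `L_D(x) = ‖[D, x]‖` on a C*-algebra `A` of operators. -/
def lipSeminorm {H : Type*} [NormedAddCommGroup H] [InnerProductSpace ℂ H] [CompleteSpace H]
    (D : H →ₗ.[ℂ] H) (A : StarSubalgebra ℂ (H →L[ℂ] H)) (x : A) : ℝ≥0∞ :=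
  commSeminorm D (x : H →L[ℂ] H)

variable {A : Type*} [NormedRing A] [NormedAlgebra ℂ A]

/-- The quotient norm of the class of `x` in `A / ℂ1`. -/
def quotNorm (x : A) : ℝ :=
  ‖(Submodule.Quotient.mk x : A ⧸ Submodule.span ℂ {(1 : A)})‖

/-- The normic radius of the ball `{x ∈ A : L x ≤ 1}`: the supremum of the quotient norms in `A / ℂ1`
of its elements. -/
def normicRadius (L : A → ℝ≥0∞) : ℝ≥0∞ :=
  ⨆ x : A, ⨆ _ : L x ≤ 1, ENNReal.ofReal (quotNorm x)

/-- The ball `{x ∈ A : L x ≤ 1}` is totally bounded in `A / ℂ1`. -/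
def BallTotallyBounded (L : A → ℝ≥0∞) : Prop :=
  TotallyBounded
    ((fun x : A => (Submodule.Quotient.mk x : A ⧸ Submodule.span ℂ {(1 : A)})) '' {x | L x ≤ 1})

/-- The state space, with the weak* topology (as a subspace of `WeakDual ℂ A`). -/
def stateSpace (A : Type*) [NormedRing A] [NormedAlgebra ℂ A] [StarRing A] : Set (WeakDual ℂ A) :=
  {φ | φ 1 = 1 ∧ ∀ x : A, 0 ≤ (φ (star x * x)).re ∧ (φ (star x * x)).im = 0}

/-- The pseudometric `ρ_L` on the state space (it may take the value `∞`). -/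
def stateDist [StarRing A] (L : A → ℝ≥0∞) (φ ψ : stateSpace A) : ℝ≥0∞ :=
  ⨆ x : A, ⨆ _ : L x ≤ 1, ‖φ.1 x - ψ.1 x‖ₑ

/-- `L` is a Lip-norm, i.e. `(A, L)` is a quantum compact metric space: the topology of the
pseudometric `ρ_L` on the state space is the weak* topology. -/
def IsLipNorm [StarRing A] (L : A → ℝ≥0∞) : Prop :=
  ∀ φ : stateSpace A, 𝓝 φ = ⨅ (ε : ℝ≥0∞) (_ : 0 < ε), 𝓟 {ψ | stateDist L φ ψ < ε}

end General

/-- The elements `x n` have finite nonzero seminorm, so that the rescaled elements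
`y n = x n / L n (x n)` have constant seminorm `1`; and the quotient norms of the `y n` tend to
infinity. -/
def UnboundedSeq {A : ℕ → Type*} [∀ n, NormedRing (A n)] [∀ n, NormedAlgebra ℂ (A n)]
    (L : ∀ n, A n → ℝ≥0∞) (x : ∀ n, A n) : Prop :=
  (∀ n, 0 < L n (x n) ∧ L n (x n) < ⊤) ∧
  (∀ n, L n (((L n (x n)).toReal : ℂ)⁻¹ • x n) = 1) ∧
  Tendsto (fun n => quotNorm (((L n (x n)).toReal : ℂ)⁻¹ • x n)) atTop atTop

/-- `UnboundedSeq` for a sequence in a single algebra. -/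
def UnboundedSeqIn {A : Type*} [NormedRing A] [NormedAlgebra ℂ A]
    (L : A → ℝ≥0∞) (x : ℕ → A) : Prop :=
  UnboundedSeq (A := fun _ => A) (fun _ => L) x

/-! ### The Hilbert space of the UHF algebra, with coefficients

`X = κ^P` carries the product of the uniform probability measures. The space `L²(X × ⨁_P κ)` with
`ξ (x, k)` standing for the value at the pair `(x, y)`, `y = x - k`, of sequences that differ in
finitely many places, is `L²(UHF, τ)` for the UHF algebra `⨂_P M_κ(ℂ)` and its trace (a local matrix
`a` is the vector `(x, y) ↦ a_{x y}`); matrices act on `x` and leave `y` alone. -/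

section UHFModel

instance finsuppMeasurableSpace (P κ : Type*) [Zero κ] : MeasurableSpace (P →₀ κ) := ⊤

variable (P κ : Type*) [Fintype κ] [AddCommGroup κ] [MeasurableSpace κ]

/-- The measure of the tail equivalence relation, in the coordinates `(x, x - y)`. -/
def tailMeasure : Measure ((P → κ) × (P →₀ κ)) :=
  (Measure.infinitePi fun _ : P => (PMF.uniformOfFintype κ).toMeasure).prod Measure.count

/-- The Hilbert space `E ⊗ L²(⨂_P M_κ(ℂ), τ)`. -/
abbrev TailSpace (E : Type*) [NormedAddCommGroup E] : Type _ :=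
  Lp E 2 (tailMeasure P κ)

variable {P κ}

/-- Replace the first `n` letters of `x` by `j`, keeping `y = x - k` fixed. -/
def replaceWord {κ : Type*} [AddCommGroup κ] (n : ℕ) (j : Fin n → κ)
    (w : (ℕ → κ) × (ℕ →₀ κ)) : (ℕ → κ) × (ℕ →₀ κ) :=
  (fun i => if h : i < n then j ⟨i, h⟩ else w.1 i,
    w.2 + ∑ i : Fin n, Finsupp.single (i : ℕ) (j i - w.1 i))

/-- The action on `E ⊗ L²(⨂_ℕ M_κ(ℂ), τ)` of `T ∈ B(E) ⊗ M_κ(ℂ)^{⊗ n}`, given as a matrix with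
entries in `B(E)`, through the embedding `T ↦ T ⊗ 1` into `B(E) ⊗ UHF`. -/
def amplify {E : Type*} [NormedAddCommGroup E] [NormedSpace ℂ E] (n : ℕ)
    (T : (Fin n → κ) → (Fin n → κ) → (E →L[ℂ] E)) :
    TailSpace ℕ κ E →L[ℂ] TailSpace ℕ κ E :=
  opOf fun S => ∀ ξ : TailSpace ℕ κ E, ∀ᵐ w ∂(tailMeasure ℕ κ),
    (S ξ : (ℕ → κ) × (ℕ →₀ κ) → E) w =
      ∑ j : Fin n → κ, T (fun i => w.1 i) j ((ξ : (ℕ → κ) × (ℕ →₀ κ) → E) (replaceWord n j w))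

/-- The operator `D₀ ⊗ I + C` on `E ⊗ L²(⨂_ℕ M_κ(ℂ), τ)`, where `C` is the diagonal operator given by
a function `c` of the sequence `x` with values in `B(E)`. -/
def diracPlus {E : Type*} [NormedAddCommGroup E] [NormedSpace ℂ E]
    (D₀ : E →ₗ.[ℂ] E) (c : (ℕ → κ) → (E →L[ℂ] E)) :
    TailSpace ℕ κ E →ₗ.[ℂ] TailSpace ℕ κ E :=
  opOfGraph {z | ∀ᵐ w ∂(tailMeasure ℕ κ),
    ((z.1 : (ℕ → κ) × (ℕ →₀ κ) → E) w,
      (z.2 : (ℕ → κ) × (ℕ →₀ κ) → E) w - c w.1 ((z.1 : (ℕ → κ) × (ℕ →₀ κ) → E) w)) ∈ D₀.graph}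

end UHFModel

/-! ### Covering matrices -/

/-- A purely expanding integer matrix `B` with `|det B| > 1`. -/
structure CoveringMatrix (p : ℕ) where
  mat : Matrix (Fin p) (Fin p) ℤ
  one_lt_det : 1 < |mat.det|
  expanding : ∀ v : Fin p → ℝ, v ≠ 0 →
    Tendsto (fun n : ℕ => ‖(mat.map (Int.cast : ℤ → ℝ) ^ n) *ᵥ v‖) atTop atTop

namespace CoveringMatrix

variable {p : ℕ} (B : CoveringMatrix p)

/-- `B` as a real matrix. -/
def real : Matrix (Fin p) (Fin p) ℝ := B.mat.map (Int.cast : ℤ → ℝ)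

/-- `A = (Bᵀ)⁻¹`. -/
def dual : Matrix (Fin p) (Fin p) ℝ := (B.realᵀ)⁻¹

/-- The dual group `A ℤ^p / ℤ^p` of `ℤ^p / B ℤ^p`, identified through `A` with `ℤ^p / Bᵀ ℤ^p`. -/
def Digit : Type := (Fin p → ℤ) ⧸ LinearMap.range (B.matᵀ).mulVecLin

instance : AddCommGroup B.Digit :=
  inferInstanceAs (AddCommGroup ((Fin p → ℤ) ⧸ LinearMap.range (B.matᵀ).mulVecLin))

instance : MeasurableSpace B.Digit := ⊤

instance : Finite B.Digit := by
  change Finite ((Fin p → ℤ) ⧸ LinearMap.range (B.matᵀ).mulVecLin)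
  have hdet : B.mat.det ≠ 0 := by
    intro h
    have := B.one_lt_det
    simp [h] at this
  apply Module.finite_of_fg_torsion
  intro x
  induction x using Submodule.Quotient.induction_on with
  | H z =>
    refine ⟨⟨B.mat.det, mem_nonZeroDivisors_of_ne_zero hdet⟩, ?_⟩
    change B.mat.det • (Submodule.Quotient.mk z :
      (Fin p → ℤ) ⧸ LinearMap.range (B.matᵀ).mulVecLin) = 0
    rw [← Submodule.Quotient.mk_smul, Submodule.Quotient.mk_eq_zero]
    refine ⟨(B.matᵀ).adjugate *ᵥ z, ?_⟩
    rw [Matrix.mulVecLin_apply, Matrix.mulVec_mulVec, Matrix.mul_adjugate, Matrix.smul_mulVec,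
      Matrix.one_mulVec, Matrix.det_transpose]

instance : Fintype B.Digit := Fintype.ofFinite _

/-- The section `s` with values in `A ℤ^p ∩ [0,1)^p`. -/
def sec (k : B.Digit) : Fin p → ℝ := fun i =>
  Int.fract ((B.dual *ᵥ (fun l => ((Quotient.out k : Fin p → ℤ) l : ℝ))) i)

/-- `s_1(j_1) + ⋯ + s_n(j_n)`, where `s_{h+1} = A^h s`. -/
def wordSum {n : ℕ} (j : Fin n → B.Digit) : Fin p → ℝ :=
  ∑ h : Fin n, (B.dual ^ (h : ℕ)) *ᵥ B.sec (j h)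

/-- `∑_h s_h(x_h)` for an infinite sequence `x`. -/
def seqSum (x : ℕ → B.Digit) : Fin p → ℝ :=
  ∑' h : ℕ, (B.dual ^ h) *ᵥ B.sec (x h)

/-- The vector `A^k e₁`. -/
def freq (k : ℕ) : Fin p → ℝ :=
  (B.dual ^ k) *ᵥ (fun i => if (i : ℕ) = 0 then 1 else 0)

/-- The fundamental domain `B^n [0,1)^p` of `ℝ^p / B^n ℤ^p`. -/
def fundDom (n : ℕ) : Set (Fin p → ℝ) :=
  (fun u => (B.real ^ n) *ᵥ u) '' Set.pi Set.univ (fun _ => Set.Ico (0 : ℝ) 1)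

/-- The group `G_n = A^n ℤ^p`. -/
def group (n : ℕ) : AddSubgroup (Fin p → ℝ) :=
  ((B.dual ^ n).mulVecLin.toAddMonoidHom.comp
    ((Int.castAddHom ℝ).compLeft (Fin p))).range

/-- The group `G_∞ = ⋃ G_n` (an increasing union). -/
def groupLimit : AddSubgroup (Fin p → ℝ) := ⨆ n, B.group n

end CoveringMatrix

/-- Self-adjoint matrices that satisfy the Clifford relations. -/
def IsClifford {m N : ℕ} (ε : Fin m → Matrix (Fin N) (Fin N) ℂ) : Prop :=
  (∀ a, (ε a).IsHermitian) ∧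
  ∀ a b, ε a * ε b + ε b * ε a = if a = b then 2 else 0

/-! ### Tori and rational rotation algebras

Both are treated as algebras of functions `f : ℝ^p → M_q(ℂ)` with `f = γ_g(f)` for `g ∈ B^n ℤ^p`, where
`γ_g(f)(t) = u_g f(t - g) u_g*` for given unitary matrices `u_g`; for tori `q = 1` and `u_g = 1`. -/

section Tori

variable {p q N : ℕ} (B : CoveringMatrix p) (u : (Fin p → ℤ) → Matrix (Fin q) (Fin q) ℂ)

/-- `γ_g(f)(t) = u_g f(t - g) u_g*`. -/
def translate (g : Fin p → ℤ) (f : (Fin p → ℝ) → Matrix (Fin q) (Fin q) ℂ) :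
    (Fin p → ℝ) → Matrix (Fin q) (Fin q) ℂ :=
  fun t => u g * f (t - fun i => (g i : ℝ)) * (u g)ᴴ

/-- `f = γ_g(f)` for all `g ∈ B^n ℤ^p`. -/
def IsInvariant (n : ℕ) (f : (Fin p → ℝ) → Matrix (Fin q) (Fin q) ℂ) : Prop :=
  ∀ m : Fin p → ℤ, f = translate u ((B.mat ^ n) *ᵥ m) f

/-- The fibre `ℂ^N ⊗ M_q(ℂ)`, with the Hilbert-Schmidt norm on `M_q(ℂ)`. -/
abbrev Fibre (N q : ℕ) : Type := EuclideanSpace ℂ (Fin N × Fin q × Fin q)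

/-- Left multiplication by a matrix `M ∈ M_q(ℂ)`. -/
def leftMul (M : Matrix (Fin q) (Fin q) ℂ) (v : Fibre N q) : Fibre N q :=
  WithLp.toLp 2 fun i => ∑ c, M i.2.1 c * v (i.1, c, i.2.2)

/-- The action of a matrix on the spinor factor `ℂ^N`. -/
def spinMul (M : Matrix (Fin N) (Fin N) ℂ) (v : Fibre N q) : Fibre N q :=
  WithLp.toLp 2 fun i => ∑ j, M i.1 j * v (j, i.2)

/-- Lebesgue measure on the fundamental domain of `ℝ^p / B^n ℤ^p`, divided by `q |det B|^n`. -/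
def torusMeasure (q n : ℕ) : Measure (Fin p → ℝ) :=
  ((q * B.mat.det.natAbs ^ n : ℕ) : ℝ≥0∞)⁻¹ • volume.restrict (B.fundDom n)

/-- The Hilbert space `ℂ^N ⊗ L²(A_n, τ_n)`, where `τ_n(f) = (q |det B|^n)⁻¹ ∫ tr f(t) dt`. -/
abbrev TorusSpace (N q n : ℕ) : Type := Lp (Fibre N q) 2 (torusMeasure B q n)

/-- The operator of left multiplication by the function `f`. -/
def mulOp (N n : ℕ) (f : (Fin p → ℝ) → Matrix (Fin q) (Fin q) ℂ) :
    TorusSpace B N q n →L[ℂ] TorusSpace B N q n :=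
  opOf fun T => ∀ ξ : TorusSpace B N q n, ∀ᵐ t ∂(torusMeasure B q n),
    (T ξ : (Fin p → ℝ) → Fibre N q) t = leftMul (f t) ((ξ : (Fin p → ℝ) → Fibre N q) t)

/-- The operator `M ⊗ I` for a matrix `M` that acts on the spinors. -/
def spinOp (n : ℕ) (M : Matrix (Fin N) (Fin N) ℂ) :
    TorusSpace B N q n →L[ℂ] TorusSpace B N q n :=
  opOf fun T => ∀ ξ : TorusSpace B N q n, ∀ᵐ t ∂(torusMeasure B q n),
    (T ξ : (Fin p → ℝ) → Fibre N q) t = spinMul M ((ξ : (Fin p → ℝ) → Fibre N q) t)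

/-- The C*-algebra `A_n` of continuous functions with `f = γ_g(f)` for `g ∈ B^n ℤ^p`, acting by
multiplication. -/
def torusAlg (N n : ℕ) :
    StarSubalgebra ℂ (TorusSpace B N q n →L[ℂ] TorusSpace B N q n) :=
  cstarGen {T | ∃ f, Continuous f ∧ IsInvariant B u n f ∧ T = mulOp B N n f}

/-- The Dirac operator `D_n = -i c ∑_a ε^a ⊗ ∂_a`: the closure of this differential operator on the
smooth spinors on the `n`-th covering. -/
def torusDirac (ε : Fin p → Matrix (Fin N) (Fin N) ℂ) (c : ℝ) (n : ℕ) :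
    TorusSpace B N q n →ₗ.[ℂ] TorusSpace B N q n :=
  opOfGraph {z | ∃ φ : (Fin p → ℝ) → Fibre N q,
    ContDiff ℝ ∞ φ ∧
    (∀ i, IsInvariant B u n (fun t => Matrix.of fun a b => φ t (i, a, b))) ∧
    (z.1 : (Fin p → ℝ) → Fibre N q) =ᵐ[torusMeasure B q n] φ ∧
    (z.2 : (Fin p → ℝ) → Fibre N q) =ᵐ[torusMeasure B q n] fun t =>
      (-Complex.I * c) • ∑ a, spinMul (ε a) (fderiv ℝ φ t (Pi.single a 1))}

/-- The exponential `e^{2πi ⟨v, t⟩}`. -/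
def character (v t : Fin p → ℝ) : ℂ := Complex.exp (2 * Real.pi * Complex.I * (v ⬝ᵥ t : ℝ))

/-- The entry `(j, k)` of the matrix over `A_0` that represents `f ∈ A_n`: the spectral component of
`f` for the class of `S(j) - S(k)`, where `S(j) = s_1(j_1) + ⋯ + s_n(j_n)`, multiplied by the
function `e^{2πi ⟨S(j) - S(k), t⟩}`; the sum runs over representatives of `ℤ^p / B^n ℤ^p`. -/
def matrixEntry (n : ℕ) (f : (Fin p → ℝ) → Matrix (Fin q) (Fin q) ℂ) (j k : Fin n → B.Digit) :
    (Fin p → ℝ) → Matrix (Fin q) (Fin q) ℂ :=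
  fun t => ((B.mat.det.natAbs ^ n : ℕ) : ℂ)⁻¹ •
    ∑ᶠ g ∈ {g : Fin p → ℤ | (fun i => (g i : ℝ)) ∈ B.fundDom n},
      character (B.wordSum j - B.wordSum k) (t - fun i => (g i : ℝ)) • translate u g f t

/-- The space `H_0 ⊗ L²(R, τ)`. -/
abbrev TorusLimitSpace (N q : ℕ) : Type := TailSpace ℕ B.Digit (TorusSpace B N q 0)

/-- The image of `f ∈ A_n` in `B(H_0) ⊗ M_r^{⊗ n} ⊆ B(H_0) ⊗ R`. -/
def torusEmbed (N n : ℕ) (f : (Fin p → ℝ) → Matrix (Fin q) (Fin q) ℂ) :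
    TorusLimitSpace B N q →L[ℂ] TorusLimitSpace B N q :=
  amplify n fun j k => mulOp B N 0 (matrixEntry B u n f j k)

/-- The inductive limit `A_∞`, as the closure of the union of the images of the `A_n`. -/
def torusLimitAlg (N : ℕ) :
    StarSubalgebra ℂ (TorusLimitSpace B N q →L[ℂ] TorusLimitSpace B N q) :=
  cstarGen {T | ∃ n f, Continuous f ∧ IsInvariant B u n f ∧ T = torusEmbed B u N n f}

/-- `D_∞ = D_0 ⊗ I - 2π c ∑_a ε^a ⊗ I ⊗ (∑_h I^{⊗ h-1} ⊗ diag(s_h(·)^a))`. -/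
def torusLimitDirac (ε : Fin p → Matrix (Fin N) (Fin N) ℂ) (c : ℝ) :
    TorusLimitSpace B N q →ₗ.[ℂ] TorusLimitSpace B N q :=
  diracPlus (torusDirac B u ε c 0) fun x =>
    spinOp B 0 (-∑ a, ((2 * Real.pi * c * B.seqSum x a : ℝ) : ℂ) • ε a)

end Tori

/-- The matrix `U_0` of the rational rotation algebra with `θ = m / q`. -/
def rotU (m q : ℕ) : Matrix (Fin q) (Fin q) ℂ :=
  Matrix.diagonal fun k => Complex.exp (2 * Real.pi * Complex.I * ((k : ℕ) * m / q))

/-- The cyclic permutation matrix `V_0`. -/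
def rotV (q : ℕ) : Matrix (Fin q) (Fin q) ℂ :=
  Matrix.of fun h k => if (k : ℕ) = ((h : ℕ) + 1) % q then 1 else 0

/-- The unitaries `V_0^{g_1} U_0^{-g_2}`, `g ∈ ℤ²`. -/
def rotTwist (m q : ℕ) (g : Fin 2 → ℤ) : Matrix (Fin q) (Fin q) ℂ :=
  rotV q ^ (g 0) * rotU m q ^ (-(g 1))

/-! ### Crossed products -/

section Crossed

variable {H : Type*} [NormedAddCommGroup H] [InnerProductSpace ℂ H] [CompleteSpace H]

/-- `(ℒ, H, D)` is a spectral triple over the unital C*-algebra `Z ⊆ B(H)`. -/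
structure IsSpectralTriple (Z ℒ : StarSubalgebra ℂ (H →L[ℂ] H)) (D : H →ₗ.[ℂ] H) : Prop where
  isClosed : IsClosed (Z : Set (H →L[ℂ] H))
  le : ℒ ≤ Z
  dense : Z ≤ ℒ.topologicalClosure
  dense_domain : Dense (D.domain : Set H)
  selfAdjoint : IsSelfAdjoint D
  bounded_comm : ∀ a ∈ ℒ, commSeminorm D a < ⊤
  compact_resolvent : ∃ R : H →L[ℂ] H, IsCompactOperator R ∧
    ∀ ξ : D.domain, R (D ξ + Complex.I • (ξ : H)) = ξ

variable {p N : ℕ} (B : CoveringMatrix p) (Z : StarSubalgebra ℂ (H →L[ℂ] H))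

/-- An action of `G_∞` on `Z`. -/
abbrev LimitAction : Type _ := Multiplicative B.groupLimit →* (Z ≃⋆ₐ[ℂ] Z)

/-- The Hilbert space `H ⊗ ℂ^N ⊗ ℓ²(G)`. -/
abbrev CrossedSpace (H : Type*) [NormedAddCommGroup H] (N : ℕ) (G : AddSubgroup (Fin p → ℝ)) :
    Type _ :=
  lp (fun _ : G => PiLp 2 fun _ : Fin N => H) 2

/-- `U_h`, for `h ∈ G`: `(U_h ξ)(g) = ξ(g - h)`. -/
def shiftOp (N : ℕ) (G : AddSubgroup (Fin p → ℝ)) (h : Fin p → ℝ) :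
    CrossedSpace H N G →L[ℂ] CrossedSpace H N G :=
  opOf fun T => ∀ (ξ : CrossedSpace H N G) (g g' : G),
    (g' : Fin p → ℝ) = (g : Fin p → ℝ) - h → T ξ g = ξ g'

variable {B Z}

/-- `π_G(z)`, for `G ⊆ G_∞`: `(π_G(z) ξ)(g) = ρ_g⁻¹(z) ξ(g)`. -/
def crossedRep (ρ : LimitAction B Z) (N : ℕ) (G : AddSubgroup (Fin p → ℝ)) (z : Z) :
    CrossedSpace H N G →L[ℂ] CrossedSpace H N G :=
  opOf fun T => ∀ (ξ : CrossedSpace H N G) (g : G) (g' : B.groupLimit) (i : Fin N),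
    (g' : Fin p → ℝ) = g → T ξ g i = ((ρ (Multiplicative.ofAdd g'))⁻¹ z : H →L[ℂ] H) (ξ g i)

/-- The crossed product `A_n = Z ⋊ G_n`. -/
def crossedAlg (ρ : LimitAction B Z) (N n : ℕ) :
    StarSubalgebra ℂ (CrossedSpace H N (B.group n) →L[ℂ] CrossedSpace H N (B.group n)) :=
  cstarGen (Set.range (crossedRep ρ N (B.group n)) ∪
    {T | ∃ h ∈ B.group n, T = shiftOp N (B.group n) h})

/-- The matrix `ℓ(v) = ∑_μ v_μ ε_{μ+1}`. -/
def cliffordLength (ε : Fin (p + 1) → Matrix (Fin N) (Fin N) ℂ) (v : Fin p → ℝ) :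
    Matrix (Fin N) (Fin N) ℂ :=
  ∑ μ : Fin p, (v μ : ℂ) • ε μ.succ

variable (B)

/-- `D_n = D ⊗ ε_1 ⊗ I + I ⊗ M_{ℓ_n}`, on `H ⊗ ℂ^N ⊗ ℓ²(G_n)`. -/
def crossedDirac (D : H →ₗ.[ℂ] H) (ε : Fin (p + 1) → Matrix (Fin N) (Fin N) ℂ) (n : ℕ) :
    CrossedSpace H N (B.group n) →ₗ.[ℂ] CrossedSpace H N (B.group n) :=
  opOfGraph {z | ∀ g : B.group n, ∃ ζ : Fin N → H,
    (∀ j, (z.1 g j, ζ j) ∈ D.graph) ∧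
    ∀ i, z.2 g i = ∑ j, ε 0 i j • ζ j + ∑ j, cliffordLength ε (g : Fin p → ℝ) i j • z.1 g j}

/-- The space `H_0 ⊗ L²(R, τ)`. -/
abbrev CrossedLimitSpace (H : Type*) [NormedAddCommGroup H] [InnerProductSpace ℂ H] (N : ℕ) :
    Type _ :=
  TailSpace ℕ B.Digit (CrossedSpace H N (B.group 0))

/-- `D_∞ = D_0 ⊗ I + C`, where `C` acts at the sequence `x` as the matrix `∑_h ℓ(s_h(x_h))`. -/
def crossedLimitDirac (D : H →ₗ.[ℂ] H) (ε : Fin (p + 1) → Matrix (Fin N) (Fin N) ℂ) :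
    CrossedLimitSpace B H N →ₗ.[ℂ] CrossedLimitSpace B H N :=
  diracPlus (crossedDirac B D ε 0) fun x =>
    opOf fun T => ∀ (ξ : CrossedSpace H N (B.group 0)) (g : B.group 0) (i : Fin N),
      T ξ g i = ∑ j, cliffordLength ε (B.seqSum x) i j • ξ g j

/-- The image of `U_h`, `h ∈ G_n`, in `B(H_0) ⊗ M_r^{⊗ n} ⊆ B(H_0) ⊗ R`: the matrix with entries
`U_{h + S(k) - S(j)}` where this index lies in `G_0`, and `0` elsewhere, with
`S(j) = s_1(j_1) + ⋯ + s_n(j_n)`. -/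
def limitShift (H : Type*) [NormedAddCommGroup H] [InnerProductSpace ℂ H] [CompleteSpace H]
    (N n : ℕ) (h : Fin p → ℝ) :
    CrossedLimitSpace B H N →L[ℂ] CrossedLimitSpace B H N :=
  amplify n fun j k => open Classical in
    if h + B.wordSum k - B.wordSum j ∈ B.group 0 then
      shiftOp N (B.group 0) (h + B.wordSum k - B.wordSum j)
    else 0

variable {B}

/-- The representation of `Z` on `H_0 ⊗ L²(R, τ)` that, together with the operators `limitShift`,
represents `A_∞ = Z ⋊ G_∞`: at `m ∈ G_0` and at the pair `(x, y)` of sequences, `y = x - k`, the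
element `z` acts as `ρ_d⁻¹(z)`, where `d = m + ∑_h (s_h(x_h) - s_h(y_h)) ∈ G_∞`. (With `y` fixed, `d`
runs through `G_∞` once, so that this is a multiple of the regular representation on `ℓ²(G_∞)`.) -/
def limitRep (ρ : LimitAction B Z) (N : ℕ) (z : Z) :
    CrossedLimitSpace B H N →L[ℂ] CrossedLimitSpace B H N :=
  opOf fun T => ∀ ξ : CrossedLimitSpace B H N, ∀ᵐ w ∂(tailMeasure ℕ B.Digit),
    ∀ (m : B.group 0) (i : Fin N) (d : B.groupLimit),
      (d : Fin p → ℝ) = (m : Fin p → ℝ) + ∑ h ∈ w.2.support,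
        (B.dual ^ h) *ᵥ (B.sec (w.1 h) - B.sec (w.1 h - w.2 h)) →
      (T ξ : (ℕ → B.Digit) × (ℕ →₀ B.Digit) → CrossedSpace H N (B.group 0)) w m i =
        ((ρ (Multiplicative.ofAdd d))⁻¹ z : H →L[ℂ] H)
          ((ξ : (ℕ → B.Digit) × (ℕ →₀ B.Digit) → CrossedSpace H N (B.group 0)) w m i)

/-- A representation of `Z` on `H_0 ⊗ L²(R, τ)` is covariant with respect to the operators
`limitShift`. -/
def IsCovariant (ρ : LimitAction B Z) (N : ℕ)
    (Φ : Z → (CrossedLimitSpace B H N →L[ℂ] CrossedLimitSpace B H N)) : Prop :=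
  ∀ (n : ℕ) (h : B.groupLimit), (h : Fin p → ℝ) ∈ B.group n → ∀ z,
    limitShift B H N n h * Φ z * star (limitShift B H N n h) = Φ (ρ (Multiplicative.ofAdd h) z)

/-- The C*-algebra `A_∞` generated by a representation of `Z` on `H_0 ⊗ L²(R, τ)` and by the images of
the unitaries `U_h`, `h ∈ G_∞`. -/
def crossedLimitAlg (N : ℕ)
    (Φ : Z → (CrossedLimitSpace B H N →L[ℂ] CrossedLimitSpace B H N)) :
    StarSubalgebra ℂ (CrossedLimitSpace B H N →L[ℂ] CrossedLimitSpace B H N) :=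
  cstarGen (Set.range Φ ∪ {T | ∃ n, ∃ h ∈ B.group n, T = limitShift B H N n h})

end Crossed

/-! ### UHF algebras -/

section UHF

variable (r : ℕ) [NeZero r] (P : Set ℤ)

/-- The Hilbert space `L²(⨂_P M_r(ℂ), τ)`. -/
abbrev UHFSpace : Type := TailSpace P (Fin r) ℂ

variable {r}

/-- The matrix `b` at the site `i`. -/
def siteOp (b : Matrix (Fin r) (Fin r) ℂ) (i : P) : UHFSpace r P →L[ℂ] UHFSpace r P :=
  opOf fun T => ∀ ξ : UHFSpace r P, ∀ᵐ w ∂(tailMeasure P (Fin r)),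
    (T ξ : (P → Fin r) × (P →₀ Fin r) → ℂ) w = ∑ c : Fin r, b (w.1 i) c *
      (ξ : (P → Fin r) × (P →₀ Fin r) → ℂ)
        (open Classical in Function.update w.1 i c, w.2 + Finsupp.single i (c - w.1 i))

variable (r)

/-- The UHF algebra `⨂_P M_r(ℂ)`. -/
def uhfAlg : StarSubalgebra ℂ (UHFSpace r P →L[ℂ] UHFSpace r P) :=
  cstarGen {T | ∃ b i, T = siteOp P b i}

/-- The closed subspace `L²(⨂_{i ∈ P, i ≤ k} M_r(ℂ), τ)`: the closure of the set of vectors `a Ω`, where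
`a` is in the algebra generated by the matrices at the sites `i ≤ k`, and `Ω` is the vector of the
trace (the indicator function of the diagonal `x = y`). -/
def localSubspace (k : ℤ) : Submodule ℂ (UHFSpace r P) :=
  (Submodule.span ℂ {v | ∃ a ∈ StarAlgebra.adjoin ℂ {T | ∃ b, ∃ i : P, (i : ℤ) ≤ k ∧ T = siteOp P b i},
    ∃ Ω : UHFSpace r P,
      ((Ω : (P → Fin r) × (P →₀ Fin r) → ℂ) =ᵐ[tailMeasure P (Fin r)]
        fun w => if w.2 = 0 then 1 else 0) ∧ v = a Ω}).topologicalClosure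

instance (k : ℤ) : CompleteSpace (localSubspace r P k) :=
  Submodule.topologicalClosure.completeSpace _

/-- The projection `Q_k = P_k - P_{k-1}`, where `P_k` is the projection onto the `k`-th local subspace. -/
def levelProj (k : ℤ) : UHFSpace r P →L[ℂ] UHFSpace r P :=
  (localSubspace r P k).starProjection - (localSubspace r P (k - 1)).starProjection

/-- The Dirac operator `∑_k r^{ks} Q_k` on `L²(⨂_P M_r(ℂ), τ)`, with its natural domain. -/
def uhfDirac (s : ℝ) : UHFSpace r P →ₗ.[ℂ] UHFSpace r P :=
  opOfGraph {z | HasSum (fun k : ℤ => (((r : ℝ) ^ ((k : ℝ) * s) : ℝ) : ℂ) • levelProj r P k z.1) z.2}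

end UHF

end SelfCovering

end

open SelfCovering

noncomputable section

set_option linter.unusedSectionVars false

namespace SelfCovering

/-! ### Graphs of unbounded operators and commutator seminorms -/

section Operators

variable {H : Type*} [NormedAddCommGroup H] [NormedSpace ℂ H]

/-! The elements `x_n` have commutators that shrink to zero, while they stay at a fixed distance
from the scalars. Dividing by the seminorm therefore makes the quotient norm explode, both along the
sequence `A_n` and inside `A_∞`. Everything reduces to these two facts, which
`unboundedSeq_of_tendsto` combines.

In cases 1–3, `x_n` is a unitary of frequency `v = A^n e₁`, and `[D_n, x_n] = C(v) x_n` with `C(v) =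
∑_a v_a C_a` for Clifford generators `C_a` up to a common scale. Since `C(v)²` is a scalar multiple
of `|v|²`, the seminorm is exactly that scale times `|v|` (`norm_vecOp`, `commSeminorm_eq_ofReal`).
Pure expansion of `B` puts all eigenvalues of `A` inside the open unit disc
(`norm_lt_one_of_mem_spectrum`), so `v → 0`.

On the limit space `x_n` becomes a matrix with one nonzero entry in each row and column, because
translation by `v ∈ G_n` permutes the words that represent `G_n / G_0` (`exists_wordPerm`). The
entry in row `j` is a unitary of `A_0` whose frequency is `v` corrected by the word sums of `j` and
`π j`. The commutator with `D_0` sees the corrected frequency; the diagonal part of the limit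
operator contributes precisely the opposite correction. What remains is again `C(v)` times an
isometry (`diracPlus_twist`), so the seminorms agree for every `n`. The distance to the scalars is
witnessed by a unit vector that is orthogonal to its image.

In case 4 the matrix at site `-n` commutes with `P_k` for all `k ≥ -n`, so only the levels `k ≤ -n`
enter the commutator. Their weights form a geometric series of size `r^{-ns}`
(`exists_commutator_diagGraph`, `hasSum_geometric_le`). The commutator is not zero, because the
matrix moves the trace vector out of the preceding local subspace (`siteOp_traceVec_notMem`).

The failure of the Lip-norm property is shown directly. An operator far from the scalars separates
two vector states (`exists_vectors_inner_sub`), so vector states have unbounded distance from a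
fixed one; moving a small step towards them gives states that converge weak* but keep distance at
least `1` (`not_isLipNorm_of_tendsto`).

Domains are handled through graphs throughout: if `(e, f) ↦ (x e, x f + F e)` preserves the graph of
`D`, then `x` preserves the domain and `[D, x] = F` there. Operators specified by a property or by a
graph need existence, respectively closability, before they can be used. -/

lemma opOf_spec {P : (H →L[ℂ] H) → Prop} (h : ∃ T, P T) : P (opOf P) := by
  unfold opOf
  rw [dif_pos h]
  exact h.choose_spec

/-- The hypothesis is closability. Only for a single-valued subspace does `toLinearPMap` keep the
given graph, so every use must first exclude pairs `(0, f)` with `f ≠ 0` from the closure. -/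
lemma opOfGraph_graph {Γ : Set (H × H)}
    (hΓ : ∀ z ∈ (Submodule.span ℂ Γ).topologicalClosure, z.1 = 0 → z.2 = 0) :
    (opOfGraph Γ).graph = (Submodule.span ℂ Γ).topologicalClosure :=
  Submodule.toLinearPMap_graph_eq _ hΓ

/-- If the graph of `D` is stable under `(e, f) ↦ (x e, x f + F e)`, then `[D, x] = F`. -/
lemma commSeminorm_eq {D : H →ₗ.[ℂ] H} {x : H →L[ℂ] H} {F : H → H}
    (h : ∀ e f, (e, f) ∈ D.graph → (x e, x f + F e) ∈ D.graph) :
    commSeminorm D x = ⨆ ξ : D.domain, ⨆ _ : ‖(ξ : H)‖ ≤ 1, ‖F ξ‖ₑ := by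
  have key : ∀ ξ : D.domain, ∃ y : D.domain, (y : H) = x ξ ∧ D y = x (D ξ) + F ξ := by
    intro ξ
    have := h ξ (D ξ) (D.mem_graph ξ)
    rw [LinearPMap.mem_graph_iff] at this
    exact this
  have hdom : ∀ ξ : D.domain, x (ξ : H) ∈ D.domain := by
    intro ξ
    obtain ⟨y, hy, -⟩ := key ξ
    rw [← hy]; exact y.2
  unfold commSeminorm
  rw [dif_pos hdom]
  refine iSup_congr fun ξ => iSup_congr fun _ => ?_
  obtain ⟨y, hy, hy'⟩ := key ξ
  have : (⟨x ξ, hdom ξ⟩ : D.domain) = y := Subtype.ext hy.symm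
  rw [this, hy']
  congr 1
  abel

lemma commSeminorm_le {D : H →ₗ.[ℂ] H} {x : H →L[ℂ] H} {F : H → H}
    (h : ∀ e f, (e, f) ∈ D.graph → (x e, x f + F e) ∈ D.graph) {C : ℝ} (hC : 0 ≤ C)
    (hF : ∀ e, ‖F e‖ ≤ C * ‖e‖) :
    commSeminorm D x ≤ ENNReal.ofReal C := by
  rw [commSeminorm_eq h]
  refine iSup_le fun ξ => iSup_le fun hξ => ?_
  rw [← ofReal_norm]
  apply ENNReal.ofReal_le_ofReal
  refine (hF ξ).trans ?_
  nlinarith [norm_nonneg (ξ : H)]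

lemma commSeminorm_pos {D : H →ₗ.[ℂ] H} {x : H →L[ℂ] H} {F : H → H}
    (h : ∀ e f, (e, f) ∈ D.graph → (x e, x f + F e) ∈ D.graph) {e : H} (he : e ∈ D.domain)
    (he1 : ‖e‖ ≤ 1) (hF : F e ≠ 0) : 0 < commSeminorm D x := by
  rw [commSeminorm_eq h]
  refine lt_of_lt_of_le ?_ (le_iSup₂_of_le (⟨e, he⟩ : D.domain) he1 le_rfl)
  simpa using hF

/-- The norm of a commutator that is a multiple of an isometry. -/
lemma commSeminorm_eq_ofReal {D : H →ₗ.[ℂ] H} {x : H →L[ℂ] H} {F : H → H}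
    (h : ∀ e f, (e, f) ∈ D.graph → (x e, x f + F e) ∈ D.graph) {C : ℝ}
    (hF : ∀ e, ‖F e‖ = C * ‖e‖) (hD : ∃ e ∈ D.domain, e ≠ 0) :
    commSeminorm D x = ENNReal.ofReal C := by
  obtain ⟨e, he, he0⟩ := hD
  have hn : 0 < ‖e‖ := norm_pos_iff.2 he0
  have hC : 0 ≤ C := by
    have := norm_nonneg (F e)
    rw [hF] at this
    exact nonneg_of_mul_nonneg_left this hn
  refine le_antisymm (commSeminorm_le h hC fun e => (hF e).le) ?_
  rw [commSeminorm_eq h]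
  have hn' : ‖((‖e‖⁻¹ : ℝ) : ℂ) • e‖ = 1 := by
    rw [norm_smul]; simp [hn.ne']
  refine le_trans ?_ (le_iSup₂_of_le
    (⟨((‖e‖⁻¹ : ℝ) : ℂ) • e, D.domain.smul_mem _ he⟩ : D.domain) hn'.le le_rfl)
  rw [← ofReal_norm, hF, hn', mul_one]

/-- The twist is a continuous linear map of `H × H`, so stability passes from generators to their
span and then to the closure. Commutators thus need computing only on a core. -/
lemma mem_closure_span_of_twist {Γ : Set (H × H)} {x F : H →L[ℂ] H}
    (h : ∀ z ∈ Γ, (x z.1, x z.2 + F z.1) ∈ Γ) {z : H × H}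
    (hz : z ∈ (Submodule.span ℂ Γ).topologicalClosure) :
    (x z.1, x z.2 + F z.1) ∈ (Submodule.span ℂ Γ).topologicalClosure := by
  let Θ : H × H →L[ℂ] H × H :=
    (x.comp (ContinuousLinearMap.fst ℂ H H)).prod
      (x.comp (ContinuousLinearMap.snd ℂ H H) + F.comp (ContinuousLinearMap.fst ℂ H H))
  have h1 : Submodule.span ℂ Γ ≤ (Submodule.span ℂ Γ).comap (Θ : H × H →ₗ[ℂ] H × H) :=
    Submodule.span_le.2 fun z hz => Submodule.subset_span (h z hz)
  have h2 : Set.MapsTo Θ (Submodule.span ℂ Γ : Set (H × H)) (Submodule.span ℂ Γ) := h1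
  exact h2.closure Θ.continuous hz

/-- `opOfGraph` version of the previous statement. -/
lemma opOfGraph_twist {Γ : Set (H × H)}
    (hΓ : ∀ z ∈ (Submodule.span ℂ Γ).topologicalClosure, z.1 = 0 → z.2 = 0)
    {x F : H →L[ℂ] H} (h : ∀ z ∈ Γ, (x z.1, x z.2 + F z.1) ∈ Γ) (e f : H)
    (hef : (e, f) ∈ (opOfGraph Γ).graph) : (x e, x f + F e) ∈ (opOfGraph Γ).graph := by
  rw [opOfGraph_graph hΓ] at hef ⊢
  exact mem_closure_span_of_twist h hef

lemma mem_opOfGraph_domain {Γ : Set (H × H)} {e f : H} (h : (e, f) ∈ Γ) :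
    e ∈ (opOfGraph Γ).domain := by
  refine ⟨(e, f), ?_, rfl⟩
  exact Submodule.le_topologicalClosure _ (Submodule.subset_span h)

/-- The graph of an operator given by a closed subspace. -/
lemma opOfGraph_graph_of_isClosed {Γ : Set (H × H)} (S : Submodule ℂ (H × H)) (hS : (S : Set _) = Γ)
    (hc : IsClosed Γ) (hΓ : ∀ z ∈ Γ, z.1 = 0 → z.2 = 0) {z : H × H} :
    z ∈ (opOfGraph Γ).graph ↔ z ∈ Γ := by
  have h : (Submodule.span ℂ Γ).topologicalClosure = S := by
    rw [← hS, Submodule.span_eq]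
    apply SetLike.coe_injective
    rw [Submodule.topologicalClosure_coe, hS, hc.closure_eq]
  rw [opOfGraph_graph, h, ← hS]
  · rfl
  · intro z hz
    rw [h] at hz
    exact hΓ z (hS ▸ hz)

lemma commSeminorm_smul (D : H →ₗ.[ℂ] H) (x : H →L[ℂ] H) {c : ℂ} (hc : c ≠ 0) :
    commSeminorm D (c • x) = ‖c‖ₑ * commSeminorm D x := by
  have hiff : (∀ ξ : D.domain, (c • x) (ξ : H) ∈ D.domain) ↔ ∀ ξ : D.domain, x ξ ∈ D.domain := by
    refine forall_congr' fun ξ => ?_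
    rw [_root_.smul_apply]
    exact Submodule.smul_mem_iff _ hc
  unfold commSeminorm
  by_cases h : ∀ ξ : D.domain, x ξ ∈ D.domain
  · rw [dif_pos h, dif_pos (hiff.2 h)]
    simp only [ENNReal.mul_iSup]
    refine iSup_congr fun ξ => iSup_congr fun _ => ?_
    rw [← enorm_smul, smul_sub]
    have : (⟨(c • x) (ξ : H), hiff.2 h ξ⟩ : D.domain) = c • ⟨x ξ, h ξ⟩ := rfl
    rw [this, LinearPMap.map_smul, _root_.smul_apply]
  · rw [dif_neg h, dif_neg (fun h' => h (hiff.1 h')), ENNReal.mul_top]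
    simpa using hc

end Operators

/-! ### Vector states, weak* convergence and distance to the scalars -/

section States

variable {H : Type*} [NormedAddCommGroup H] [InnerProductSpace ℂ H]


/-- A vector that is far from being an eigenvector yields two vector states that differ at `x`. -/
lemma exists_vectors_inner_sub (x : H →L[ℂ] H) {ξ : H} (hξ : ‖ξ‖ = 1) {c : ℝ} (hc : 0 < c)
    (h : ∀ a : ℂ, c ≤ ‖x ξ - a • ξ‖) :
    ∃ η η' : H, ‖η‖ = 1 ∧ ‖η'‖ = 1 ∧ c ≤ ‖(inner ℂ η (x η)) - (inner ℂ η' (x η'))‖ := by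
  -- `y` is the part of `x ξ` orthogonal to `ξ`; its direction `z` gives a second basis vector, and
  -- the states come from unit vectors in the plane of `ξ` and `z`.
  set y := x ξ - (inner ℂ ξ (x ξ)) • ξ with hy
  have hξξ : (inner ℂ ξ ξ) = 1 := by rw [inner_self_eq_norm_sq_to_K, hξ]; simp
  have hyn : c ≤ ‖y‖ := h _
  have hy0 : (‖y‖ : ℂ) ≠ 0 := by
    have : 0 < ‖y‖ := hc.trans_le hyn
    exact_mod_cast this.ne'
  have hξy : (inner ℂ ξ y) = 0 := by
    rw [hy, inner_sub_right, inner_smul_right, hξξ, mul_one, sub_self]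
  set z := (‖y‖ : ℂ)⁻¹ • y with hz
  have hξz : (inner ℂ ξ z) = 0 := by rw [hz, inner_smul_right, hξy, mul_zero]
  have hzξ : (inner ℂ z ξ) = 0 := by rw [← inner_conj_symm, hξz, map_zero]
  have hzn : ‖z‖ = 1 := by
    rw [hz, norm_smul, norm_inv, Complex.norm_real, norm_norm]
    exact inv_mul_cancel₀ (by exact_mod_cast hy0)
  have hzz : (inner ℂ z z) = 1 := by rw [inner_self_eq_norm_sq_to_K, hzn]; simp
  have hzx : (inner ℂ z (x ξ)) = ‖y‖ := by
    have : x ξ = y + (inner ℂ ξ (x ξ)) • ξ := by rw [hy]; abel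
    rw [this, inner_add_right, inner_smul_right, hzξ, mul_zero, add_zero, hz, inner_smul_left,
      inner_self_eq_norm_sq_to_K]
    simp only [map_inv₀, Complex.conj_ofReal, Complex.coe_algebraMap]
    field_simp
  set s : ℂ := ((√2 : ℝ) : ℂ)⁻¹ with hs
  have hs2 : s * s = 1 / 2 := by
    rw [hs, ← mul_inv, ← Complex.ofReal_mul, Real.mul_self_sqrt (by norm_num)]
    norm_num
  have hsc : (starRingEnd ℂ) s = s := by rw [hs, map_inv₀, Complex.conj_ofReal]
  have hin : ∀ a : ℂ, (inner ℂ (s • (ξ + a • z)) (s • (ξ + a • z))) = (1 + (starRingEnd ℂ) a * a) / 2 := by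
    intro a
    simp only [inner_smul_left, inner_smul_right, inner_add_left, inner_add_right, hξξ, hξz, hzξ,
      hzz, hsc]
    linear_combination (1 + (starRingEnd ℂ) a * a) * hs2
  have hnorm : ∀ a : ℂ, (starRingEnd ℂ) a * a = 1 → ‖s • (ξ + a • z)‖ = 1 := by
    intro a ha
    have h1 := hin a
    rw [ha, inner_self_eq_norm_sq_to_K] at h1
    have h2 : ‖s • (ξ + a • z)‖ ^ 2 = 1 := by
      have : ((‖s • (ξ + a • z)‖ ^ 2 : ℝ) : ℂ) = ((1 : ℝ) : ℂ) := by
        push_cast; rw [show (Complex.ofReal ‖s • (ξ + a • z)‖ ^ 2) = (1 + 1) / 2 from h1]; norm_num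
      exact_mod_cast this
    exact (pow_eq_one_iff_of_nonneg (norm_nonneg _) two_ne_zero).1 h2
  have hval : ∀ a : ℂ, (inner ℂ (s • (ξ + a • z)) (x (s • (ξ + a • z)))) = ((inner ℂ ξ (x ξ)) + a * (inner ℂ ξ (x z)) +
      (starRingEnd ℂ) a * ‖y‖ + (starRingEnd ℂ) a * a * (inner ℂ z (x z))) / 2 := by
    intro a
    simp only [map_smul, map_add, inner_smul_left, inner_smul_right, inner_add_left,
      inner_add_right, hzx, hsc]
    linear_combination ((inner ℂ ξ (x ξ)) + a * (inner ℂ ξ (x z)) +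
      (starRingEnd ℂ) a * ‖y‖ + (starRingEnd ℂ) a * a * (inner ℂ z (x z))) * hs2
  -- With `b = ⟨ξ, x z⟩`, the phases `±1` give the difference `b + ‖y‖` and the phases `±i` give `i
  -- (b - ‖y‖)`. These cannot both be smaller than `c`, because `2‖y‖ ≥ 2c`.
  by_cases hcase : c ≤ ‖(inner ℂ ξ (x z)) + ‖y‖‖
  · refine ⟨s • (ξ + (1 : ℂ) • z), s • (ξ + (-1 : ℂ) • z), hnorm 1 (by simp), hnorm (-1) (by simp), ?_⟩
    rw [hval, hval]
    convert hcase using 2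
    simp only [map_one, map_neg]
    ring
  · refine ⟨s • (ξ + Complex.I • z), s • (ξ + (-Complex.I) • z), hnorm _ (by simp),
      hnorm _ (by simp), ?_⟩
    rw [hval, hval]
    have : (((inner ℂ ξ (x ξ)) + Complex.I * (inner ℂ ξ (x z)) + (starRingEnd ℂ) Complex.I * ‖y‖ +
        (starRingEnd ℂ) Complex.I * Complex.I * (inner ℂ z (x z))) / 2 -
        ((inner ℂ ξ (x ξ)) + -Complex.I * (inner ℂ ξ (x z)) + (starRingEnd ℂ) (-Complex.I) * ‖y‖ +
        (starRingEnd ℂ) (-Complex.I) * -Complex.I * (inner ℂ z (x z))) / 2) =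
        Complex.I * (((inner ℂ ξ (x z)) + ‖y‖) - 2 * ‖y‖) := by
      simp only [Complex.conj_I, map_neg]
      ring
    rw [this, norm_mul, Complex.norm_I, one_mul]
    have h1 : ‖(2 * ‖y‖ : ℂ)‖ = 2 * ‖y‖ := by simp
    have h2 := norm_sub_norm_le (2 * ‖y‖ : ℂ) ((inner ℂ ξ (x z)) + ‖y‖)
    rw [norm_sub_rev (2 * ‖y‖ : ℂ), h1] at h2
    rw [not_le] at hcase
    linarith

variable [CompleteSpace H] (A : StarSubalgebra ℂ (H →L[ℂ] H))

/-- The vector functional `x ↦ ⟨ξ, x ξ⟩`. -/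
def vectorFunctional (ξ : H) : A →L[ℂ] ℂ :=
  LinearMap.mkContinuous
    { toFun := fun x => (inner ℂ ξ ((x : H →L[ℂ] H) ξ))
      map_add' := fun x y => by simp
      map_smul' := fun c x => by simp } (‖ξ‖ ^ 2) fun x => by
        refine (norm_inner_le_norm _ _).trans ?_
        have := (x : H →L[ℂ] H).le_opNorm ξ
        change ‖ξ‖ * ‖(x : H →L[ℂ] H) ξ‖ ≤ ‖ξ‖ ^ 2 * ‖(x : H →L[ℂ] H)‖
        nlinarith [norm_nonneg ξ]

/-- The vector state of a unit vector. -/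
def vectorState {ξ : H} (hξ : ‖ξ‖ = 1) : stateSpace A :=
  ⟨StrongDual.toWeakDual (vectorFunctional A ξ), by
    constructor
    · change (inner ℂ ξ ξ) = (1 : ℂ)
      rw [inner_self_eq_norm_sq_to_K, hξ]; simp
    · intro x
      have : (StrongDual.toWeakDual (vectorFunctional A ξ)) (star x * x) =
          ((‖(x : H →L[ℂ] H) ξ‖ ^ 2 : ℝ) : ℂ) := by
        change (inner ℂ ξ ((ContinuousLinearMap.adjoint (x : H →L[ℂ] H)) ((x : H →L[ℂ] H) ξ))) = _
        rw [ContinuousLinearMap.adjoint_inner_right, inner_self_eq_norm_sq_to_K]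
        simp
      rw [this]
      exact ⟨by rw [Complex.ofReal_re]; positivity, Complex.ofReal_im _⟩⟩

lemma vectorState_apply {ξ : H} (hξ : ‖ξ‖ = 1) (x : A) :
    (vectorState A hξ).1 x = (inner ℂ ξ ((x : H →L[ℂ] H) ξ)) := rfl

lemma norm_vectorState_le {ξ : H} (hξ : ‖ξ‖ = 1) (x : A) : ‖(vectorState A hξ).1 x‖ ≤ ‖x‖ := by
  rw [vectorState_apply]
  refine (norm_inner_le_norm _ _).trans ?_
  have := (x : H →L[ℂ] H).le_opNorm ξ
  rw [hξ, mul_one] at this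
  rw [hξ, one_mul]
  exact this

variable {A}

lemma convex_stateSpace {φ ψ : WeakDual ℂ A} (hφ : φ ∈ stateSpace A) (hψ : ψ ∈ stateSpace A)
    {t : ℝ} (ht : 0 ≤ t) (ht1 : t ≤ 1) :
    ((1 - t : ℝ) : ℂ) • φ + (t : ℂ) • ψ ∈ stateSpace A := by
  have happ : ∀ x, (((1 - t : ℝ) : ℂ) • φ + (t : ℂ) • ψ) x =
      ((1 - t : ℝ) : ℂ) * φ x + (t : ℂ) * ψ x := fun x => rfl
  constructor
  · rw [happ, hφ.1, hψ.1]; push_cast; ring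
  · intro x
    obtain ⟨h1, h2⟩ := hφ.2 x
    obtain ⟨h3, h4⟩ := hψ.2 x
    rw [happ, Complex.add_re, Complex.add_im, Complex.re_ofReal_mul, Complex.re_ofReal_mul,
      Complex.im_ofReal_mul, Complex.im_ofReal_mul, h2, h4]
    refine ⟨add_nonneg (mul_nonneg (by linarith) h1) (mul_nonneg ht h3), by ring⟩

/-- In a Lip-normed algebra the vector states have bounded distance from each other. -/
lemma not_isLipNorm_of_tendsto {L : A → ℝ≥0∞} {ξ₀ : H} (hξ₀ : ‖ξ₀‖ = 1) {ξ : ℕ → H}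
    (hξ : ∀ n, ‖ξ n‖ = 1) {x : ℕ → A} (hx : ∀ n, L (x n) ≤ 1)
    (h : Tendsto (fun n => ‖(vectorState A hξ₀).1 (x n) - (vectorState A (hξ n)).1 (x n)‖) atTop
      atTop) : ¬ IsLipNorm L := by
  intro hL
  set φ := vectorState A hξ₀ with hφ
  set d : ℕ → ℝ := fun n => ‖φ.1 (x n) - (vectorState A (hξ n)).1 (x n)‖ with hd
  have hmem : {ψ | stateDist L φ ψ < 1} ∈ 𝓝 φ := by
    rw [hL φ]
    exact mem_iInf_of_mem 1 (mem_iInf_of_mem one_pos (mem_principal_self _))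
  have hev : ∀ᶠ n in atTop, 1 ≤ d n := h.eventually_ge_atTop 1
  -- The weight of a convex combination: the minimum keeps it in `[0, 1]`, and once `d n ≥ 1` it
  -- equals `1 / d n`, so that `t n → 0` while `t n * d n = 1`.
  let t : ℕ → ℝ := fun n => min 1 (d n)⁻¹
  have ht0 : ∀ n, 0 ≤ t n := fun n => le_min zero_le_one (inv_nonneg.2 (norm_nonneg _))
  have ht1 : ∀ n, t n ≤ 1 := fun n => min_le_left _ _
  have ht : Tendsto t atTop (𝓝 0) :=
    squeeze_zero ht0 (fun n => min_le_right _ _) h.inv_tendsto_atTop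
  let ψ : ℕ → stateSpace A := fun n =>
    ⟨_, convex_stateSpace φ.2 (vectorState A (hξ n)).2 (ht0 n) (ht1 n)⟩
  have hψ : ∀ n y, φ.1 y - (ψ n).1 y = (t n : ℂ) * (φ.1 y - (vectorState A (hξ n)).1 y) := by
    intro n y
    change φ.1 y - (((1 - t n : ℝ) : ℂ) * φ.1 y + (t n : ℂ) * (vectorState A (hξ n)).1 y) = _
    push_cast; ring
  have hlim : Tendsto ψ atTop (𝓝 φ) := by
    rw [tendsto_subtype_rng]
    refine tendsto_iff_forall_eval_tendsto_topDualPairing.2 fun y => ?_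
    change Tendsto (fun n => (ψ n).1 y) atTop (𝓝 (φ.1 y))
    rw [tendsto_iff_norm_sub_tendsto_zero]
    refine squeeze_zero (fun n => norm_nonneg _) (g := fun n => t n * (2 * ‖y‖)) (fun n => ?_) ?_
    · rw [norm_sub_rev, hψ, norm_mul, Complex.norm_real, Real.norm_of_nonneg (ht0 n)]
      refine mul_le_mul_of_nonneg_left ?_ (ht0 n)
      refine (norm_sub_le _ _).trans ?_
      have h1 := norm_vectorState_le A hξ₀ y
      have h2 := norm_vectorState_le A (hξ n) y
      linarith
    · simpa using ht.mul_const (2 * ‖y‖)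
  obtain ⟨n, hn, hdn⟩ := ((hlim.eventually hmem).and hev).exists
  have h2 : (1 : ℝ≥0∞) ≤ stateDist L φ (ψ n) := by
    refine le_trans ?_ (le_iSup₂_of_le (x n) (hx n) le_rfl)
    rw [hψ, ← ofReal_norm, norm_mul, Complex.norm_real, Real.norm_of_nonneg (ht0 n)]
    have : t n = (d n)⁻¹ := min_eq_right (inv_le_one_of_one_le₀ hdn)
    rw [this, show ‖φ.1 (x n) - (vectorState A (hξ n)).1 (x n)‖ = d n from rfl,
      inv_mul_cancel₀ (by linarith), ENNReal.ofReal_one]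
  exact absurd hn (not_lt.2 h2)

/-- Every representative of the class is `x - a`, and its norm is at least the norm of its value at
the unit vector `ξ`. -/
lemma le_quotNorm (x : A) {ξ : H} (hξ : ‖ξ‖ = 1) {c : ℝ}
    (h : ∀ a : ℂ, c ≤ ‖(x : H →L[ℂ] H) ξ - a • ξ‖) : c ≤ quotNorm x := by
  unfold quotNorm
  refine QuotientAddGroup.le_norm_iff.2 fun m hm => ?_
  have hm' : x - m ∈ Submodule.span ℂ {(1 : A)} := by
    rw [← Submodule.Quotient.eq]
    exact hm.symm
  obtain ⟨a, ha⟩ := Submodule.mem_span_singleton.1 hm'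
  have hm2 : (m : H →L[ℂ] H) ξ = (x : H →L[ℂ] H) ξ - a • ξ := by
    have : m = x - a • 1 := by rw [ha]; abel
    rw [this]; rfl
  refine (h a).trans ?_
  rw [← hm2]
  have := (m : H →L[ℂ] H).le_opNorm ξ
  rw [hξ, mul_one] at this
  exact this

end States

/-! ### From small commutators to unbounded balls -/

section Radius

lemma quotNorm_smul {A : Type*} [NormedRing A] [NormedAlgebra ℂ A] (c : ℂ) (x : A) :
    quotNorm (c • x) = ‖c‖ * quotNorm x := by
  unfold quotNorm
  rw [Submodule.Quotient.mk_smul, norm_smul]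

lemma tendsto_normicRadius {A : ℕ → Type*} [∀ n, NormedRing (A n)] [∀ n, NormedAlgebra ℂ (A n)]
    {L : ∀ n, A n → ℝ≥0∞} {x : ∀ n, A n} (h : UnboundedSeq L x) :
    Tendsto (fun n => normicRadius (L n)) atTop (𝓝 ⊤) := by
  refine tendsto_nhds_top_mono (ENNReal.tendsto_ofReal_atTop.comp h.2.2) ?_
  filter_upwards with n
  exact le_iSup₂_of_le _ (h.2.1 n).le le_rfl

/-- Total boundedness implies boundedness, and the rescaled elements lie in the ball with quotient
norms tending to infinity. -/
lemma not_ballTotallyBounded {A : Type*} [NormedRing A] [NormedAlgebra ℂ A] {L : A → ℝ≥0∞}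
    {x : ℕ → A} (h : UnboundedSeqIn L x) : ¬ BallTotallyBounded L := by
  intro hb
  obtain ⟨C, hC⟩ := isBounded_iff_forall_norm_le.1 hb.isBounded
  obtain ⟨n, hn⟩ := (h.2.2.eventually_gt_atTop C).exists
  exact absurd (hC _ ⟨_, (h.2.1 n).le, rfl⟩) (not_le.2 hn)

variable {H : ℕ → Type*} [∀ n, NormedAddCommGroup (H n)] [∀ n, InnerProductSpace ℂ (H n)]
  [∀ n, CompleteSpace (H n)] {A : ∀ n, StarSubalgebra ℂ (H n →L[ℂ] H n)}

lemma lipSeminorm_smul {H : Type*} [NormedAddCommGroup H] [InnerProductSpace ℂ H]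
    [CompleteSpace H] (D : H →ₗ.[ℂ] H) (A : StarSubalgebra ℂ (H →L[ℂ] H)) (x : A) {c : ℂ}
    (hc : c ≠ 0) : lipSeminorm D A (c • x) = ‖c‖ₑ * lipSeminorm D A x :=
  commSeminorm_smul D (x : H →L[ℂ] H) hc

/-- Elements whose commutators with the Dirac operators tend to zero, but which stay away from the
scalars on some unit vectors. -/
lemma unboundedSeq_of_tendsto {D : ∀ n, H n →ₗ.[ℂ] H n} {x : ∀ n, A n}
    (hpos : ∀ n, 0 < lipSeminorm (D n) (A n) (x n))
    (hlim : Tendsto (fun n => lipSeminorm (D n) (A n) (x n)) atTop (𝓝 0))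
    (hfin : ∀ n, lipSeminorm (D n) (A n) (x n) < ⊤) {c : ℝ} (hc : 0 < c) {ξ : ∀ n, H n}
    (hξ : ∀ n, ‖ξ n‖ = 1)
    (h : ∀ n (a : ℂ), c ≤ ‖(x n : H n →L[ℂ] H n) (ξ n) - a • ξ n‖) :
    UnboundedSeq (fun n => lipSeminorm (D n) (A n)) x := by
  have hr : ∀ n, 0 < (lipSeminorm (D n) (A n) (x n)).toReal := fun n =>
    ENNReal.toReal_pos (hpos n).ne' (hfin n).ne
  have hnorm : ∀ n, ‖((lipSeminorm (D n) (A n) (x n)).toReal : ℂ)⁻¹‖ =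
      (lipSeminorm (D n) (A n) (x n)).toReal⁻¹ := fun n => by
    rw [norm_inv, Complex.norm_real, Real.norm_of_nonneg (hr n).le]
  refine ⟨fun n => ⟨hpos n, hfin n⟩, fun n => ?_, ?_⟩
  · dsimp only
    rw [lipSeminorm_smul _ _ _ (by exact_mod_cast (inv_pos.2 (hr n)).ne'), ← ofReal_norm, hnorm,
      ENNReal.ofReal_inv_of_pos (hr n), ENNReal.ofReal_toReal (hfin n).ne]
    exact ENNReal.inv_mul_cancel (hpos n).ne' (hfin n).ne
  · have h0 : Tendsto (fun n => (lipSeminorm (D n) (A n) (x n)).toReal) atTop (𝓝[>] 0) := by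
      refine tendsto_nhdsWithin_iff.2 ⟨?_, Eventually.of_forall hr⟩
      simpa [Function.comp_def] using (ENNReal.tendsto_toReal ENNReal.zero_ne_top).comp hlim
    have h1 := h0.inv_tendsto_nhdsGT_zero.atTop_mul_const hc
    refine tendsto_atTop_mono (fun n => ?_) h1
    rw [quotNorm_smul, hnorm]
    exact mul_le_mul_of_nonneg_left (le_quotNorm (x n) (hξ n) (h n)) (inv_nonneg.2 (hr n).le)

/-- The two vector states separated by `x n` vary with `n`, while `not_isLipNorm_of_tendsto` wants
one fixed base state. By the triangle inequality one of the two differs from the state of `ξ 0` by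
at least `c / 2` at `x n`. -/
lemma not_isLipNorm_of_unboundedSeqIn {H : Type*} [NormedAddCommGroup H] [InnerProductSpace ℂ H]
    [CompleteSpace H] {D : H →ₗ.[ℂ] H} {A : StarSubalgebra ℂ (H →L[ℂ] H)} {x : ℕ → A}
    (hpos : ∀ n, 0 < lipSeminorm D A (x n))
    (hlim : Tendsto (fun n => lipSeminorm D A (x n)) atTop (𝓝 0))
    (hfin : ∀ n, lipSeminorm D A (x n) < ⊤) {c : ℝ} (hc : 0 < c) {ξ : ℕ → H}
    (hξ : ∀ n, ‖ξ n‖ = 1) (h : ∀ n (a : ℂ), c ≤ ‖(x n : H →L[ℂ] H) (ξ n) - a • ξ n‖) :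
    ¬ IsLipNorm (lipSeminorm D A) := by
  have hr : ∀ n, 0 < (lipSeminorm D A (x n)).toReal := fun n =>
    ENNReal.toReal_pos (hpos n).ne' (hfin n).ne
  have hnorm : ∀ n, ‖((lipSeminorm D A (x n)).toReal : ℂ)⁻¹‖ =
      (lipSeminorm D A (x n)).toReal⁻¹ := fun n => by
    rw [norm_inv, Complex.norm_real, Real.norm_of_nonneg (hr n).le]
  have key : ∀ n, ∃ η : H, ∃ hη : ‖η‖ = 1,
      c / 2 ≤ ‖(vectorState A (hξ 0)).1 (x n) - (vectorState A hη).1 (x n)‖ := by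
    intro n
    obtain ⟨η, η', hη, hη', hd⟩ := exists_vectors_inner_sub (x n : H →L[ℂ] H) (hξ n) hc (h n)
    rw [← vectorState_apply A hη, ← vectorState_apply A hη'] at hd
    by_contra! hcon
    have h1 := hcon η hη
    have h2 := hcon η' hη'
    have h3 := norm_sub_le_norm_sub_add_norm_sub ((vectorState A hη).1 (x n))
      ((vectorState A (hξ 0)).1 (x n)) ((vectorState A hη').1 (x n))
    rw [norm_sub_rev] at h1
    linarith
  choose η hη hηd using key
  refine not_isLipNorm_of_tendsto (hξ 0) hη
    (x := fun n => ((lipSeminorm D A (x n)).toReal : ℂ)⁻¹ • x n) (fun n => ?_) ?_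
  · refine ((unboundedSeq_of_tendsto (D := fun _ => D) (A := fun _ => A) hpos hlim hfin hc hξ
      h).2.1 n).le
  · have h0 : Tendsto (fun n => (lipSeminorm D A (x n)).toReal) atTop (𝓝[>] 0) := by
      refine tendsto_nhdsWithin_iff.2 ⟨?_, Eventually.of_forall hr⟩
      simpa [Function.comp_def] using (ENNReal.tendsto_toReal ENNReal.zero_ne_top).comp hlim
    refine tendsto_atTop_mono (fun n => ?_)
      (h0.inv_tendsto_nhdsGT_zero.atTop_mul_const (half_pos hc))
    rw [map_smul, map_smul, ← smul_sub, norm_smul, hnorm]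
    exact mul_le_mul_of_nonneg_left (hηd n) (inv_nonneg.2 (hr n).le)

end Radius

namespace CoveringMatrix

variable {p : ℕ} (B : CoveringMatrix p)

/-! ### Decay of the powers of the dual matrix -/

lemma det_ne_zero : B.mat.det ≠ 0 := by
  intro h
  have := B.one_lt_det
  simp [h] at this

lemma det_real_ne_zero : B.real.det ≠ 0 := by
  have : B.real.det = (B.mat.det : ℝ) := (Int.cast_det B.mat).symm
  rw [this]
  exact_mod_cast B.det_ne_zero

lemma isUnit_det_transpose : IsUnit B.realᵀ.det := by
  rw [Matrix.det_transpose]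
  exact isUnit_iff_ne_zero.2 B.det_real_ne_zero

lemma dual_mul : B.dual * B.realᵀ = 1 := Matrix.nonsing_inv_mul _ B.isUnit_det_transpose

lemma mul_dual : B.realᵀ * B.dual = 1 := Matrix.mul_nonsing_inv _ B.isUnit_det_transpose

lemma dual_pow_mul (n : ℕ) : B.dual ^ n * B.realᵀ ^ n = 1 := by
  have : Commute B.dual B.realᵀ := by rw [Commute, SemiconjBy, B.dual_mul, B.mul_dual]
  rw [← this.mul_pow, B.dual_mul, one_pow]

lemma mul_dual_pow (n : ℕ) : B.realᵀ ^ n * B.dual ^ n = 1 := by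
  have : Commute B.realᵀ B.dual := by rw [Commute, SemiconjBy, B.dual_mul, B.mul_dual]
  rw [← this.mul_pow, B.mul_dual, one_pow]

lemma dual_pow_mulVec_injective (n : ℕ) : Function.Injective (B.dual ^ n).mulVec := by
  intro v w h
  have := congrArg (B.realᵀ ^ n).mulVec h
  simpa [Matrix.mulVec_mulVec, B.mul_dual_pow] using this

lemma pos {p : ℕ} (B : CoveringMatrix p) : 0 < p := by
  rcases Nat.eq_zero_or_pos p with rfl | h
  · have := B.one_lt_det
    simp at this
  · exact h

/-- An eigenvalue of modulus at least one would give a nonzero complex `w` with `μ B w = w`, hence a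
bounded orbit `B^n w`. The real and imaginary parts of `w` then have bounded orbits too, and
expansion forces both to vanish. -/
lemma norm_lt_one_of_mem_spectrum {μ : ℂ}
    (hμ : μ ∈ spectrum ℂ (B.dual.map (Complex.ofReal : ℝ → ℂ))) : ‖μ‖ < 1 := by
  by_contra! hcon
  set A' := B.dual.map (Complex.ofReal : ℝ → ℂ) with hA'
  set B' := B.real.map (Complex.ofReal : ℝ → ℂ) with hB'
  have hAB : A' * B'ᵀ = 1 := by
    have h := congrArg (fun M : Matrix (Fin p) (Fin p) ℝ => M.map (Complex.ofRealHom : ℝ →+* ℂ))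
      B.dual_mul
    simp only [Matrix.map_mul] at h
    rw [Matrix.map_one _ (map_zero _) (map_one _)] at h
    exact h
  have hdet : (algebraMap ℂ (Matrix (Fin p) (Fin p) ℂ) μ - A').det = 0 := by
    rw [spectrum.mem_iff, Matrix.isUnit_iff_isUnit_det, isUnit_iff_ne_zero, not_not] at hμ
    exact hμ
  -- Multiplying `μ - A` by `Bᵀ` on the right and transposing turns the characteristic equation of
  -- `A` into one for `B`.
  have hdet2 : (μ • B' - 1).det = 0 := by
    have h1 : ((algebraMap ℂ (Matrix (Fin p) (Fin p) ℂ) μ - A') * B'ᵀ)ᵀ = μ • B' - 1 := by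
      rw [sub_mul, hAB, Matrix.transpose_sub, Algebra.algebraMap_eq_smul_one, smul_mul_assoc,
        one_mul, Matrix.transpose_smul, Matrix.transpose_transpose, Matrix.transpose_one]
    rw [← h1, Matrix.det_transpose, Matrix.det_mul, hdet, zero_mul]
  obtain ⟨w, hw0, hw⟩ := Matrix.exists_mulVec_eq_zero_iff.2 hdet2
  have hw1 : μ • (B' *ᵥ w) = w := by
    rw [Matrix.sub_mulVec, Matrix.one_mulVec, Matrix.smul_mulVec, sub_eq_zero] at hw
    exact hw
  have hpow : ∀ n : ℕ, μ ^ n • ((B' ^ n) *ᵥ w) = w := by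
    intro n
    induction n with
    | zero => simp
    | succ n ih =>
      rw [pow_succ, pow_succ, mul_smul, ← Matrix.mulVec_mulVec, ← Matrix.mulVec_smul,
        hw1, ih]
  have hbd : ∀ n : ℕ, ‖(B' ^ n) *ᵥ w‖ ≤ ‖w‖ := by
    intro n
    calc ‖(B' ^ n) *ᵥ w‖ ≤ ‖μ ^ n‖ * ‖(B' ^ n) *ᵥ w‖ := by
          refine le_mul_of_one_le_left (norm_nonneg _) ?_
          rw [norm_pow]; exact one_le_pow₀ hcon
      _ = ‖w‖ := by rw [← norm_smul, hpow]
  have hBn : ∀ n : ℕ, B' ^ n = (B.real ^ n).map (Complex.ofReal : ℝ → ℂ) := by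
    intro n
    exact (Matrix.map_pow B.real (Complex.ofRealHom : ℝ →+* ℂ) n).symm
  -- To be used for `re` and `im`: being real-linear, `f` commutes with the real matrix `B^n`, so
  -- the orbit of `f ∘ w` is bounded by that of `w`.
  have hcomp : ∀ (f : ℂ →ₗ[ℝ] ℝ), (∀ z, |f z| ≤ ‖z‖) → (fun i => f (w i)) = 0 := by
    intro f hf
    by_contra hne
    have ht := B.expanding _ hne
    obtain ⟨n, hn⟩ := (ht.eventually_gt_atTop ‖w‖).exists
    refine absurd hn (not_lt.2 (le_trans ?_ (hbd n)))
    refine (pi_norm_le_iff_of_nonneg (norm_nonneg _)).2 fun i => ?_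
    refine le_trans ?_ (norm_le_pi_norm _ i)
    have : ((B.mat.map (Int.cast : ℤ → ℝ) ^ n) *ᵥ fun i => f (w i)) i = f ((B' ^ n *ᵥ w) i) := by
      rw [hBn, Matrix.mulVec, Matrix.mulVec, dotProduct, dotProduct, map_sum]
      refine Finset.sum_congr rfl fun j _ => ?_
      rw [Matrix.map_apply, ← smul_eq_mul (a := ((B.real ^ n) i j : ℂ)), Complex.coe_smul, map_smul]
      rfl
    rw [this]
    exact hf _
  have hre := hcomp Complex.reLm Complex.abs_re_le_norm
  have him := hcomp Complex.imLm Complex.abs_im_le_norm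
  exact hw0 (funext fun i => Complex.ext (congrFun hre i) (congrFun him i))

section Norms

attribute [local instance] Matrix.linftyOpNormedRing Matrix.linftyOpNormedAlgebra
  Matrix.linftyOpNormedAddCommGroup

/-- Gelfand's formula for the complexified matrix: with spectral radius below some `r < 1`,
eventually `‖A^n‖ ≤ r^n`. Complexification does not change the `ℓ^∞` operator norm. -/
lemma summable_norm_dual_pow :
    Summable fun n : ℕ => ‖(B.dual ^ n : Matrix (Fin p) (Fin p) ℝ)‖ := by
  have : Nonempty (Fin p) := ⟨⟨0, B.pos⟩⟩
  set A' := B.dual.map (Complex.ofReal : ℝ → ℂ) with hA'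
  have hn : ∀ n : ℕ, ‖A' ^ n‖ = ‖(B.dual ^ n : Matrix (Fin p) (Fin p) ℝ)‖ := by
    intro n
    have : A' ^ n = (B.dual ^ n).map (Complex.ofReal : ℝ → ℂ) :=
      (Matrix.map_pow B.dual (Complex.ofRealHom : ℝ →+* ℂ) n).symm
    rw [this, Matrix.linfty_opNorm_def, Matrix.linfty_opNorm_def]
    simp
  have : CompleteSpace (Matrix (Fin p) (Fin p) ℂ) := FiniteDimensional.complete ℂ _
  have hrad : spectralRadius ℂ A' < ((1 : NNReal) : ℝ≥0∞) :=
    spectrum.spectralRadius_lt_of_forall_lt A' fun z hz => by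
      exact_mod_cast B.norm_lt_one_of_mem_spectrum hz
  obtain ⟨r, hr1, hr2⟩ := ENNReal.lt_iff_exists_nnreal_btwn.1 hrad
  have hr2' : r < 1 := by exact_mod_cast hr2
  have hev := (spectrum.pow_nnnorm_pow_one_div_tendsto_nhds_spectralRadius A').eventually
    (gt_mem_nhds hr1)
  have hgeo : Summable fun n : ℕ => (r : ℝ) ^ n :=
    summable_geometric_of_lt_one r.2 (by exact_mod_cast hr2')
  refine hgeo.of_norm_bounded_eventually_nat ?_
  filter_upwards [hev, eventually_gt_atTop 0] with n hn1 hn0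
  rw [norm_norm, ← hn]
  have h2 : ((‖A' ^ n‖₊ : ℝ≥0∞) ^ (1 / (n : ℝ))) ^ (n : ℝ) ≤ (r : ℝ≥0∞) ^ (n : ℝ) :=
    ENNReal.rpow_le_rpow hn1.le (Nat.cast_nonneg n)
  rw [← ENNReal.rpow_mul, one_div, inv_mul_cancel₀ (by exact_mod_cast hn0.ne'), ENNReal.rpow_one,
    ENNReal.rpow_natCast] at h2
  exact_mod_cast h2

/-- This form mentions only norms of vectors, so that the locally chosen matrix norm is not needed
afterwards. -/
lemma exists_summable_bound : ∃ a : ℕ → ℝ, Summable a ∧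
    ∀ (h : ℕ) (v : Fin p → ℝ), ‖(B.dual ^ h) *ᵥ v‖ ≤ a h * ‖v‖ :=
  ⟨_, B.summable_norm_dual_pow, fun _ v => Matrix.linfty_opNorm_mulVec _ v⟩

end Norms

lemma norm_sec_le (k : B.Digit) : ‖B.sec k‖ ≤ 1 := by
  refine (pi_norm_le_iff_of_nonneg zero_le_one).2 fun i => ?_
  rw [sec, Real.norm_of_nonneg (Int.fract_nonneg _)]
  exact (Int.fract_lt_one _).le

lemma summable_seqSum (x : ℕ → B.Digit) : Summable fun h : ℕ => (B.dual ^ h) *ᵥ B.sec (x h) := by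
  obtain ⟨a, ha, hb⟩ := B.exists_summable_bound
  refine ha.of_norm_bounded fun h => (hb h _).trans ?_
  -- Nonnegativity is not part of the bound; it is recovered by testing on the constant vector `1`.
  have h0 : 0 ≤ a h := by
    have := (norm_nonneg _).trans (hb h (fun _ => 1))
    have h1 : (0 : ℝ) < ‖(fun _ => 1 : Fin p → ℝ)‖ := by
      have : Nonempty (Fin p) := ⟨⟨0, B.pos⟩⟩
      simp
    exact nonneg_of_mul_nonneg_left this h1
  exact mul_le_of_le_one_right h0 (B.norm_sec_le _)

lemma exists_norm_seqSum_le : ∃ C : ℝ, ∀ x : ℕ → B.Digit, ‖B.seqSum x‖ ≤ C := by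
  obtain ⟨a, ha, hb⟩ := B.exists_summable_bound
  refine ⟨∑' h, |a h|, fun x => ?_⟩
  refine tsum_of_norm_bounded ha.abs.hasSum fun h => (hb h _).trans ?_
  calc a h * ‖B.sec (x h)‖ ≤ |a h| * ‖B.sec (x h)‖ :=
        mul_le_mul_of_nonneg_right (le_abs_self _) (norm_nonneg _)
    _ ≤ |a h| := mul_le_of_le_one_right (abs_nonneg _) (B.norm_sec_le _)

lemma measurable_seqSum : Measurable fun x : ℕ → B.Digit => B.seqSum x := by
  refine measurable_of_tendsto_metrizable
    (f := fun n (x : ℕ → B.Digit) => ∑ h ∈ Finset.range n, (B.dual ^ h) *ᵥ B.sec (x h)) ?_ ?_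
  · intro n
    refine Finset.measurable_sum _ fun h _ => ?_
    exact (measurable_from_top (f := fun k : B.Digit => (B.dual ^ h) *ᵥ B.sec k)).comp
      (measurable_pi_apply h)
  · exact tendsto_pi_nhds.2 fun x => (B.summable_seqSum x).hasSum.tendsto_sum_nat

/-- The common tails cancel. This is what makes the infinite diagonal sum contribute only a finite
word sum to commutators with elements of `A_n`. -/
lemma seqSum_sub_seqSum {n : ℕ} {x y : ℕ → B.Digit} (h : ∀ i, n ≤ i → x i = y i) :
    B.seqSum x - B.seqSum y =
      B.wordSum (fun i : Fin n => x i) - B.wordSum (fun i : Fin n => y i) := by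
  have key : ∀ z : ℕ → B.Digit, B.seqSum z = B.wordSum (fun i : Fin n => z i) +
      ∑' i, (B.dual ^ (i + n)) *ᵥ B.sec (z (i + n)) := by
    intro z
    unfold seqSum wordSum
    rw [← (B.summable_seqSum z).sum_add_tsum_nat_add n, Finset.sum_range]
  rw [key x, key y]
  have : (fun i => (B.dual ^ (i + n)) *ᵥ B.sec (x (i + n))) =
      fun i => (B.dual ^ (i + n)) *ᵥ B.sec (y (i + n)) := by
    funext i
    rw [h _ (Nat.le_add_left n i)]
  rw [this]
  abel

lemma tendsto_freq : Tendsto B.freq atTop (𝓝 0) := by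
  obtain ⟨a, ha, hb⟩ := B.exists_summable_bound
  refine squeeze_zero_norm (fun n => hb n _) ?_
  simpa using ha.tendsto_atTop_zero.mul_const _

lemma freq_ne_zero (n : ℕ) : B.freq n ≠ 0 := by
  intro h
  have h0 := B.dual_pow_mulVec_injective n (h.trans (Matrix.mulVec_zero _).symm)
  have := congrFun h0 ⟨0, B.pos⟩
  simp at this

/-! ### Words and residue classes -/

lemma mem_group_iff {n : ℕ} {v : Fin p → ℝ} :
    v ∈ B.group n ↔ ∃ z : Fin p → ℤ, (B.dual ^ n) *ᵥ (fun i => (z i : ℝ)) = v := Iff.rfl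

lemma mem_group_zero {v : Fin p → ℝ} :
    v ∈ B.group 0 ↔ ∃ z : Fin p → ℤ, (fun i => (z i : ℝ)) = v := by
  simp [mem_group_iff]

lemma freq_mem_group (n : ℕ) : B.freq n ∈ B.group n := by
  refine B.mem_group_iff.2 ⟨fun i => if (i : ℕ) = 0 then 1 else 0, ?_⟩
  simp only [freq]
  congr 1
  funext i
  simp

lemma transpose_real_mulVec (z : Fin p → ℤ) :
    B.realᵀ *ᵥ (fun i => (z i : ℝ)) = fun i => ((B.matᵀ *ᵥ z) i : ℝ) := by
  funext i
  simp [Matrix.mulVec, dotProduct, real]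

lemma group_le_succ (n : ℕ) : B.group n ≤ B.group (n + 1) := by
  rintro v ⟨z, rfl⟩
  refine ⟨B.matᵀ *ᵥ z, ?_⟩
  change (B.dual ^ (n + 1)) *ᵥ (fun i => ((B.matᵀ *ᵥ z) i : ℝ)) = _
  rw [← B.transpose_real_mulVec, Matrix.mulVec_mulVec, pow_succ, mul_assoc, B.dual_mul, mul_one]
  rfl

lemma group_mono : Monotone B.group := monotone_nat_of_le_succ B.group_le_succ

/-- The section involves a chosen representative and a fractional part. The representative differs
from `m` by some `Bᵀ y`, and the integer part `f` removed is `A Bᵀ f`; both changes stay in `A Bᵀ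
ℤ^p`. -/
lemma exists_sec_eq (m : Fin p → ℤ) : ∃ z : Fin p → ℤ,
    B.sec (Submodule.Quotient.mk m) = B.dual *ᵥ (fun i => ((m + B.matᵀ *ᵥ z) i : ℝ)) := by
  set k : B.Digit := Submodule.Quotient.mk m with hk
  have h1 : (Quotient.out k : Fin p → ℤ) - m ∈ LinearMap.range (B.matᵀ).mulVecLin := by
    rw [← Submodule.Quotient.eq]
    exact Quotient.out_eq k
  obtain ⟨y, hy⟩ := h1
  set f : Fin p → ℤ := fun i => ⌊(B.dual *ᵥ (fun l => ((Quotient.out k : Fin p → ℤ) l : ℝ))) i⌋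
    with hf
  refine ⟨y - f, ?_⟩
  have h2 : B.sec k = B.dual *ᵥ (fun l => ((Quotient.out k : Fin p → ℤ) l : ℝ)) -
      fun i => (f i : ℝ) := by
    funext i
    simp only [sec, Pi.sub_apply, hf, Int.fract]
  have h3 : (fun i => (f i : ℝ)) = B.dual *ᵥ (fun i => ((B.matᵀ *ᵥ f) i : ℝ)) := by
    rw [← B.transpose_real_mulVec, Matrix.mulVec_mulVec, B.dual_mul, Matrix.one_mulVec]
  rw [h2, h3, ← Matrix.mulVec_sub]
  congr 1
  funext i
  have h4 : (Quotient.out k : Fin p → ℤ) i = m i + (B.matᵀ *ᵥ y) i := by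
    have := congrFun hy i
    simp only [Matrix.mulVecLin_apply, Pi.sub_apply] at this
    omega
  simp only [Pi.sub_apply, Pi.add_apply, Matrix.mulVec_sub, h4]
  push_cast
  ring

lemma dual_pow_succ_mulVec_transpose (n : ℕ) (z : Fin p → ℤ) :
    (B.dual ^ (n + 1)) *ᵥ (fun i => ((B.matᵀ *ᵥ z) i : ℝ)) =
      (B.dual ^ n) *ᵥ (fun i => (z i : ℝ)) := by
  rw [← B.transpose_real_mulVec, Matrix.mulVec_mulVec, pow_succ, mul_assoc, B.dual_mul, mul_one]

lemma pow_mulVec_sec_mem (n : ℕ) (k : B.Digit) : (B.dual ^ n) *ᵥ B.sec k ∈ B.group (n + 1) := by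
  obtain ⟨m, rfl⟩ := Submodule.Quotient.mk_surjective _ k
  obtain ⟨z, hz⟩ := B.exists_sec_eq m
  refine B.mem_group_iff.2 ⟨m + B.matᵀ *ᵥ z, ?_⟩
  rw [hz, Matrix.mulVec_mulVec, ← pow_succ]

lemma wordSum_succ {n : ℕ} (j : Fin (n + 1) → B.Digit) :
    B.wordSum j = B.wordSum (fun i : Fin n => j i.castSucc) + (B.dual ^ n) *ᵥ B.sec (j (Fin.last n)) := by
  unfold wordSum
  rw [Fin.sum_univ_castSucc]
  rfl

lemma wordSum_mem {n : ℕ} (j : Fin n → B.Digit) : B.wordSum j ∈ B.group n := by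
  refine AddSubgroup.sum_mem _ fun h _ => ?_
  exact B.group_mono h.2 (B.pow_mulVec_sec_mem _ _)

/-- Digit expansion: subtracting the last digit, the class of the integer vector modulo `Bᵀ ℤ^p`,
moves an element of `G_{n+1}` into `G_n`. -/
lemma exists_wordSum (n : ℕ) : ∀ v ∈ B.group n, ∃ j : Fin n → B.Digit,
    v - B.wordSum j ∈ B.group 0 := by
  induction n with
  | zero => exact fun v hv => ⟨Fin.elim0, by simpa [wordSum] using hv⟩
  | succ n ih =>
    intro v hv
    obtain ⟨m, rfl⟩ := B.mem_group_iff.1 hv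
    obtain ⟨k, z, hz⟩ : ∃ (k : B.Digit) (z : Fin p → ℤ),
        B.sec k = B.dual *ᵥ (fun i => ((m + B.matᵀ *ᵥ z) i : ℝ)) := ⟨_, B.exists_sec_eq m⟩
    have h1 : (B.dual ^ (n + 1)) *ᵥ (fun i => (m i : ℝ)) -
        (B.dual ^ n) *ᵥ B.sec k ∈ B.group n := by
      refine B.mem_group_iff.2 ⟨-z, ?_⟩
      rw [hz, Matrix.mulVec_mulVec, ← pow_succ, ← Matrix.mulVec_sub,
        ← B.dual_pow_succ_mulVec_transpose]
      congr 1
      funext i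
      simp [Matrix.mulVec_neg]
    obtain ⟨j, hj⟩ := ih _ h1
    refine ⟨Fin.snoc j k, ?_⟩
    rw [wordSum_succ]
    simp only [Fin.snoc_castSucc, Fin.snoc_last]
    convert hj using 1
    abel

/-- All terms but the last lie in `G_n`, so the last digits agree modulo `G_n` and hence as classes;
after cancelling them the shorter words are compared. -/
lemma wordSum_injective (n : ℕ) : ∀ j k : Fin n → B.Digit,
    B.wordSum j - B.wordSum k ∈ B.group 0 → j = k := by
  induction n with
  | zero => exact fun j k _ => Subsingleton.elim _ _
  | succ n ih =>
    intro j k hjk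
    have hlast : j (Fin.last n) = k (Fin.last n) := by
      obtain ⟨a, ha⟩ := Submodule.Quotient.mk_surjective _ (j (Fin.last n))
      obtain ⟨b, hb⟩ := Submodule.Quotient.mk_surjective _ (k (Fin.last n))
      obtain ⟨y, hy⟩ := B.exists_sec_eq a
      obtain ⟨z, hz⟩ := B.exists_sec_eq b
      have h1 : (B.dual ^ n) *ᵥ B.sec (j (Fin.last n)) - (B.dual ^ n) *ᵥ B.sec (k (Fin.last n)) ∈
          B.group n := by
        have h2 := B.group_mono (Nat.zero_le n) hjk
        rw [wordSum_succ, wordSum_succ] at h2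
        have h3 := B.wordSum_mem (fun i : Fin n => j i.castSucc)
        have h4 := B.wordSum_mem (fun i : Fin n => k i.castSucc)
        convert (B.group n).add_mem ((B.group n).sub_mem h2 h3) h4 using 1
        abel
      obtain ⟨c, hc⟩ := B.mem_group_iff.1 h1
      rw [← Matrix.mulVec_sub] at hc
      have h5 := B.dual_pow_mulVec_injective n hc
      rw [← ha, ← hb, hy, hz, ← Matrix.mulVec_sub] at h5
      have h6 := congrArg (B.realᵀ).mulVec h5
      rw [Matrix.mulVec_mulVec, B.mul_dual, Matrix.one_mulVec, transpose_real_mulVec] at h6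
      rw [← ha, ← hb]
      refine (Submodule.Quotient.eq _).2 ⟨c - y + z, ?_⟩
      funext i
      have h7 := congrFun h6 i
      simp only [Pi.sub_apply, Pi.add_apply] at h7
      norm_cast at h7
      simp only [Matrix.mulVecLin_apply, Matrix.mulVec_add, Matrix.mulVec_sub, Pi.add_apply,
        Pi.sub_apply]
      omega
    have hinit := ih (fun i => j i.castSucc) (fun i => k i.castSucc) (by
      rw [wordSum_succ, wordSum_succ, hlast, add_sub_add_right_eq_sub] at hjk
      exact hjk)
    funext i
    refine Fin.lastCases hlast (fun i => ?_) i
    exact congrFun hinit i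

/-- Translation by `v ∈ G_n` permutes the words of length `n`, which represent `G_n / G_0`. -/
lemma exists_wordPerm {n : ℕ} {v : Fin p → ℝ} (hv : v ∈ B.group n) :
    ∃ π : Equiv.Perm (Fin n → B.Digit), ∀ j k,
      v + B.wordSum j - B.wordSum k ∈ B.group 0 ↔ k = π j := by
  have h1 : ∀ j : Fin n → B.Digit, ∃ k, v + B.wordSum j - B.wordSum k ∈ B.group 0 := fun j =>
    B.exists_wordSum n _ ((B.group n).add_mem hv (B.wordSum_mem j))
  choose f hf using h1
  have hinj : Function.Injective f := by
    intro j j' h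
    refine B.wordSum_injective n _ _ ?_
    convert (B.group 0).sub_mem (hf j) (hf j') using 1
    rw [h]
    abel
  refine ⟨Equiv.ofBijective f (Finite.injective_iff_bijective.1 hinj), fun j k => ⟨fun h => ?_, ?_⟩⟩
  · refine B.wordSum_injective n _ _ ?_
    change B.wordSum k - B.wordSum (f j) ∈ B.group 0
    convert (B.group 0).sub_mem (hf j) h using 1
    abel
  · rintro rfl
    exact hf j

end CoveringMatrix

/-! ### Characters -/

section Character

variable {p : ℕ}

lemma character_add_left (v w t : Fin p → ℝ) :
    character (v + w) t = character v t * character w t := by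
  unfold character
  rw [← Complex.exp_add, add_dotProduct]
  push_cast
  ring_nf

lemma character_add_right (v s t : Fin p → ℝ) :
    character v (s + t) = character v s * character v t := by
  unfold character
  rw [← Complex.exp_add, dotProduct_add]
  push_cast
  ring_nf

@[simp] lemma character_zero_right (v : Fin p → ℝ) : character v 0 = 1 := by simp [character]

lemma norm_character (v t : Fin p → ℝ) : ‖character v t‖ = 1 := by
  unfold character
  rw [Complex.norm_exp]
  simp

lemma character_neg_right (v t : Fin p → ℝ) : character v (-t) = (character v t)⁻¹ := by
  refine eq_inv_of_mul_eq_one_left ?_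
  rw [← character_add_right, neg_add_cancel, character_zero_right]

lemma contDiff_character (v : Fin p → ℝ) : ContDiff ℝ ∞ (character v) := by
  have h : ContDiff ℝ ∞ fun t : Fin p → ℝ => v ⬝ᵥ t := by
    unfold dotProduct
    fun_prop
  unfold character
  exact Complex.contDiff_exp.comp
    (contDiff_const.mul ((Complex.ofRealCLM.contDiff (n := ∞)).comp h))

lemma continuous_character (v : Fin p → ℝ) : Continuous (character v) :=
  (contDiff_character v).continuous

/-- Along the line `t + x s` the character is a one-variable exponential, whose derivative at `x =
0` is the directional derivative. -/
lemma hasFDerivAt_character (v t s : Fin p → ℝ) :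
    fderiv ℝ (character v) t s = (2 * Real.pi * Complex.I * (v ⬝ᵥ s : ℝ)) * character v t := by
  have h1 : HasDerivAt (fun x : ℝ => t + x • s) s 0 := by
    simpa using ((hasDerivAt_id (0 : ℝ)).smul_const s).const_add t
  have h2 : HasDerivAt (fun x : ℝ => character v (t + x • s)) (fderiv ℝ (character v) t s) 0 := by
    have h3 : HasFDerivAt (character v) (fderiv ℝ (character v) t) (t + (0 : ℝ) • s) := by
      rw [zero_smul, add_zero]
      exact ((contDiff_character v).differentiable (by simp)).differentiableAt.hasFDerivAt
    exact h3.comp_hasDerivAt 0 h1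
  have h4 : (fun x : ℝ => character v (t + x • s)) = fun x : ℝ =>
      Complex.exp (2 * Real.pi * Complex.I * (v ⬝ᵥ t : ℝ) +
        (2 * Real.pi * Complex.I * (v ⬝ᵥ s : ℝ)) * (x : ℂ)) := by
    funext x
    unfold character
    rw [dotProduct_add, dotProduct_smul, smul_eq_mul]
    push_cast
    ring_nf
  rw [h4] at h2
  have h5 : HasDerivAt (fun x : ℝ => Complex.exp (2 * Real.pi * Complex.I * (v ⬝ᵥ t : ℝ) +
        (2 * Real.pi * Complex.I * (v ⬝ᵥ s : ℝ)) * (x : ℂ)))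
      (Complex.exp (2 * Real.pi * Complex.I * (v ⬝ᵥ t : ℝ) +
        (2 * Real.pi * Complex.I * (v ⬝ᵥ s : ℝ)) * ((0 : ℝ) : ℂ)) *
        ((2 * Real.pi * Complex.I * (v ⬝ᵥ s : ℝ)) * 1)) 0 := by
    refine HasDerivAt.cexp ?_
    refine HasDerivAt.const_add _ ?_
    exact (HasDerivAt.ofReal_comp (hasDerivAt_id (0 : ℝ))).const_mul _
  rw [h2.unique h5]
  simp only [Complex.ofReal_zero, mul_zero, add_zero, mul_one]
  unfold character
  ring

end Character

/-! ### Dual lattices and orthogonality of characters -/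

namespace CoveringMatrix

variable {p : ℕ} (B : CoveringMatrix p)

lemma real_pow_mulVec (n : ℕ) (m : Fin p → ℤ) :
    (B.real ^ n) *ᵥ (fun i => (m i : ℝ)) = fun i => (((B.mat ^ n) *ᵥ m) i : ℝ) := by
  have : B.real ^ n = (B.mat ^ n).map (Int.cast : ℤ → ℝ) :=
    (Matrix.map_pow B.mat (Int.castRingHom ℝ) n).symm
  rw [this]
  funext i
  simp [Matrix.mulVec, dotProduct]

lemma dual_pow_transpose_mul (n : ℕ) : (B.dual ^ n)ᵀ * B.real ^ n = 1 := by
  have := congrArg Matrix.transpose (B.mul_dual_pow n)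
  rwa [Matrix.transpose_mul, ← Matrix.transpose_pow, Matrix.transpose_transpose,
    Matrix.transpose_one] at this

lemma mul_dual_pow_transpose (n : ℕ) : B.real ^ n * (B.dual ^ n)ᵀ = 1 := by
  have := congrArg Matrix.transpose (B.dual_pow_mul n)
  rwa [Matrix.transpose_mul, ← Matrix.transpose_pow, Matrix.transpose_transpose,
    Matrix.transpose_one] at this

/-- `A^n` is the inverse transpose of `B^n`. This duality makes characters with frequency in `G_n`
periodic under `B^n ℤ^p`. -/
lemma dotProduct_real_pow (n : ℕ) (z u : Fin p → ℝ) :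
    ((B.dual ^ n) *ᵥ z) ⬝ᵥ ((B.real ^ n) *ᵥ u) = z ⬝ᵥ u := by
  rw [Matrix.dotProduct_mulVec, ← Matrix.mulVec_transpose, Matrix.mulVec_mulVec,
    Matrix.transpose_pow, B.mul_dual_pow, Matrix.one_mulVec]

lemma character_lattice {n : ℕ} {v : Fin p → ℝ} (hv : v ∈ B.group n) (m : Fin p → ℤ) :
    character v (fun i => (((B.mat ^ n) *ᵥ m) i : ℝ)) = 1 := by
  obtain ⟨z, rfl⟩ := B.mem_group_iff.1 hv
  unfold character
  rw [← B.real_pow_mulVec, B.dotProduct_real_pow, Complex.exp_eq_one_iff]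
  refine ⟨z ⬝ᵥ m, ?_⟩
  simp only [dotProduct]
  push_cast
  ring

lemma character_int {v : Fin p → ℝ} (hv : v ∈ B.group 0) (m : Fin p → ℤ) :
    character v (fun i => (m i : ℝ)) = 1 := by
  simpa using B.character_lattice hv m

/-- Testing on the standard basis vectors, `e^{2πi v_i} = 1` for all `i` would make every coordinate
of `v` an integer. -/
lemma exists_character_ne_one {v : Fin p → ℝ} (hv : v ∉ B.group 0) :
    ∃ m : Fin p → ℤ, character v (fun i => (m i : ℝ)) ≠ 1 := by
  by_contra! hcon
  apply hv
  have h1 : ∀ i, ∃ k : ℤ, (k : ℝ) = v i := by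
    intro i
    have h2 := hcon (Pi.single i 1)
    unfold character at h2
    rw [Complex.exp_eq_one_iff] at h2
    obtain ⟨k, hk⟩ := h2
    refine ⟨k, ?_⟩
    have h3 : (v ⬝ᵥ fun l => ((Pi.single i 1 : Fin p → ℤ) l : ℝ)) = v i := by
      simp [dotProduct, Pi.single_apply]
    rw [h3] at hk
    have h4 : (2 * Real.pi * Complex.I : ℂ) ≠ 0 := Complex.two_pi_I_ne_zero
    have h5 : (v i : ℂ) = k := by
      apply mul_left_cancel₀ h4
      rw [hk]
      ring
    exact_mod_cast h5.symm
  choose z hz using h1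
  exact B.mem_group_zero.2 ⟨z, funext hz⟩

lemma mem_fundDom {n : ℕ} {x : Fin p → ℝ} :
    x ∈ B.fundDom n ↔ ∀ i, (((B.dual ^ n)ᵀ) *ᵥ x) i ∈ Set.Ico (0 : ℝ) 1 := by
  constructor
  · rintro ⟨u, hu, rfl⟩ i
    simp only [Matrix.mulVec_mulVec, B.dual_pow_transpose_mul, Matrix.one_mulVec]
    exact hu i (Set.mem_univ i)
  · intro h
    refine ⟨_, fun i _ => h i, ?_⟩
    simp only [Matrix.mulVec_mulVec, B.mul_dual_pow_transpose, Matrix.one_mulVec]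

/-- The integer vectors in the fundamental domain represent `ℤ^p / B^n ℤ^p`. -/
lemma bijective_fundDom (n : ℕ) : Function.Bijective
    (fun g : {g : Fin p → ℤ | (fun i => (g i : ℝ)) ∈ B.fundDom n} =>
      (Submodule.Quotient.mk (g : Fin p → ℤ) :
        (Fin p → ℤ) ⧸ LinearMap.range (B.mat ^ n).mulVecLin)) := by
  constructor
  · rintro ⟨g, hg⟩ ⟨g', hg'⟩ h
    obtain ⟨m, hm⟩ := (Submodule.Quotient.eq _).1 h
    have h1 : (fun i => (g i : ℝ)) - (fun i => (g' i : ℝ)) = (B.real ^ n) *ᵥ (fun i => (m i : ℝ)) := by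
      rw [B.real_pow_mulVec]
      funext i
      have := congrFun hm i
      simp only [Matrix.mulVecLin_apply, Pi.sub_apply] at this
      simp [this]
    have h2 := congrArg ((B.dual ^ n)ᵀ).mulVec h1
    rw [Matrix.mulVec_mulVec, B.dual_pow_transpose_mul, Matrix.one_mulVec, Matrix.mulVec_sub] at h2
    have hm0 : m = 0 := by
      funext i
      have h3 := congrFun h2 i
      have h4 := B.mem_fundDom.1 hg i
      have h5 := B.mem_fundDom.1 hg' i
      simp only [Pi.sub_apply] at h3
      have h6 : (m i : ℝ) < 1 := by linarith [h4.1, h4.2, h5.1, h5.2]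
      have h7 : (-1 : ℝ) < m i := by linarith [h4.1, h4.2, h5.1, h5.2]
      have h8 : m i < 1 := by exact_mod_cast h6
      have h9 : -1 < m i := by exact_mod_cast h7
      simp only [Pi.zero_apply]
      omega
    rw [hm0, map_zero] at hm
    exact Subtype.ext (sub_eq_zero.1 hm.symm)
  · intro q
    obtain ⟨g, rfl⟩ := Submodule.Quotient.mk_surjective _ q
    set f : Fin p → ℤ := fun i => ⌊(((B.dual ^ n)ᵀ) *ᵥ fun l => (g l : ℝ)) i⌋ with hf
    refine ⟨⟨g - (B.mat ^ n) *ᵥ f, ?_⟩, ?_⟩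
    · refine B.mem_fundDom.2 fun i => ?_
      have h1 : (fun l => ((g - (B.mat ^ n) *ᵥ f) l : ℝ)) =
          (fun l => (g l : ℝ)) - (B.real ^ n) *ᵥ fun l => (f l : ℝ) := by
        rw [B.real_pow_mulVec]
        funext l
        simp
      rw [h1, Matrix.mulVec_sub, Matrix.mulVec_mulVec, B.dual_pow_transpose_mul, Matrix.one_mulVec]
      simp only [Pi.sub_apply, hf]
      exact ⟨Int.fract_nonneg _, Int.fract_lt_one _⟩
    · refine (Submodule.Quotient.eq _).2 ⟨-f, ?_⟩
      simp [Matrix.mulVec_neg]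

/-- The index of the sublattice is the absolute determinant of an isomorphism from `ℤ^p` onto it,
here `B^n` itself, which is injective. -/
lemma card_quotient (n : ℕ) :
    Nat.card ((Fin p → ℤ) ⧸ LinearMap.range (B.mat ^ n).mulVecLin) = B.mat.det.natAbs ^ n := by
  have hinj : Function.Injective (B.mat ^ n).mulVecLin := by
    rw [Matrix.coe_mulVecLin]
    refine Matrix.mulVec_injective_of_det_ne_zero ?_
    rw [Matrix.det_pow]
    exact pow_ne_zero _ B.det_ne_zero
  have h := Submodule.natAbs_det_equiv (LinearMap.range (B.mat ^ n).mulVecLin)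
    (LinearEquiv.ofInjective _ hinj)
  rw [← h]
  have h2 : ((LinearMap.range (B.mat ^ n).mulVecLin).subtype ∘ₗ
      AddMonoidHom.toIntLinearMap (AddMonoidHomClass.toAddMonoidHom
        (LinearEquiv.ofInjective _ hinj))) = Matrix.toLin' (B.mat ^ n) := rfl
  rw [h2, LinearMap.det_toLin', Matrix.det_pow, Int.natAbs_pow]

lemma finite_quotient (n : ℕ) :
    Finite ((Fin p → ℤ) ⧸ LinearMap.range (B.mat ^ n).mulVecLin) := by
  refine Nat.finite_of_card_ne_zero ?_
  rw [B.card_quotient]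
  exact pow_ne_zero _ (Int.natAbs_ne_zero.2 B.det_ne_zero)

lemma finite_fundDom (n : ℕ) : {g : Fin p → ℤ | (fun i => (g i : ℝ)) ∈ B.fundDom n}.Finite := by
  have := B.finite_quotient n
  exact Finite.of_injective _ (B.bijective_fundDom n).1

/-- Orthogonality of characters on `ℤ^p / B^n ℤ^p`. -/
lemma finsum_character {n : ℕ} {v : Fin p → ℝ} (hv : v ∈ B.group n) :
    ∑ᶠ g ∈ {g : Fin p → ℤ | (fun i => (g i : ℝ)) ∈ B.fundDom n},
      character v (-fun i => (g i : ℝ)) =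
    open Classical in if v ∈ B.group 0 then ((B.mat.det.natAbs ^ n : ℕ) : ℂ) else 0 := by
  have := B.finite_quotient n
  have := Fintype.ofFinite ((Fin p → ℤ) ⧸ LinearMap.range (B.mat ^ n).mulVecLin)
  set F : (Fin p → ℤ) → ℂ := fun g => character v (-fun i => (g i : ℝ)) with hF
  have hFadd : ∀ g m, F (g + m) = F g * F m := by
    intro g m
    rw [hF]
    simp only
    rw [← character_add_right]
    congr 1
    funext i
    simp only [Pi.neg_apply, Pi.add_apply]
    push_cast
    ring
  have hFper : ∀ m ∈ LinearMap.range (B.mat ^ n).mulVecLin, F m = 1 := by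
    rintro _ ⟨m, rfl⟩
    rw [hF]
    simp only [Matrix.mulVecLin_apply]
    rw [character_neg_right, B.character_lattice hv, inv_one]
  -- `F` is multiplicative and trivial on `B^n ℤ^p`, so it descends to the finite quotient; the sum
  -- over the fundamental domain becomes a sum over a group.
  let G : ((Fin p → ℤ) ⧸ LinearMap.range (B.mat ^ n).mulVecLin) → ℂ := fun q => F (Quotient.out q)
  have hG : ∀ g, G (Submodule.Quotient.mk g) = F g := by
    intro g
    have h1 : (Quotient.out (Submodule.Quotient.mk g :
        (Fin p → ℤ) ⧸ LinearMap.range (B.mat ^ n).mulVecLin)) - g ∈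
        LinearMap.range (B.mat ^ n).mulVecLin := by
      rw [← Submodule.Quotient.eq]
      exact Quotient.out_eq _
    have h2 := hFadd g ((Quotient.out (Submodule.Quotient.mk g :
        (Fin p → ℤ) ⧸ LinearMap.range (B.mat ^ n).mulVecLin)) - g)
    rw [hFper _ h1, mul_one, add_sub_cancel] at h2
    exact h2
  have hsum : ∑ᶠ g ∈ {g : Fin p → ℤ | (fun i => (g i : ℝ)) ∈ B.fundDom n}, F g = ∑ q, G q := by
    rw [← finsum_set_coe_eq_finsum_mem, ← finsum_eq_sum_of_fintype]
    exact finsum_eq_of_bijective _ (B.bijective_fundDom n) fun g => (hG g).symm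
  rw [hsum]
  split_ifs with h0
  · have hG1 : ∀ q, G q = 1 := by
      intro q
      change character v (-fun i => (((Quotient.out q : Fin p → ℤ) i : ℤ) : ℝ)) = 1
      rw [character_neg_right, B.character_int h0, inv_one]
    simp only [hG1, Finset.sum_const, nsmul_eq_mul, mul_one, Finset.card_univ]
    rw [← B.card_quotient n, Nat.card_eq_fintype_card]
  -- Translation by `m` permutes the group and multiplies the sum by `F m ≠ 1`, so the sum vanishes.
  · obtain ⟨m, hm⟩ := B.exists_character_ne_one h0
    have hFm : F m ≠ 1 := by
      rw [hF]
      simp only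
      rwa [character_neg_right, ne_eq, inv_eq_one]
    have hshift : ∀ q, G (q + Submodule.Quotient.mk m) = G q * F m := by
      intro q
      obtain ⟨g, rfl⟩ := Submodule.Quotient.mk_surjective _ q
      rw [← Submodule.Quotient.mk_add, hG, hG, hFadd]
    have h1 : ∑ q, G q = (∑ q, G q) * F m := by
      rw [Finset.sum_mul, ← Equiv.sum_comp (Equiv.addRight (Submodule.Quotient.mk m)) G]
      exact Finset.sum_congr rfl fun q _ => hshift q
    have h2 : (∑ q, G q) * (F m - 1) = 0 := by
      rw [mul_sub, ← h1, mul_one, sub_self]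
    exact (mul_eq_zero.1 h2).resolve_right (sub_ne_zero.2 hFm)

end CoveringMatrix

/-! ### Operators on spaces of square integrable functions -/

section LpOperators

variable {α E : Type*} [MeasurableSpace α] {μ : Measure α} [NormedAddCommGroup E] [NormedSpace ℂ E]

/-- A uniformly bounded measurable family of operators acts on square integrable functions. -/
lemma exists_lpOp {A : α → E → E} (hadd : ∀ x e f, A x (e + f) = A x e + A x f)
    (hsmul : ∀ x (c : ℂ) e, A x (c • e) = c • A x e) {C : ℝ}
    (hC : ∀ x e, ‖A x e‖ ≤ C * ‖e‖) {ρ : α → α} (hρ : MeasurePreserving ρ μ μ)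
    (hA : ∀ ξ : α → E, AEStronglyMeasurable ξ μ → AEStronglyMeasurable (fun x => A x (ξ x)) μ) :
    ∃ T : Lp E 2 μ →L[ℂ] Lp E 2 μ, ∀ ξ : Lp E 2 μ, ∀ᵐ x ∂μ,
      (T ξ : α → E) x = A x ((ξ : α → E) (ρ x)) := by
  have hmem : ∀ ξ : Lp E 2 μ, MemLp (fun x => A x ((ξ : α → E) (ρ x))) 2 μ := by
    intro ξ
    have h1 : MemLp (fun x => (ξ : α → E) (ρ x)) 2 μ := (Lp.memLp ξ).comp_measurePreserving hρ
    exact h1.of_le_mul (hA _ h1.1) (Eventually.of_forall fun x => hC _ _)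
  have hco : ∀ ξ : Lp E 2 μ, ∀ᵐ x ∂μ, ((hmem ξ).toLp : α → E) x = A x ((ξ : α → E) (ρ x)) :=
    fun ξ => (hmem ξ).coeFn_toLp
  let T : Lp E 2 μ →ₗ[ℂ] Lp E 2 μ :=
    { toFun := fun ξ => (hmem ξ).toLp
      map_add' := fun ξ η => by
        apply Lp.ext
        filter_upwards [hco (ξ + η), hco ξ, hco η, Lp.coeFn_add (hmem ξ).toLp (hmem η).toLp,
          hρ.quasiMeasurePreserving.ae (Lp.coeFn_add ξ η)] with x h1 h2 h3 h4 h5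
        rw [h1, h4, Pi.add_apply, h2, h3, h5, Pi.add_apply, hadd]
      map_smul' := fun c ξ => by
        apply Lp.ext
        filter_upwards [hco (c • ξ), hco ξ, Lp.coeFn_smul c (hmem ξ).toLp,
          hρ.quasiMeasurePreserving.ae (Lp.coeFn_smul c ξ)] with x h1 h2 h4 h5
        rw [h1, RingHom.id_apply, h4, Pi.smul_apply, h2, h5, Pi.smul_apply, hsmul] }
  refine ⟨T.mkContinuous C fun ξ => ?_, fun ξ => hco ξ⟩
  rw [← Lp.norm_compMeasurePreserving ξ hρ]
  refine Lp.norm_le_mul_norm_of_ae_le_mul ?_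
  filter_upwards [hco ξ, Lp.coeFn_compMeasurePreserving ξ hρ] with x h1 h2
  change ‖((hmem ξ).toLp : α → E) x‖ ≤ _
  rw [h1, h2]
  exact hC _ _

lemma norm_eq_mul_norm_of_ae {ξ η : Lp E 2 μ} {c : ℝ} 
    (h : ∀ᵐ x ∂μ, ‖(ξ : α → E) x‖ = c * ‖(η : α → E) x‖) (hc : 0 ≤ c) : ‖ξ‖ = c * ‖η‖ := by
  have h1 : ‖ξ‖ ≤ c * ‖η‖ := Lp.norm_le_mul_norm_of_ae_le_mul (h.mono fun x hx => hx.le)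
  rcases hc.eq_or_lt with rfl | hc
  · simpa using h1
  refine le_antisymm h1 ?_
  have h2 : ‖η‖ ≤ c⁻¹ * ‖ξ‖ := Lp.norm_le_mul_norm_of_ae_le_mul (h.mono fun x hx => by
    rw [hx, inv_mul_cancel_left₀ hc.ne'])
  rwa [← div_eq_inv_mul, le_div_iff₀' hc] at h2

end LpOperators

/-- Pythagoras. With `η = x ξ` it bounds the distance of `x` from the scalars. -/
lemma one_le_norm_sub_smul {H : Type*} [NormedAddCommGroup H] [InnerProductSpace ℂ H]
    {ξ η : H} (hη : ‖η‖ = 1) (h : inner ℂ ξ η = 0) (a : ℂ) : 1 ≤ ‖η - a • ξ‖ := by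
  have h1 : inner ℂ η (a • ξ) = 0 := by
    rw [inner_smul_right, ← inner_conj_symm, h, map_zero, mul_zero]
  have h2 := norm_sub_sq (𝕜 := ℂ) η (a • ξ)
  rw [h1, hη] at h2
  simp only [map_zero, mul_zero, sub_zero, one_pow] at h2
  nlinarith [sq_nonneg ‖a • ξ‖, norm_nonneg (η - a • ξ)]

/-- A map that is piecewise given by measure preserving maps, and permutes the pieces. -/
lemma measurePreserving_piecewise {α ι : Type*} [MeasurableSpace α] [Finite ι] {μ : Measure α}
    {φ : α → ι} (hφ : ∀ k, MeasurableSet (φ ⁻¹' {k})) {σ : ι → α → α}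
    (hσ : ∀ k, MeasurePreserving (σ k) μ μ) (π : Equiv.Perm ι)
    (h : ∀ k w, φ (σ k w) = π k ↔ φ w = k) : MeasurePreserving (fun w => σ (φ w) w) μ μ := by
  have := Fintype.ofFinite ι
  have hpre : ∀ s, (fun w => σ (φ w) w) ⁻¹' s = ⋃ k, φ ⁻¹' {k} ∩ σ k ⁻¹' s := by
    intro s
    ext w
    simp
  have hmeas : Measurable fun w => σ (φ w) w := by
    intro s hs
    rw [hpre]
    exact MeasurableSet.iUnion fun k => (hφ k).inter ((hσ k).measurable hs)
  refine ⟨hmeas, Measure.ext fun s hs => ?_⟩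
  have hd : ∀ t : Set α, Pairwise (Function.onFun Disjoint fun k => φ ⁻¹' {k} ∩ t) := by
    intro t j k hjk
    refine Set.disjoint_left.2 fun w hw hw' => hjk ?_
    rw [← hw.1, ← hw'.1]
  rw [Measure.map_apply hmeas hs, hpre, measure_iUnion]
  -- The piece with label `k` is the `σ k`-preimage of the piece with label `π k`; summing over `k`
  -- and reindexing by `π` gives the measure of `s`.
  · have h1 : ∀ k, μ (φ ⁻¹' {k} ∩ σ k ⁻¹' s) = μ (φ ⁻¹' {π k} ∩ s) := by
      intro k
      rw [← (hσ k).measure_preimage ((hφ _).inter hs).nullMeasurableSet]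
      congr 1
      ext w
      simp [h]
    have h2 : μ s = ∑' k, μ (φ ⁻¹' {k} ∩ s) := by
      rw [← measure_iUnion (hd s) fun k => (hφ k).inter hs]
      congr 1
      ext w
      simp
    rw [h2]
    simp only [h1]
    exact π.tsum_eq (fun k => μ (φ ⁻¹' {k} ∩ s))
  · intro j k hjk
    refine Set.disjoint_left.2 fun w hw hw' => hjk ?_
    rw [← hw.1, ← hw'.1]
  · exact fun k => (hφ k).inter ((hσ k).measurable hs)

/-! ### The measure on the tail equivalence relation -/

section Tail

instance {P κ : Type*} [Zero κ] : DiscreteMeasurableSpace (P →₀ κ) := ⟨fun _ => trivial⟩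

variable {P κ : Type*} [Fintype κ] [AddCommGroup κ] [MeasurableSpace κ]
  [MeasurableSingletonClass κ]

lemma uniform_singleton (a : κ) :
    (PMF.uniformOfFintype κ).toMeasure {a} = (Fintype.card κ : ℝ≥0∞)⁻¹ := by
  rw [PMF.toMeasure_apply_singleton _ _ (measurableSet_singleton a), PMF.uniformOfFintype_apply]

lemma map_add_uniform (c : κ) :
    Measure.map (fun a => a + c) (PMF.uniformOfFintype κ).toMeasure =
      (PMF.uniformOfFintype κ).toMeasure := by
  refine Measure.ext_of_singleton fun a => ?_
  rw [Measure.map_apply (measurable_of_countable _) (measurableSet_singleton a)]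
  have : (fun a => a + c) ⁻¹' {a} = {a - c} := by
    ext b
    exact eq_sub_iff_add_eq.symm
  rw [this, uniform_singleton, uniform_singleton]

variable [Countable P]

/-- Translations preserve the measure. -/
lemma measurePreserving_shift (a : P → κ) (b : P →₀ κ) :
    MeasurePreserving (fun w : (P → κ) × (P →₀ κ) => (w.1 + a, w.2 + b))
      (tailMeasure P κ) (tailMeasure P κ) := by
  have h1 : MeasurePreserving (fun x : P → κ => x + a)
      (Measure.infinitePi fun _ : P => (PMF.uniformOfFintype κ).toMeasure)
      (Measure.infinitePi fun _ : P => (PMF.uniformOfFintype κ).toMeasure) := by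
    refine ⟨measurable_pi_lambda (fun x : P → κ => x + a) fun i => ?_, ?_⟩
    · have h : Measurable fun k : κ => k + a i := measurable_of_countable _
      exact h.comp (measurable_pi_apply i)
    · change Measure.map (fun (x : P → κ) i => x i + a i) _ = _
      rw [Measure.infinitePi_map_pi (fun _ : P => (PMF.uniformOfFintype κ).toMeasure)
        (f := fun i k => k + a i) fun i => measurable_of_countable _]
      simp only [map_add_uniform]
  have h2 : MeasurePreserving (fun f : P →₀ κ => f + b) Measure.count Measure.count := by
    refine ⟨measurable_of_countable _, Measure.ext_of_singleton fun f => ?_⟩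
    rw [Measure.map_apply (measurable_of_countable _) (measurableSet_singleton f)]
    have : (fun a => a + b) ⁻¹' {f} = {f - b} := by
      ext g
      exact eq_sub_iff_add_eq.symm
    rw [this, Measure.count_singleton, Measure.count_singleton]
  exact h1.prod h2

lemma tailMeasure_prod_singleton (s : Set (P → κ)) (f : P →₀ κ) :
    tailMeasure P κ (s ×ˢ {f}) =
      Measure.infinitePi (fun _ : P => (PMF.uniformOfFintype κ).toMeasure) s := by
  rw [tailMeasure, Measure.prod_prod, Measure.count_singleton, mul_one]

variable (P κ) in
/-- The diagonal `x = y`. -/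
def diagSet : Set ((P → κ) × (P →₀ κ)) := Set.univ ×ˢ {0}

lemma measurableSet_diagSet : MeasurableSet (diagSet P κ) :=
  MeasurableSet.univ.prod (measurableSet_singleton 0)

lemma tailMeasure_diagSet : tailMeasure P κ (diagSet P κ) = 1 := by
  rw [diagSet, tailMeasure_prod_singleton, measure_univ]

lemma tailMeasure_diagSet_ne_top : tailMeasure P κ (diagSet P κ) ≠ ⊤ := by
  rw [tailMeasure_diagSet]; exact ENNReal.one_ne_top

end Tail

/-! ### Monomial matrices -/

section Monomial

variable {κ : Type*} [Fintype κ] [AddCommGroup κ] [MeasurableSpace κ]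
  [MeasurableSingletonClass κ]

/-- The first `n` letters of `x`. -/
def initWord (n : ℕ) (w : (ℕ → κ) × (ℕ →₀ κ)) : Fin n → κ := fun i => w.1 i

lemma measurable_initWord (n : ℕ) : Measurable (initWord (κ := κ) n) :=
  measurable_pi_lambda _ fun i => (measurable_pi_apply (i : ℕ)).comp measurable_fst

/-- On the cylinder of sequences starting with `k` the substitution is a translation, by `π k - k`
on the first `n` letters of `x` and on the difference `x - y`. The permutation `π` moves the
cylinders onto one another. -/
lemma measurePreserving_replaceWord (n : ℕ) (π : Equiv.Perm (Fin n → κ)) :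
    MeasurePreserving (fun w => replaceWord n (π (initWord n w)) w)
      (tailMeasure ℕ κ) (tailMeasure ℕ κ) := by
  let a : (Fin n → κ) → (ℕ → κ) := fun k i => if h : i < n then π k ⟨i, h⟩ - k ⟨i, h⟩ else 0
  let b : (Fin n → κ) → (ℕ →₀ κ) := fun k => ∑ i : Fin n, Finsupp.single (i : ℕ) (π k i - k i)
  have h := measurePreserving_piecewise (μ := tailMeasure ℕ κ) (φ := initWord n)
    (fun k => measurable_initWord n (measurableSet_singleton k))
    (σ := fun k w => (w.1 + a k, w.2 + b k)) (fun k => measurePreserving_shift _ _) π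
    (by
      intro k w
      constructor
      · intro h
        funext i
        have := congrFun h i
        simp only [initWord, Pi.add_apply, a, i.2, dif_pos, Fin.eta] at this
        have h2 : w.1 i + (π k i - k i) = π k i := this
        rw [add_sub_left_comm] at h2
        exact sub_eq_zero.1 (by simpa [initWord] using h2)
      · rintro rfl
        funext i
        simp only [initWord, Pi.add_apply, a, i.2, dif_pos, Fin.eta]
        exact add_sub_cancel _ _)
  convert h using 1
  funext w
  refine Prod.ext ?_ rfl
  funext i
  simp only [replaceWord, Pi.add_apply, a]
  split_ifs with hi
  · exact (add_sub_cancel (w.1 i) (π (initWord n w) ⟨i, hi⟩)).symm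
  · simp

variable {E : Type*} [NormedAddCommGroup E] [NormedSpace ℂ E]

/-- A matrix with exactly one nonzero entry in each row and column acts by a weighted
substitution. -/
lemma amplify_monomial (n : ℕ) (π : Equiv.Perm (Fin n → κ)) (V : (Fin n → κ) → (E →L[ℂ] E))
    {T : (Fin n → κ) → (Fin n → κ) → (E →L[ℂ] E)}
    (hT : ∀ j, T j (π j) = V j) (hT0 : ∀ j k, k ≠ π j → T j k = 0) (ξ : TailSpace ℕ κ E) :
    ∀ᵐ w ∂(tailMeasure ℕ κ), (amplify n T ξ : (ℕ → κ) × (ℕ →₀ κ) → E) w =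
      V (initWord n w) ((ξ : (ℕ → κ) × (ℕ →₀ κ) → E) (replaceWord n (π (initWord n w)) w)) := by
  have hcol : ∀ (ξ : TailSpace ℕ κ E) w, ∑ j : Fin n → κ, T (fun i => w.1 i) j
      ((ξ : (ℕ → κ) × (ℕ →₀ κ) → E) (replaceWord n j w)) =
      V (initWord n w) ((ξ : (ℕ → κ) × (ℕ →₀ κ) → E) (replaceWord n (π (initWord n w)) w)) := by
    intro ξ w
    rw [Finset.sum_eq_single (π (initWord n w))]
    · rw [← hT]; rfl
    · intro j _ hj
      have : T (fun i => w.1 i) j = 0 := hT0 (initWord n w) j hj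
      rw [this]; rfl
    · intro h
      exact absurd (Finset.mem_univ _) h
  -- `amplify` is a chosen operator and would be `0` by default, so existence must come before any
  -- formula for it.
  have hex : ∃ S : TailSpace ℕ κ E →L[ℂ] TailSpace ℕ κ E, ∀ ξ : TailSpace ℕ κ E,
      ∀ᵐ w ∂(tailMeasure ℕ κ), (S ξ : (ℕ → κ) × (ℕ →₀ κ) → E) w =
        ∑ j : Fin n → κ, T (fun i => w.1 i) j
          ((ξ : (ℕ → κ) × (ℕ →₀ κ) → E) (replaceWord n j w)) := by
    simp only [hcol]
    refine exists_lpOp (A := fun w e => V (initWord n w) e) (C := ∑ k, ‖V k‖)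
      (fun _ _ _ => map_add _ _ _) (fun _ _ _ => map_smul _ _ _) (fun w e => ?_)
      (measurePreserving_replaceWord n π) fun ξ hξ => ?_
    · refine ((V (initWord n w)).le_opNorm e).trans ?_
      refine mul_le_mul_of_nonneg_right ?_ (norm_nonneg _)
      exact Finset.single_le_sum (f := fun k => ‖V k‖) (fun k _ => norm_nonneg _)
        (Finset.mem_univ (initWord n w))
    -- Measurability: only finitely many operators `V k` occur, each on a measurable cylinder.
    · have : (fun w => V (initWord n w) (ξ w)) = fun w => ∑ k,
          (initWord n ⁻¹' {k}).indicator (fun w => V k (ξ w)) w := by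
        funext w
        rw [Finset.sum_eq_single (initWord n w)]
        · simp
        · intro k _ hk
          rw [Set.indicator_of_notMem]
          simpa using hk.symm
        · intro h
          exact absurd (Finset.mem_univ _) h
      rw [this]
      refine Finset.aestronglyMeasurable_fun_sum _ fun k _ => ?_
      exact ((V k).continuous.comp_aestronglyMeasurable hξ).indicator
        (measurable_initWord n (measurableSet_singleton k))
  filter_upwards [opOf_spec hex ξ] with w hw
  rw [← hcol]
  exact hw

lemma norm_amplify_monomial (n : ℕ) (π : Equiv.Perm (Fin n → κ)) (V : (Fin n → κ) → (E →L[ℂ] E))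
    {T : (Fin n → κ) → (Fin n → κ) → (E →L[ℂ] E)}
    (hT : ∀ j, T j (π j) = V j) (hT0 : ∀ j k, k ≠ π j → T j k = 0)
    (hV : ∀ j e, ‖V j e‖ = ‖e‖) (ξ : TailSpace ℕ κ E) : ‖amplify n T ξ‖ = ‖ξ‖ := by
  have hρ := measurePreserving_replaceWord n π
  rw [← Lp.norm_compMeasurePreserving ξ hρ, ← one_mul ‖Lp.compMeasurePreserving _ hρ ξ‖]
  refine norm_eq_mul_norm_of_ae ?_ zero_le_one
  filter_upwards [amplify_monomial n π V hT hT0 ξ, Lp.coeFn_compMeasurePreserving ξ hρ]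
    with w h1 h2
  rw [h1, h2, hV, one_mul]
  rfl

/-- The vector `e ⊗ Ω`. -/
def diagVector {P : Type*} [Countable P] (e : E) : TailSpace P κ E :=
  indicatorConstLp 2 measurableSet_diagSet tailMeasure_diagSet_ne_top e

lemma diagVector_coe {P : Type*} [Countable P] (e : E) :
    ((diagVector e : TailSpace P κ E) : (P → κ) × (P →₀ κ) → E) =ᵐ[tailMeasure P κ]
      (diagSet P κ).indicator fun _ => e := indicatorConstLp_coeFn

lemma norm_diagVector {P : Type*} [Countable P] (e : E) :
    ‖(diagVector e : TailSpace P κ E)‖ = ‖e‖ := by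
  rw [diagVector, norm_indicatorConstLp (by simp) (by simp)]
  simp [measureReal_def, tailMeasure_diagSet]

end Monomial

section MonomialInner

variable {κ : Type*} [Fintype κ] [AddCommGroup κ] [MeasurableSpace κ]
  [MeasurableSingletonClass κ] {E : Type*} [NormedAddCommGroup E] [InnerProductSpace ℂ E]

/-- The vector `e ⊗ Ω` lives on the diagonal `x = y`. Replacing a word in `x` with `y` fixed leaves
the diagonal unless `π` fixes the word, and at fixed words the entry sends `e` to a vector
orthogonal to `e`. Hence `e ⊗ Ω` is orthogonal to its image. -/
lemma one_le_norm_amplify_sub (n : ℕ) (π : Equiv.Perm (Fin n → κ))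
    (V : (Fin n → κ) → (E →L[ℂ] E)) {T : (Fin n → κ) → (Fin n → κ) → (E →L[ℂ] E)}
    (hT : ∀ j, T j (π j) = V j) (hT0 : ∀ j k, k ≠ π j → T j k = 0)
    (hV : ∀ j e, ‖V j e‖ = ‖e‖) {e : E} (he : ‖e‖ = 1)
    (h : ∀ j, π j = j → inner ℂ e (V j e) = 0) (a : ℂ) :
    1 ≤ ‖amplify n T (diagVector e : TailSpace ℕ κ E) - a • (diagVector e : TailSpace ℕ κ E)‖ := by
  refine one_le_norm_sub_smul ?_ ?_ a
  · rw [norm_amplify_monomial n π V hT hT0 hV, norm_diagVector, he]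
  · rw [L2.inner_def]
    refine integral_eq_zero_of_ae ?_
    filter_upwards [amplify_monomial n π V hT hT0 (diagVector e : TailSpace ℕ κ E),
      diagVector_coe (P := ℕ) (κ := κ) e,
      (measurePreserving_replaceWord n π).quasiMeasurePreserving.ae
        (diagVector_coe (P := ℕ) (κ := κ) e)] with w h1 h2 h3
    rw [h1, h2, h3]
    by_cases hw : w ∈ diagSet ℕ κ
    · by_cases hw2 : replaceWord n (π (initWord n w)) w ∈ diagSet ℕ κ
      · rw [Set.indicator_of_mem hw, Set.indicator_of_mem hw2]
        refine h _ ?_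
        have e1 : w.2 = 0 := hw.2
        have e2 : w.2 + ∑ i : Fin n, Finsupp.single (i : ℕ) (π (initWord n w) i - w.1 i) = 0 :=
          hw2.2
        rw [e1, zero_add] at e2
        funext i
        have e3 := DFunLike.congr_fun e2 (i : ℕ)
        rw [Finsupp.finsetSum_apply, Finset.sum_eq_single i] at e3
        · exact sub_eq_zero.1 (by simpa [initWord] using e3)
        · intro j _ hj
          exact Finsupp.single_eq_of_ne (fun h => hj (Fin.ext h.symm))
        · intro h
          exact absurd (Finset.mem_univ _) h
      · rw [Set.indicator_of_notMem hw2, map_zero, inner_zero_right]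
        rfl
    · rw [Set.indicator_of_notMem hw, inner_zero_left]
      rfl

end MonomialInner

instance {p : ℕ} (B : CoveringMatrix p) : DiscreteMeasurableSpace B.Digit := ⟨fun _ => trivial⟩

/-! ### The Dirac operator on the limit -/

section DiracPlus

variable {κ : Type*} [Fintype κ] [AddCommGroup κ] [MeasurableSpace κ]
variable {E : Type*} [NormedAddCommGroup E] [NormedSpace ℂ E]

lemma exists_subseq_tendsto_ae {α : Type*} [MeasurableSpace α] {μ : Measure α}
    {ξ : ℕ → Lp E 2 μ} {η : Lp E 2 μ} (h : Tendsto ξ atTop (𝓝 η)) :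
    ∃ ns : ℕ → ℕ, StrictMono ns ∧
      ∀ᵐ x ∂μ, Tendsto (fun i => (ξ (ns i) : α → E) x) atTop (𝓝 ((η : α → E) x)) :=
  (tendstoInMeasure_of_tendsto_Lp h).exists_seq_tendsto_ae

/-- The fibrewise condition already defines a closed single-valued subspace, so taking the closed
span adds nothing: an `L²`-convergent sequence of pairs has a subsequence converging almost
everywhere, and the graph of `D₀` is closed. -/
lemma mem_diracPlus_graph {D₀ : E →ₗ.[ℂ] E} (hD₀ : IsClosed (D₀.graph : Set (E × E)))
    (c : (ℕ → κ) → (E →L[ℂ] E)) {z : TailSpace ℕ κ E × TailSpace ℕ κ E} :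
    z ∈ (diracPlus D₀ c).graph ↔ ∀ᵐ w ∂(tailMeasure ℕ κ),
      ((z.1 : (ℕ → κ) × (ℕ →₀ κ) → E) w,
        (z.2 : (ℕ → κ) × (ℕ →₀ κ) → E) w - c w.1 ((z.1 : (ℕ → κ) × (ℕ →₀ κ) → E) w)) ∈ D₀.graph := by
  let S : Submodule ℂ (TailSpace ℕ κ E × TailSpace ℕ κ E) :=
    { carrier := {z | ∀ᵐ w ∂(tailMeasure ℕ κ), ((z.1 : (ℕ → κ) × (ℕ →₀ κ) → E) w,
        (z.2 : (ℕ → κ) × (ℕ →₀ κ) → E) w - c w.1 ((z.1 : (ℕ → κ) × (ℕ →₀ κ) → E) w)) ∈ D₀.graph}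
      add_mem' := fun {y z} hy hz => by
        filter_upwards [hy, hz, Lp.coeFn_add y.1 z.1, Lp.coeFn_add y.2 z.2] with w h1 h2 h3 h4
        rw [Prod.fst_add, Prod.snd_add, h3, h4]
        convert D₀.graph.add_mem h1 h2 using 1
        refine Prod.ext rfl ?_
        simp only [Pi.add_apply, map_add, Prod.snd_add]
        abel
      zero_mem' := by
        filter_upwards [Lp.coeFn_zero E 2 (tailMeasure ℕ κ)] with w h1
        rw [Prod.fst_zero, Prod.snd_zero, h1]
        simp
      smul_mem' := fun a z hz => by
        filter_upwards [hz, Lp.coeFn_smul a z.1, Lp.coeFn_smul a z.2] with w h1 h3 h4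
        rw [Prod.smul_fst, Prod.smul_snd, h3, h4]
        convert D₀.graph.smul_mem a h1 using 1
        refine Prod.ext rfl ?_
        simp only [Pi.smul_apply, map_smul, Prod.smul_snd, smul_sub] }
  refine opOfGraph_graph_of_isClosed S rfl ?_ ?_
  · refine IsSeqClosed.isClosed fun zs z hzs hz => ?_
    have hz1 : Tendsto (fun i => (zs i).1) atTop (𝓝 z.1) := (continuous_fst.tendsto z).comp hz
    have hz2 : Tendsto (fun i => (zs i).2) atTop (𝓝 z.2) := (continuous_snd.tendsto z).comp hz
    obtain ⟨ns, hns, h1⟩ := exists_subseq_tendsto_ae hz1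
    -- The second components are refined along the subsequence already chosen for the first, so that
    -- both converge along one sequence of indices.
    obtain ⟨ms, hms, h2⟩ := exists_subseq_tendsto_ae (hz2.comp hns.tendsto_atTop)
    have hall : ∀ᵐ w ∂(tailMeasure ℕ κ), ∀ i, (((zs i).1 : (ℕ → κ) × (ℕ →₀ κ) → E) w,
        ((zs i).2 : (ℕ → κ) × (ℕ →₀ κ) → E) w -
          c w.1 (((zs i).1 : (ℕ → κ) × (ℕ →₀ κ) → E) w)) ∈ D₀.graph := ae_all_iff.2 hzs
    change ∀ᵐ w ∂(tailMeasure ℕ κ), _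
    filter_upwards [h1, h2, hall] with w h1 h2 h3
    have h1' := h1.comp hms.tendsto_atTop
    refine hD₀.mem_of_tendsto
      (h1'.prodMk_nhds (h2.sub (((c w.1).continuous.tendsto _).comp h1')))
      (Eventually.of_forall fun i => h3 (ns (ms i)))
  · intro z hz hz1
    apply Lp.ext
    filter_upwards [hz, Lp.coeFn_zero E 2 (tailMeasure ℕ κ)] with w h1 h2
    rw [hz1, h2, Pi.zero_apply, map_zero, sub_zero] at h1
    rw [h2]
    exact D₀.graph_fst_eq_zero_snd h1 rfl

end DiracPlus

/-! ### Clifford multiplication and commutators on the limit space -/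

section Limit

variable {p : ℕ} (B : CoveringMatrix p) {E : Type*} [NormedAddCommGroup E] [InnerProductSpace ℂ E]

/-- The operator `∑_a v_a C_a`. -/
def vecOp (C : Fin p → (E →L[ℂ] E)) (v : Fin p → ℝ) : E →L[ℂ] E := ∑ a, (v a : ℂ) • C a

lemma vecOp_apply (C : Fin p → (E →L[ℂ] E)) (v : Fin p → ℝ) (e : E) :
    vecOp C v e = ∑ a, (v a : ℂ) • C a e := by
  simp [vecOp]

lemma vecOp_add (C : Fin p → (E →L[ℂ] E)) (v w : Fin p → ℝ) :
    vecOp C (v + w) = vecOp C v + vecOp C w := by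
  simp [vecOp, add_smul, Finset.sum_add_distrib]

lemma vecOp_sub (C : Fin p → (E →L[ℂ] E)) (v w : Fin p → ℝ) :
    vecOp C (v - w) = vecOp C v - vecOp C w := by
  rw [eq_sub_iff_add_eq, ← vecOp_add, sub_add_cancel]

lemma vecOp_commute {C : Fin p → (E →L[ℂ] E)} {V : E →L[ℂ] E}
    (h : ∀ a e, C a (V e) = V (C a e)) (v : Fin p → ℝ) (e : E) :
    vecOp C v (V e) = V (vecOp C v e) := by
  simp [vecOp_apply, h, map_sum]

/-- The Euclidean length of a vector. -/
def euclidLength (v : Fin p → ℝ) : ℝ := √(∑ a, v a ^ 2)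

lemma euclidLength_pos {v : Fin p → ℝ} (hv : v ≠ 0) : 0 < euclidLength v := by
  refine Real.sqrt_pos.2 ?_
  obtain ⟨a, ha⟩ := Function.ne_iff.1 hv
  refine lt_of_lt_of_le (pow_pos (abs_pos.2 ha) 2) ?_
  rw [sq_abs]
  exact Finset.single_le_sum (f := fun a => v a ^ 2) (fun a _ => sq_nonneg _) (Finset.mem_univ a)

lemma tendsto_euclidLength_freq : Tendsto (fun n => euclidLength (B.freq n)) atTop (𝓝 0) := by
  have h : Continuous (euclidLength (p := p)) := by
    unfold euclidLength
    fun_prop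
  have := (h.tendsto 0).comp B.tendsto_freq
  simpa [euclidLength, Function.comp_def] using this

/-- Clifford generators: the square of `∑_a v_a S_a` is `|v|²`. -/
lemma norm_vecOp {S : Fin p → (E →L[ℂ] E)} {s : ℝ} (hs : 0 ≤ s)
    (hsymm : ∀ a x y, inner ℂ (S a x) y = inner ℂ x (S a y))
    (hanti : ∀ a b x, S a (S b x) + S b (S a x) = if a = b then (2 * s ^ 2 : ℂ) • x else 0)
    (v : Fin p → ℝ) (x : E) : ‖vecOp S v x‖ = s * euclidLength v * ‖x‖ := by
  have h1 : ∀ x y, inner ℂ (vecOp S v x) y = inner ℂ x (vecOp S v y) := by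
    intro x y
    simp only [vecOp_apply, sum_inner, inner_sum, inner_smul_left, inner_smul_right, hsymm,
      Complex.conj_ofReal]
  have h2 : vecOp S v (vecOp S v x) = ((s ^ 2 * ∑ a, v a ^ 2 : ℝ) : ℂ) • x := by
    have e1 : vecOp S v (vecOp S v x) = ∑ a, ∑ b, ((v a * v b : ℝ) : ℂ) • S a (S b x) := by
      rw [vecOp_apply]
      refine Finset.sum_congr rfl fun a _ => ?_
      rw [vecOp_apply, map_sum, Finset.smul_sum]
      refine Finset.sum_congr rfl fun b _ => ?_
      rw [map_smul, smul_smul]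
      push_cast
      rfl
    have e2 : vecOp S v (vecOp S v x) = ∑ a, ∑ b, ((v a * v b : ℝ) : ℂ) • S b (S a x) := by
      rw [e1, Finset.sum_comm]
      refine Finset.sum_congr rfl fun a _ => Finset.sum_congr rfl fun b _ => ?_
      rw [mul_comm]
    -- Adding the double sum to its transpose pairs `S a S b` with `S b S a`, so the anticommutation
    -- relations leave only the diagonal terms.
    have e3 : (2 : ℂ) • vecOp S v (vecOp S v x) = (2 : ℂ) • (((s ^ 2 * ∑ a, v a ^ 2 : ℝ) : ℂ) • x) := by
      rw [two_smul]
      nth_rewrite 1 [e1]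
      rw [e2, ← Finset.sum_add_distrib]
      simp only [← Finset.sum_add_distrib, ← smul_add, hanti, smul_ite, smul_zero,
        Finset.sum_ite_eq, Finset.mem_univ, if_true]
      rw [smul_smul]
      simp only [smul_smul]
      rw [← Finset.sum_smul]
      congr 1
      push_cast
      rw [Finset.mul_sum, Finset.mul_sum]
      exact Finset.sum_congr rfl fun a _ => by ring
    exact smul_right_injective E (two_ne_zero) e3
  have h3 : ‖vecOp S v x‖ ^ 2 = (s * euclidLength v * ‖x‖) ^ 2 := by
    have e1 : ((‖vecOp S v x‖ ^ 2 : ℝ) : ℂ) = (((s * euclidLength v * ‖x‖) ^ 2 : ℝ) : ℂ) := by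
      have e2 : inner ℂ (vecOp S v x) (vecOp S v x) = ((‖vecOp S v x‖ ^ 2 : ℝ) : ℂ) := by
        rw [inner_self_eq_norm_sq_to_K]; simp
      have e3 : inner ℂ x x = ((‖x‖ ^ 2 : ℝ) : ℂ) := by
        rw [inner_self_eq_norm_sq_to_K]; simp
      rw [← e2, h1, h2, inner_smul_right, e3, ← Complex.ofReal_mul, mul_pow, mul_pow, euclidLength,
        Real.sq_sqrt (Finset.sum_nonneg fun a _ => sq_nonneg _)]
    exact_mod_cast e1
  exact (pow_left_inj₀ (norm_nonneg _) (by unfold euclidLength; positivity) two_ne_zero).1 h3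

variable {B} {D₀ : E →ₗ.[ℂ] E} {C : Fin p → (E →L[ℂ] E)} {c : (ℕ → B.Digit) → (E →L[ℂ] E)} {s : ℝ}
  {n : ℕ} {π : Equiv.Perm (Fin n → B.Digit)} {V : (Fin n → B.Digit) → (E →L[ℂ] E)}
  {T : (Fin n → B.Digit) → (Fin n → B.Digit) → (E →L[ℂ] E)} {v : Fin p → ℝ}

/-- The commutator of the limit Dirac operator with a monomial matrix. -/
lemma diracPlus_twist (hD₀ : IsClosed (D₀.graph : Set (E × E)))
    (hc : ∀ x, c x = -vecOp C (s • B.seqSum x))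
    (hT : ∀ j, T j (π j) = V j) (hT0 : ∀ j k, k ≠ π j → T j k = 0)
    (hV : ∀ j e f, (e, f) ∈ D₀.graph → (V j e,
      V j f + vecOp C (v + s • (B.wordSum j - B.wordSum (π j))) (V j e)) ∈ D₀.graph)
    (hCV : ∀ a j e, C a (V j e) = V j (C a e)) (ξ η : TailSpace ℕ B.Digit E)
    (h : (ξ, η) ∈ (diracPlus D₀ c).graph) :
    (amplify n T ξ, amplify n T η +
      (vecOp C v).compLpL 2 (tailMeasure ℕ B.Digit) (amplify n T ξ)) ∈ (diracPlus D₀ c).graph := by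
  rw [mem_diracPlus_graph hD₀] at h ⊢
  filter_upwards [amplify_monomial n π V hT hT0 ξ, amplify_monomial n π V hT hT0 η,
    (measurePreserving_replaceWord n π).quasiMeasurePreserving.ae h,
    Lp.coeFn_add (amplify n T η)
      ((vecOp C v).compLpL 2 (tailMeasure ℕ B.Digit) (amplify n T ξ)),
    ContinuousLinearMap.coeFn_compLpL (vecOp C v) (amplify n T ξ)] with w h1 h2 h3 h4 h5
  rw [h4, Pi.add_apply, h5, h1, h2]
  set k := initWord n w
  set w' := replaceWord n (π k) w with hw'
  -- The sequences agree from `n` on. The diagonal operator is evaluated at `w` on one side of the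
  -- commutator and at `w'` on the other; this difference cancels the `s`-term of `hV` and leaves
  -- `vecOp C v`.
  have hseq : B.seqSum w.1 - B.seqSum w'.1 = B.wordSum k - B.wordSum (π k) := by
    rw [B.seqSum_sub_seqSum (n := n) (x := w.1) (y := w'.1)]
    · congr 2
      funext i
      simp [hw', replaceWord]
    · intro i hi
      simp [hw', replaceWord, not_lt.2 hi]
  convert hV k _ _ h3 using 1
  refine Prod.ext rfl ?_
  have hcom : ∀ u e, vecOp C u (V k e) = V k (vecOp C u e) :=
    fun u e => vecOp_commute (fun a e => hCV a k e) u e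
  simp only
  rw [← hseq, hc, hc, vecOp_add, smul_sub, vecOp_sub]
  simp only [_root_.add_apply, _root_.neg_apply, _root_.sub_apply, map_sub, map_neg, hcom]
  abel

/-- For `e` in the domain of `D₀`, the vector `e ⊗ Ω` works: the sums over digit sequences are
measurable and uniformly bounded, so `c x e` is square integrable on the diagonal, which has measure
one. -/
lemma exists_mem_diracPlus_domain (hc : ∀ x, c x = -vecOp C (s • B.seqSum x))
    (hD : ∃ e ∈ D₀.domain, e ≠ 0) : ∃ ξ ∈ (diracPlus D₀ c).domain, ξ ≠ 0 := by
  obtain ⟨e, he, he0⟩ := hD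
  refine ⟨diagVector e, ?_, ?_⟩
  · obtain ⟨M, hM⟩ := B.exists_norm_seqSum_le
    let g : (ℕ → B.Digit) × (ℕ →₀ B.Digit) → E := fun w => D₀ ⟨e, he⟩ + c w.1 e
    have hgm : StronglyMeasurable g := by
      refine stronglyMeasurable_const.add ?_
      simp only [hc]
      have : (fun w : (ℕ → B.Digit) × (ℕ →₀ B.Digit) => (-vecOp C (s • B.seqSum w.1)) e) =
          fun w => -∑ a, (((s • B.seqSum w.1) a : ℝ) : ℂ) • C a e := by
        funext w
        rw [_root_.neg_apply, vecOp_apply]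
      rw [this]
      refine (Finset.stronglyMeasurable_fun_sum _ fun a _ => ?_).neg
      refine StronglyMeasurable.smul_const ?_ _
      refine (Complex.measurable_ofReal.comp ?_).stronglyMeasurable
      exact ((measurable_pi_apply a).comp (B.measurable_seqSum.comp measurable_fst)).const_mul s
    have hgb : ∀ w, ‖g w‖ ≤ ‖D₀ ⟨e, he⟩‖ + ∑ a, |s| * M * ‖C a e‖ := by
      intro w
      refine (norm_add_le _ _).trans (add_le_add le_rfl ?_)
      rw [hc, _root_.neg_apply, norm_neg, vecOp_apply]
      refine (norm_sum_le _ _).trans (Finset.sum_le_sum fun a _ => ?_)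
      rw [norm_smul, Complex.norm_real, Pi.smul_apply, smul_eq_mul, norm_mul]
      refine mul_le_mul_of_nonneg_right ?_ (norm_nonneg _)
      exact mul_le_mul_of_nonneg_left ((norm_le_pi_norm _ a).trans (hM _)) (norm_nonneg _)
    have hmem : MemLp ((diagSet ℕ B.Digit).indicator g) 2 (tailMeasure ℕ B.Digit) := by
      refine (memLp_indicator_const (E := ℝ) 2 measurableSet_diagSet 1
        (Or.inr tailMeasure_diagSet_ne_top)).of_le_mul
        (c := ‖D₀ ⟨e, he⟩‖ + ∑ a, |s| * M * ‖C a e‖)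
        (hgm.indicator measurableSet_diagSet).aestronglyMeasurable (Eventually.of_forall fun w => ?_)
      by_cases hw : w ∈ diagSet ℕ B.Digit
      · simpa [hw] using hgb w
      · simp [hw]
    refine mem_opOfGraph_domain (f := hmem.toLp) ?_
    change ∀ᵐ w ∂(tailMeasure ℕ B.Digit), _
    filter_upwards [diagVector_coe (P := ℕ) (κ := B.Digit) e, hmem.coeFn_toLp] with w h1 h2
    simp only [h1, h2]
    by_cases hw : w ∈ diagSet ℕ B.Digit
    · rw [Set.indicator_of_mem hw, Set.indicator_of_mem hw, add_sub_cancel_right]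
      exact D₀.mem_graph ⟨e, he⟩
    · rw [Set.indicator_of_notMem hw, Set.indicator_of_notMem hw, map_zero, sub_zero]
      exact D₀.graph.zero_mem
  · intro h
    apply he0
    rw [← norm_eq_zero, ← norm_diagVector (P := ℕ) (κ := B.Digit) e, h, norm_zero]

/-- The commutator is `vecOp C v`, acting fibrewise, after the isometric monomial matrix. It is
therefore a multiple of an isometry, and its norm is exact. -/
lemma commSeminorm_diracPlus (hD₀ : IsClosed (D₀.graph : Set (E × E)))
    (hc : ∀ x, c x = -vecOp C (s • B.seqSum x))
    (hT : ∀ j, T j (π j) = V j) (hT0 : ∀ j k, k ≠ π j → T j k = 0)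
    (hV : ∀ j e f, (e, f) ∈ D₀.graph → (V j e,
      V j f + vecOp C (v + s • (B.wordSum j - B.wordSum (π j))) (V j e)) ∈ D₀.graph)
    (hCV : ∀ a j e, C a (V j e) = V j (C a e)) (hVn : ∀ j e, ‖V j e‖ = ‖e‖) {r : ℝ} (hr : 0 ≤ r)
    (hCn : ∀ e, ‖vecOp C v e‖ = r * ‖e‖) (hD : ∃ e ∈ D₀.domain, e ≠ 0) :
    commSeminorm (diracPlus D₀ c) (amplify n T) = ENNReal.ofReal r := by
  refine commSeminorm_eq_ofReal (diracPlus_twist hD₀ hc hT hT0 hV hCV) (fun ξ => ?_)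
    (exists_mem_diracPlus_domain hc hD)
  rw [← norm_amplify_monomial n π V hT hT0 hVn ξ]
  refine norm_eq_mul_norm_of_ae ?_ hr
  filter_upwards [ContinuousLinearMap.coeFn_compLpL (vecOp C v) (amplify n T ξ)] with w h
  rw [h, hCn]

end Limit

/-! ### The fundamental domain -/

namespace CoveringMatrix

variable {p : ℕ} (B : CoveringMatrix p)

lemma measurableSet_fundDom (n : ℕ) : MeasurableSet (B.fundDom n) := by
  have : B.fundDom n = ⋂ i, (fun x : Fin p → ℝ => (((B.dual ^ n)ᵀ) *ᵥ x) i) ⁻¹' Set.Ico 0 1 := by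
    ext x
    simp [B.mem_fundDom]
  rw [this]
  refine MeasurableSet.iInter fun i => ?_
  have h : Continuous fun x : Fin p → ℝ => (((B.dual ^ n)ᵀ) *ᵥ x) i := by fun_prop
  exact h.measurable measurableSet_Ico

lemma det_real_pow_ne_zero (n : ℕ) : (B.real ^ n).det ≠ 0 := by
  rw [Matrix.det_pow]
  exact pow_ne_zero _ B.det_real_ne_zero

lemma volume_fundDom (n : ℕ) : volume (B.fundDom n) = ENNReal.ofReal |(B.real ^ n).det| := by
  have h : B.fundDom n = Matrix.toLin' (B.real ^ n) ''
      Set.pi Set.univ (fun _ => Set.Ico (0 : ℝ) 1) := rfl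
  rw [h, Measure.addHaar_image_linearMap, LinearMap.det_toLin', Real.volume_pi_Ico]
  simp

lemma volume_fundDom_ne_top (n : ℕ) : volume (B.fundDom n) ≠ ⊤ := by
  rw [volume_fundDom]; exact ENNReal.ofReal_ne_top

lemma volume_fundDom_pos (n : ℕ) : 0 < volume (B.fundDom n) := by
  rw [volume_fundDom]
  exact ENNReal.ofReal_pos.2 (abs_pos.2 (B.det_real_pow_ne_zero n))

/-- The open fundamental domain. -/
def fundInterior (n : ℕ) : Set (Fin p → ℝ) :=
  {x | ∀ i, (((B.dual ^ n)ᵀ) *ᵥ x) i ∈ Set.Ioo (0 : ℝ) 1}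

lemma isOpen_fundInterior (n : ℕ) : IsOpen (B.fundInterior n) := by
  have : B.fundInterior n =
      ⋂ i, (fun x : Fin p → ℝ => (((B.dual ^ n)ᵀ) *ᵥ x) i) ⁻¹' Set.Ioo 0 1 := by
    ext x
    simp [fundInterior]
  rw [this]
  refine isOpen_iInter_of_finite fun i => ?_
  have h : Continuous fun x : Fin p → ℝ => (((B.dual ^ n)ᵀ) *ᵥ x) i := by fun_prop
  exact isOpen_Ioo.preimage h

lemma fundInterior_subset (n : ℕ) : B.fundInterior n ⊆ B.fundDom n := fun _ hx =>
  B.mem_fundDom.2 fun i => Set.Ioo_subset_Ico_self (hx i)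

/-- Points of the half-open domain outside the open one have a coordinate equal to `0` in the
lattice basis, so they lie in finitely many hyperplanes. -/
lemma volume_fundDom_diff (n : ℕ) : volume (B.fundDom n \ B.fundInterior n) = 0 := by
  let f : Fin p → ((Fin p → ℝ) →ₗ[ℝ] ℝ) := fun i =>
    (LinearMap.proj i).comp (Matrix.toLin' (B.dual ^ n)ᵀ)
  have hsub : B.fundDom n \ B.fundInterior n ⊆ ⋃ i, (LinearMap.ker (f i) : Set (Fin p → ℝ)) := by
    rintro x ⟨hx, hx'⟩
    rw [B.mem_fundDom] at hx
    simp only [fundInterior, Set.mem_ofPred_eq, not_forall] at hx'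
    obtain ⟨i, hi⟩ := hx'
    refine Set.mem_iUnion.2 ⟨i, ?_⟩
    have h1 := hx i
    change (((B.dual ^ n)ᵀ) *ᵥ x) i = 0
    by_contra hne
    exact hi ⟨lt_of_le_of_ne h1.1 (Ne.symm hne), h1.2⟩
  refine measure_mono_null hsub (measure_iUnion_null fun i => ?_)
  refine Measure.addHaar_submodule _ _ fun htop => ?_
  have h1 : (B.real ^ n) *ᵥ (Pi.single i 1) ∈ LinearMap.ker (f i) := htop ▸ Submodule.mem_top
  have h2 : f i ((B.real ^ n) *ᵥ (Pi.single i 1)) = 1 := by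
    change (((B.dual ^ n)ᵀ) *ᵥ ((B.real ^ n) *ᵥ (Pi.single i 1))) i = 1
    rw [Matrix.mulVec_mulVec, B.dual_pow_transpose_mul, Matrix.one_mulVec, Pi.single_eq_same]
  rw [LinearMap.mem_ker, h2] at h1
  exact one_ne_zero h1

lemma integral_exp_Ico (k : ℤ) (hk : k ≠ 0) :
    ∫ x in Set.Ico (0 : ℝ) 1, Complex.exp (2 * Real.pi * Complex.I * k * x) = 0 := by
  rw [integral_Ico_eq_integral_Ioc, ← intervalIntegral.integral_of_le zero_le_one]
  have hc : (2 * Real.pi * Complex.I * k : ℂ) ≠ 0 :=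
    mul_ne_zero Complex.two_pi_I_ne_zero (by exact_mod_cast hk)
  rw [integral_exp_mul_complex hc]
  have h1 : Complex.exp (2 * Real.pi * Complex.I * k * ((1 : ℝ) : ℂ)) = 1 := by
    rw [Complex.exp_eq_one_iff]
    exact ⟨k, by push_cast; ring⟩
  rw [h1]
  simp

/-- Nontrivial characters of the torus have mean zero. -/
lemma integral_character {n : ℕ} {v : Fin p → ℝ} (hv : v ∈ B.group n) (hv0 : v ≠ 0) :
    ∫ t in B.fundDom n, character v t = 0 := by
  obtain ⟨z, rfl⟩ := B.mem_group_iff.1 hv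
  obtain ⟨k, hk⟩ : ∃ k, z k ≠ 0 := by
    by_contra! hcon
    apply hv0
    have : (fun i => (z i : ℝ)) = 0 := funext fun i => by simp [hcon i]
    rw [this, Matrix.mulVec_zero]
  have hder : ∀ x ∈ Set.pi Set.univ (fun _ : Fin p => Set.Ico (0 : ℝ) 1), HasFDerivWithinAt
      (fun u : Fin p → ℝ => (B.real ^ n) *ᵥ u)
      (LinearMap.toContinuousLinearMap (Matrix.toLin' (B.real ^ n)))
      (Set.pi Set.univ (fun _ : Fin p => Set.Ico (0 : ℝ) 1)) x := fun x _ =>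
    (LinearMap.toContinuousLinearMap (Matrix.toLin' (B.real ^ n))).hasFDerivAt.hasFDerivWithinAt
  have hinj : Function.Injective fun u : Fin p → ℝ => (B.real ^ n) *ᵥ u := by
    intro a b h
    have := congrArg ((B.dual ^ n)ᵀ).mulVec h
    simpa only [Matrix.mulVec_mulVec, B.dual_pow_transpose_mul, Matrix.one_mulVec] using this
  unfold fundDom
  rw [integral_image_eq_integral_abs_det_fderiv_smul volume
    (MeasurableSet.univ_pi fun _ => measurableSet_Ico) hder hinj.injOn]
  rw [integral_smul]
  -- In the coordinates `t = B^n u` the character is a product of one-variable exponentials with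
  -- integer frequencies; the factor with `z k ≠ 0` integrates to zero.
  have h1 : ∀ u : Fin p → ℝ, character ((B.dual ^ n) *ᵥ fun i => (z i : ℝ)) ((B.real ^ n) *ᵥ u) =
      ∏ i, Complex.exp (2 * Real.pi * Complex.I * z i * u i) := by
    intro u
    unfold character
    rw [B.dotProduct_real_pow, ← Complex.exp_sum, dotProduct]
    push_cast
    rw [Finset.mul_sum]
    congr 1
    exact Finset.sum_congr rfl fun i _ => by ring
  simp only [h1]
  have h2 : (volume : Measure (Fin p → ℝ)).restrict
      (Set.pi Set.univ (fun _ : Fin p => Set.Ico (0 : ℝ) 1)) =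
      Measure.pi fun _ => (volume : Measure ℝ).restrict (Set.Ico 0 1) := by
    rw [volume_pi, Measure.restrict_pi_pi]
  rw [h2, integral_fintype_prod_eq_prod
    (f := fun i (x : ℝ) => Complex.exp (2 * Real.pi * Complex.I * z i * x)),
    Finset.prod_eq_zero (Finset.mem_univ k) (integral_exp_Ico _ hk), smul_zero]

end CoveringMatrix

/-! ### Square integrable spinors on the coverings -/

section Tori

variable {p q N : ℕ} (B : CoveringMatrix p) (u : (Fin p → ℤ) → Matrix (Fin q) (Fin q) ℂ)

instance (n : ℕ) [NeZero q] : IsFiniteMeasure (torusMeasure B q n) := by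
  constructor
  rw [torusMeasure, Measure.smul_apply, Measure.restrict_apply_univ, smul_eq_mul]
  refine ENNReal.mul_lt_top ?_ (B.volume_fundDom_ne_top n).lt_top
  rw [ENNReal.inv_lt_top]
  exact_mod_cast Nat.mul_pos (Nat.pos_of_neZero q)
    (pow_pos (Int.natAbs_pos.2 B.det_ne_zero) n)

lemma torusMeasure_univ_ne_zero (n : ℕ) : torusMeasure B q n Set.univ ≠ 0 := by
  rw [torusMeasure, Measure.smul_apply, Measure.restrict_apply_univ, smul_eq_mul]
  exact mul_ne_zero (ENNReal.inv_ne_zero.2 (ENNReal.natCast_ne_top _)) (B.volume_fundDom_pos n).ne'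

lemma integral_torusMeasure {F : Type*} [NormedAddCommGroup F] [NormedSpace ℝ F] (n : ℕ)
    (f : (Fin p → ℝ) → F) : ∫ t, f t ∂(torusMeasure B q n) =
      (((q * B.mat.det.natAbs ^ n : ℕ) : ℝ≥0∞)⁻¹).toReal • ∫ t in B.fundDom n, f t :=
  integral_smul_measure _ _

lemma ae_mem_fundInterior (n : ℕ) : ∀ᵐ t ∂(torusMeasure B q n), t ∈ B.fundInterior n := by
  unfold torusMeasure
  refine Measure.ae_smul_measure ?_ _
  rw [ae_restrict_iff' (B.measurableSet_fundDom n), ae_iff]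
  refine measure_mono_null (fun t ht => ?_) (B.volume_fundDom_diff n)
  simpa using ht

/-! ### Multiplication operators and operators on spinors -/

lemma leftMul_smul_one (a : ℂ) (v : Fibre N q) : leftMul (a • 1) v = a • v := by
  ext i
  simp [leftMul, Matrix.one_apply, mul_ite, ite_mul]

lemma mulOp_spec (n : ℕ) {f : (Fin p → ℝ) → ℂ} (hf : Continuous f) {C : ℝ} (hC : ∀ t, ‖f t‖ ≤ C)
    (ξ : TorusSpace B N q n) : ∀ᵐ t ∂(torusMeasure B q n),
      (mulOp B N n (fun t => f t • 1) ξ : (Fin p → ℝ) → Fibre N q) t =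
        f t • (ξ : (Fin p → ℝ) → Fibre N q) t := by
  have hex : ∃ T : TorusSpace B N q n →L[ℂ] TorusSpace B N q n, ∀ ξ : TorusSpace B N q n,
      ∀ᵐ t ∂(torusMeasure B q n), (T ξ : (Fin p → ℝ) → Fibre N q) t =
        leftMul (f t • 1) ((ξ : (Fin p → ℝ) → Fibre N q) t) := by
    simp only [leftMul_smul_one]
    refine exists_lpOp (A := fun t e => f t • e) (C := C) (fun _ _ _ => smul_add _ _ _)
      (fun _ _ _ => smul_comm _ _ _) (fun t e => ?_) (MeasurePreserving.id _) fun ξ hξ => ?_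
    · rw [norm_smul]
      exact mul_le_mul_of_nonneg_right (hC t) (norm_nonneg _)
    · exact hf.aestronglyMeasurable.smul hξ
  filter_upwards [opOf_spec hex ξ] with t ht
  rw [← leftMul_smul_one]
  exact ht

/-- Multiplication by a character. -/
abbrev charOp (N q n : ℕ) (v : Fin p → ℝ) : TorusSpace B N q n →L[ℂ] TorusSpace B N q n :=
  mulOp B N n (fun t => character v t • 1)

lemma charOp_spec (n : ℕ) (v : Fin p → ℝ) (ξ : TorusSpace B N q n) :
    ∀ᵐ t ∂(torusMeasure B q n), (charOp B N q n v ξ : (Fin p → ℝ) → Fibre N q) t =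
      character v t • (ξ : (Fin p → ℝ) → Fibre N q) t :=
  mulOp_spec B n (continuous_character v) (fun t => (norm_character v t).le) ξ

lemma norm_charOp (n : ℕ) (v : Fin p → ℝ) (ξ : TorusSpace B N q n) :
    ‖charOp B N q n v ξ‖ = ‖ξ‖ := by
  rw [← one_mul ‖ξ‖]
  refine norm_eq_mul_norm_of_ae ?_ zero_le_one
  filter_upwards [charOp_spec B n v ξ] with t ht
  rw [ht, norm_smul, norm_character]

/-- Written as `0 • 1`, the form in which `matrixEntry_character` produces the vanishing entries. -/
lemma mulOp_zero (n : ℕ) :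
    mulOp B N n (fun _ => (0 : ℂ) • (1 : Matrix (Fin q) (Fin q) ℂ)) = 0 := by
  ext1 ξ
  apply Lp.ext
  filter_upwards [mulOp_spec B n (continuous_const (y := (0 : ℂ))) (C := 0) (by simp) ξ,
    Lp.coeFn_zero (Fibre N q) 2 (torusMeasure B q n)] with t h1 h2
  rw [h1, zero_smul, _root_.zero_apply, h2]
  rfl

/-- The action of a matrix on spinors, as a continuous linear map. -/
def spinL (q : ℕ) (M : Matrix (Fin N) (Fin N) ℂ) : Fibre N q →L[ℂ] Fibre N q :=
  LinearMap.toContinuousLinearMap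
    { toFun := spinMul M
      map_add' := fun v w => by
        ext i
        simp [spinMul, mul_add, Finset.sum_add_distrib]
      map_smul' := fun c v => by
        ext i
        simp [spinMul, Finset.mul_sum, mul_left_comm] }

@[simp] lemma spinL_apply (M : Matrix (Fin N) (Fin N) ℂ) (v : Fibre N q) :
    spinL q M v = spinMul M v := rfl

lemma spinOp_spec (n : ℕ) (M : Matrix (Fin N) (Fin N) ℂ) (ξ : TorusSpace B N q n) :
    ∀ᵐ t ∂(torusMeasure B q n), (spinOp B n M ξ : (Fin p → ℝ) → Fibre N q) t =
      spinMul M ((ξ : (Fin p → ℝ) → Fibre N q) t) :=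
  opOf_spec (P := fun T : TorusSpace B N q n →L[ℂ] TorusSpace B N q n =>
    ∀ ξ : TorusSpace B N q n, ∀ᵐ t ∂(torusMeasure B q n),
    (T ξ : (Fin p → ℝ) → Fibre N q) t = spinMul M ((ξ : (Fin p → ℝ) → Fibre N q) t))
    ⟨(spinL q M).compLpL 2 (torusMeasure B q n), fun ξ =>
      ContinuousLinearMap.coeFn_compLpL (spinL q M) ξ⟩ ξ

variable (q N) in
/-- `M ↦ M ⊗ I` as a linear map. -/
def spinOpₗ (n : ℕ) : Matrix (Fin N) (Fin N) ℂ →ₗ[ℂ]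
    (TorusSpace B N q n →L[ℂ] TorusSpace B N q n) where
  toFun := spinOp B n
  map_add' M M' := by
    ext1 ξ
    apply Lp.ext
    rw [_root_.add_apply]
    filter_upwards [spinOp_spec B n (M + M') ξ, spinOp_spec B n M ξ, spinOp_spec B n M' ξ,
      Lp.coeFn_add (spinOp B n M ξ) (spinOp B n M' ξ)] with t h1 h2 h3 h4
    rw [h1, h4, Pi.add_apply, h2, h3]
    ext i
    simp [spinMul, add_mul, Finset.sum_add_distrib]
  map_smul' c M := by
    ext1 ξ
    apply Lp.ext
    rw [_root_.smul_apply]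
    filter_upwards [spinOp_spec B n (c • M) ξ, spinOp_spec B n M ξ,
      Lp.coeFn_smul c (spinOp B n M ξ)] with t h1 h2 h4
    rw [h1, RingHom.id_apply, h4, Pi.smul_apply, h2]
    ext i
    simp [spinMul, Finset.mul_sum, mul_assoc]

lemma spinOpₗ_apply (n : ℕ) (M : Matrix (Fin N) (Fin N) ℂ) :
    spinOpₗ q N B n M = spinOp B n M := rfl

lemma spinMul_mul (M M' : Matrix (Fin N) (Fin N) ℂ) (v : Fibre N q) :
    spinMul M (spinMul M' v) = spinMul (M * M') v := by
  ext i
  simp only [spinMul, Matrix.mul_apply, Finset.mul_sum, Finset.sum_mul]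
  rw [Finset.sum_comm]
  exact Finset.sum_congr rfl fun _ _ => Finset.sum_congr rfl fun _ _ => (mul_assoc _ _ _).symm

lemma spinMul_one (v : Fibre N q) : spinMul 1 v = v := by
  ext i
  simp [spinMul, Matrix.one_apply]

lemma spinOp_mul (n : ℕ) (M M' : Matrix (Fin N) (Fin N) ℂ) (ξ : TorusSpace B N q n) :
    spinOp B n M (spinOp B n M' ξ) = spinOp B n (M * M') ξ := by
  apply Lp.ext
  filter_upwards [spinOp_spec B n M (spinOp B n M' ξ), spinOp_spec B n M' ξ,
    spinOp_spec B n (M * M') ξ] with t h1 h2 h3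
  rw [h1, h2, h3, spinMul_mul]

lemma spinOp_one (n : ℕ) (ξ : TorusSpace B N q n) : spinOp B n 1 ξ = ξ := by
  apply Lp.ext
  filter_upwards [spinOp_spec B n 1 ξ] with t h1
  rw [h1, spinMul_one]

lemma inner_spinMul {M : Matrix (Fin N) (Fin N) ℂ} (hM : M.IsHermitian) (v w : Fibre N q) :
    inner ℂ (spinMul M v) w = inner ℂ v (spinMul M w) := by
  have hcomm : ∀ F : Fin N → (Fin q × Fin q) → Fin N → ℂ,
      ∑ a, ∑ k, ∑ b, F a k b = ∑ b, ∑ k, ∑ a, F a k b := by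
    intro F
    rw [Finset.sum_comm]
    refine Eq.trans (Finset.sum_congr rfl fun k _ => Finset.sum_comm) ?_
    rw [Finset.sum_comm]
  simp only [PiLp.inner_apply, spinMul, RCLike.inner_apply, map_sum, map_mul, Finset.mul_sum,
    Finset.sum_mul]
  rw [Fintype.sum_prod_type, Fintype.sum_prod_type, hcomm]
  refine Finset.sum_congr rfl fun a _ => Finset.sum_congr rfl fun k _ =>
    Finset.sum_congr rfl fun b _ => ?_
  have : (starRingEnd ℂ) (M b a) = M a b := hM.apply a b
  rw [this]
  ring

lemma inner_spinOp (n : ℕ) {M : Matrix (Fin N) (Fin N) ℂ} (hM : M.IsHermitian)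
    (ξ η : TorusSpace B N q n) :
    inner ℂ (spinOp B n M ξ) η = inner ℂ ξ (spinOp B n M η) := by
  rw [L2.inner_def, L2.inner_def]
  refine integral_congr_ae ?_
  filter_upwards [spinOp_spec B n M ξ, spinOp_spec B n M η] with t h1 h2
  rw [h1, h2, inner_spinMul hM]

/-- The Clifford generators, with the normalisation of the commutators with the Dirac operator. -/
def torusClifford (q : ℕ) (ε : Fin p → Matrix (Fin N) (Fin N) ℂ) (c : ℝ) (n : ℕ) (a : Fin p) :
    TorusSpace B N q n →L[ℂ] TorusSpace B N q n :=
  spinOp B n (((2 * Real.pi * c : ℝ) : ℂ) • ε a)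

lemma vecOp_torusClifford (ε : Fin p → Matrix (Fin N) (Fin N) ℂ) (c : ℝ) (n : ℕ) (v : Fin p → ℝ) :
    vecOp (torusClifford B q ε c n) v =
      spinOp B n (∑ a, ((2 * Real.pi * c * v a : ℝ) : ℂ) • ε a) := by
  rw [vecOp, ← spinOpₗ_apply, map_sum]
  refine Finset.sum_congr rfl fun a _ => ?_
  rw [torusClifford, ← spinOpₗ_apply, ← map_smul, smul_smul]
  congr 2
  push_cast
  ring

/-- `norm_vecOp` takes a nonnegative scale and only its square enters the relations, so the absolute
value allows negative `c`. -/
lemma norm_vecOp_torusClifford {ε : Fin p → Matrix (Fin N) (Fin N) ℂ} (hε : IsClifford ε) (c : ℝ)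
    (n : ℕ) (v : Fin p → ℝ) (ξ : TorusSpace B N q n) :
    ‖vecOp (torusClifford B q ε c n) v ξ‖ = |2 * Real.pi * c| * euclidLength v * ‖ξ‖ := by
  refine norm_vecOp (abs_nonneg _) (fun a x y => ?_) (fun a b x => ?_) v ξ
  · refine inner_spinOp B n ?_ x y
    rw [Matrix.IsHermitian, Matrix.conjTranspose_smul, (hε.1 a).eq]
    simp
  · have h : spinOp B n (((2 * Real.pi * c : ℝ) : ℂ) • ε a * ((2 * Real.pi * c : ℝ) : ℂ) • ε b) x +
        spinOp B n (((2 * Real.pi * c : ℝ) : ℂ) • ε b * ((2 * Real.pi * c : ℝ) : ℂ) • ε a) x =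
        spinOp B n ((((2 * Real.pi * c : ℝ) : ℂ) ^ 2) • (ε a * ε b + ε b * ε a)) x := by
      rw [← _root_.add_apply, ← spinOpₗ_apply, ← spinOpₗ_apply, ← map_add, spinOpₗ_apply]
      congr 2
      rw [smul_mul_smul_comm, smul_mul_smul_comm, ← smul_add, sq]
    rw [torusClifford, torusClifford, spinOp_mul, spinOp_mul, h, hε.2]
    split_ifs with hab
    · have h2 : (((2 * Real.pi * c : ℝ) : ℂ) ^ 2) • (2 : Matrix (Fin N) (Fin N) ℂ) =
          (2 * (|2 * Real.pi * c| : ℝ) ^ 2 : ℂ) • 1 := by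
        have h3 : (2 : Matrix (Fin N) (Fin N) ℂ) = (2 : ℂ) • 1 := by
          rw [← Algebra.algebraMap_eq_smul_one]
          exact (map_ofNat (algebraMap ℂ (Matrix (Fin N) (Fin N) ℂ)) 2).symm
        rw [h3, smul_smul, ← Complex.ofReal_pow |2 * Real.pi * c|, sq_abs, Complex.ofReal_pow]
        congr 1
        ring
      rw [h2, ← spinOpₗ_apply, map_smul, spinOpₗ_apply, _root_.smul_apply, spinOp_one]
    · rw [smul_zero, ← spinOpₗ_apply, map_zero, _root_.zero_apply]

lemma spinOp_charOp (n : ℕ) (M : Matrix (Fin N) (Fin N) ℂ) (v : Fin p → ℝ)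
    (ξ : TorusSpace B N q n) :
    spinOp B n M (charOp B N q n v ξ) = charOp B N q n v (spinOp B n M ξ) := by
  apply Lp.ext
  filter_upwards [spinOp_spec B n M (charOp B N q n v ξ), charOp_spec B n v ξ,
    charOp_spec B n v (spinOp B n M ξ), spinOp_spec B n M ξ] with t h1 h2 h3 h4
  rw [h1, h2, h3, h4, ← spinL_apply, map_smul, spinL_apply]

end Tori

/-! ### The Dirac operators on the coverings -/

section TorusDirac

variable {p q N : ℕ} (B : CoveringMatrix p) (u : (Fin p → ℤ) → Matrix (Fin q) (Fin q) ℂ)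

/-- The differential expression of the Dirac operator. -/
def diracExpr (ε : Fin p → Matrix (Fin N) (Fin N) ℂ) (c : ℝ) (φ : (Fin p → ℝ) → Fibre N q)
    (t : Fin p → ℝ) : Fibre N q :=
  (-Complex.I * c) • ∑ a, spinMul (ε a) (fderiv ℝ φ t (Pi.single a 1))

/-- The smooth invariant spinors with their images under the Dirac operator. -/
def torusGraph (ε : Fin p → Matrix (Fin N) (Fin N) ℂ) (c : ℝ) (n : ℕ) :
    Set (TorusSpace B N q n × TorusSpace B N q n) :=
  {z | ∃ φ : (Fin p → ℝ) → Fibre N q,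
    ContDiff ℝ ∞ φ ∧
    (∀ i, IsInvariant B u n (fun t => Matrix.of fun a b => φ t (i, a, b))) ∧
    (z.1 : (Fin p → ℝ) → Fibre N q) =ᵐ[torusMeasure B q n] φ ∧
    (z.2 : (Fin p → ℝ) → Fibre N q) =ᵐ[torusMeasure B q n] diracExpr ε c φ}

lemma torusDirac_eq (ε : Fin p → Matrix (Fin N) (Fin N) ℂ) (c : ℝ) (n : ℕ) :
    torusDirac B u ε c n = opOfGraph (torusGraph B u ε c n) := rfl

lemma character_sub_lattice {n : ℕ} {v : Fin p → ℝ} (hv : v ∈ B.group n) (m : Fin p → ℤ)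
    (t : Fin p → ℝ) :
    character v (t - fun i => (((B.mat ^ n) *ᵥ m) i : ℝ)) = character v t := by
  rw [sub_eq_add_neg, character_add_right, character_neg_right, B.character_lattice hv, inv_one,
    mul_one]

/-- The product rule: `∂_a` of the character brings down `2πi v_a`, and `(-i c)(2πi v_a) = 2πc v_a`.
-/
lemma diracExpr_character (ε : Fin p → Matrix (Fin N) (Fin N) ℂ) (c : ℝ) {φ : (Fin p → ℝ) → Fibre N q}
    (hφ : ContDiff ℝ ∞ φ) (v t : Fin p → ℝ) :
    diracExpr ε c (fun t => character v t • φ t) t = character v t • diracExpr ε c φ t +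
      spinMul (∑ a, ((2 * Real.pi * c * v a : ℝ) : ℂ) • ε a) (character v t • φ t) := by
  have hd : ∀ a : Fin p, fderiv ℝ (fun t => character v t • φ t) t (Pi.single a 1) =
      character v t • fderiv ℝ φ t (Pi.single a 1) +
        ((2 * Real.pi * Complex.I * v a) * character v t) • φ t := by
    intro a
    have h1 : DifferentiableAt ℝ (character v) t :=
      (contDiff_character v).differentiable (by simp) t
    have h2 : DifferentiableAt ℝ φ t := hφ.differentiable (by simp) t
    have h3 : fderiv ℝ (fun t => character v t • φ t) t =
        character v t • fderiv ℝ φ t + (fderiv ℝ (character v) t).smulRight (φ t) :=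
      fderiv_fun_smul h1 h2
    rw [h3]
    simp only [_root_.add_apply, _root_.smul_apply, ContinuousLinearMap.smulRight_apply]
    rw [hasFDerivAt_character, dotProduct_single_one]
  have hs : ∀ w : Fibre N q, spinMul (∑ a, ((2 * Real.pi * c * v a : ℝ) : ℂ) • ε a) w =
      ∑ a, ((2 * Real.pi * c * v a : ℝ) : ℂ) • spinMul (ε a) w := by
    intro w
    ext i
    simp only [spinMul, WithLp.ofLp_sum, Finset.sum_apply, PiLp.smul_apply, Matrix.sum_apply,
      Matrix.smul_apply, Finset.sum_mul, smul_eq_mul, Finset.mul_sum]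
    rw [Finset.sum_comm]
    exact Finset.sum_congr rfl fun _ _ => Finset.sum_congr rfl fun _ _ => mul_assoc _ _ _
  rw [hs]
  unfold diracExpr
  simp only [hd, ← spinL_apply (q := q), map_add, map_smul, Finset.sum_add_distrib, smul_add,
    Finset.smul_sum, smul_smul]
  congr 1
  · exact Finset.sum_congr rfl fun a _ => by ring_nf
  · refine Finset.sum_congr rfl fun a _ => ?_
    congr 1
    push_cast
    linear_combination (-(c : ℂ) * 2 * Real.pi * v a * character v t) * Complex.I_mul_I

/-- Multiplication by a character commutes with the Dirac operator up to a matrix. -/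
lemma torusGraph_twist (ε : Fin p → Matrix (Fin N) (Fin N) ℂ) (c : ℝ) {n : ℕ} {v : Fin p → ℝ}
    (hv : v ∈ B.group n) (z : TorusSpace B N q n × TorusSpace B N q n)
    (hz : z ∈ torusGraph B u ε c n) :
    (charOp B N q n v z.1, charOp B N q n v z.2 +
      (vecOp (torusClifford B q ε c n) v ∘L charOp B N q n v) z.1) ∈ torusGraph B u ε c n := by
  obtain ⟨φ, hφ, hinv, h1, h2⟩ := hz
  refine ⟨fun t => character v t • φ t, (contDiff_character v).smul hφ, fun i m => ?_, ?_, ?_⟩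
  · have h3 := hinv i m
    funext t
    have h4 := congrFun h3 t
    simp only [translate] at h4 ⊢
    have h5 : (Matrix.of fun a b => (character v t • φ t) (i, a, b)) =
        character v t • Matrix.of fun a b => φ t (i, a, b) := by
      ext a b
      simp
    have h6 : (Matrix.of fun a b => (character v (t - fun i => (((B.mat ^ n) *ᵥ m) i : ℝ)) •
        φ (t - fun i => (((B.mat ^ n) *ᵥ m) i : ℝ))) (i, a, b)) =
        character v t • Matrix.of fun a b =>
          φ (t - fun i => (((B.mat ^ n) *ᵥ m) i : ℝ)) (i, a, b) := by
      ext a b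
      simp [character_sub_lattice B hv]
    rw [h5, h6, Matrix.mul_smul, Matrix.smul_mul, ← h4]
  · filter_upwards [charOp_spec B n v z.1, h1] with t h3 h4
    rw [h3, h4]
  · rw [ContinuousLinearMap.comp_apply, vecOp_torusClifford]
    filter_upwards [charOp_spec B n v z.1, charOp_spec B n v z.2, h1, h2,
      spinOp_spec B n (∑ a, ((2 * Real.pi * c * v a : ℝ) : ℂ) • ε a) (charOp B N q n v z.1),
      Lp.coeFn_add (charOp B N q n v z.2)
        (spinOp B n (∑ a, ((2 * Real.pi * c * v a : ℝ) : ℂ) • ε a) (charOp B N q n v z.1))]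
      with t h3 h4 h5 h6 h7 h8
    rw [h8, Pi.add_apply, h7, h3, h4, h5, h6, diracExpr_character ε c hφ]

/-! ### Closability -/

variable [NeZero q]

/-- The integral against a bounded continuous function. -/
lemma exists_integralCLM (n : ℕ) {g : (Fin p → ℝ) → ℝ} (hg : Continuous g)
    (hgs : HasCompactSupport g) : ∃ J : TorusSpace B N q n →L[ℂ] Fibre N q,
      ∀ ξ, J ξ = ∫ t, g t • (ξ : (Fin p → ℝ) → Fibre N q) t ∂(torusMeasure B q n) := by
  obtain ⟨C, hC⟩ := hgs.exists_bound_of_continuous hg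
  have hint : ∀ ξ : TorusSpace B N q n,
      Integrable (ξ : (Fin p → ℝ) → Fibre N q) (torusMeasure B q n) := fun ξ =>
    (Lp.memLp ξ).integrable (by norm_num)
  have hint2 : ∀ ξ : TorusSpace B N q n,
      Integrable (fun t => g t • (ξ : (Fin p → ℝ) → Fibre N q) t) (torusMeasure B q n) := fun ξ =>
    (hint ξ).bdd_smul C hg.aestronglyMeasurable (Eventually.of_forall hC)
  let J : TorusSpace B N q n →ₗ[ℂ] Fibre N q :=
    { toFun := fun ξ => ∫ t, g t • (ξ : (Fin p → ℝ) → Fibre N q) t ∂(torusMeasure B q n)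
      map_add' := fun ξ η => by
        rw [← integral_add (hint2 ξ) (hint2 η)]
        refine integral_congr_ae ?_
        filter_upwards [Lp.coeFn_add ξ η] with t ht
        rw [ht, Pi.add_apply, smul_add]
      map_smul' := fun a ξ => by
        rw [RingHom.id_apply, ← integral_smul]
        refine integral_congr_ae ?_
        filter_upwards [Lp.coeFn_smul a ξ] with t ht
        rw [ht, Pi.smul_apply, smul_comm] }
  -- The constant is the bound of `g` times the norm of the inclusion `L² ⊆ L¹` on a finite measure
  -- space.
  refine ⟨J.mkContinuous (|C| * ((torusMeasure B q n Set.univ) ^ (1 / (1 : ℝ≥0∞).toReal -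
    1 / (2 : ℝ≥0∞).toReal)).toReal) fun ξ => ?_, fun ξ => rfl⟩
  change ‖∫ t, g t • (ξ : (Fin p → ℝ) → Fibre N q) t ∂(torusMeasure B q n)‖ ≤ _
  calc ‖∫ t, g t • (ξ : (Fin p → ℝ) → Fibre N q) t ∂(torusMeasure B q n)‖
      ≤ ∫ t, |C| * ‖(ξ : (Fin p → ℝ) → Fibre N q) t‖ ∂(torusMeasure B q n) := by
        refine norm_integral_le_of_norm_le ((hint ξ).norm.const_mul _)
          (Eventually.of_forall fun t => ?_)
        rw [norm_smul]
        exact mul_le_mul_of_nonneg_right ((hC t).trans (le_abs_self C)) (norm_nonneg _)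
    _ = |C| * ∫ t, ‖(ξ : (Fin p → ℝ) → Fibre N q) t‖ ∂(torusMeasure B q n) :=
        integral_const_mul _ _
    _ ≤ |C| * (((torusMeasure B q n Set.univ) ^ (1 / (1 : ℝ≥0∞).toReal -
          1 / (2 : ℝ≥0∞).toReal)).toReal * ‖ξ‖) := by
        refine mul_le_mul_of_nonneg_left ?_ (abs_nonneg _)
        rw [integral_norm_eq_lintegral_enorm (Lp.aestronglyMeasurable ξ), ← eLpNorm_one_eq_lintegral_enorm,
          Lp.norm_def, ← ENNReal.toReal_mul, mul_comm]
        refine ENNReal.toReal_mono ?_ (eLpNorm_le_eLpNorm_mul_rpow_measure_univ (by norm_num)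
          (Lp.aestronglyMeasurable ξ))
        refine ENNReal.mul_ne_top (Lp.eLpNorm_ne_top ξ) ?_
        exact ENNReal.rpow_ne_top_of_nonneg (by norm_num) (measure_ne_top _ _)
    _ = _ := by ring

lemma integral_torusMeasure_of_support (n : ℕ) {g : (Fin p → ℝ) → ℝ}
    (hg : Function.support g ⊆ B.fundDom n) (f : (Fin p → ℝ) → Fibre N q) :
    ∫ t, g t • f t ∂(torusMeasure B q n) =
      (((q * B.mat.det.natAbs ^ n : ℕ) : ℝ≥0∞)⁻¹).toReal • ∫ t, g t • f t := by
  rw [integral_torusMeasure, setIntegral_eq_integral_of_forall_compl_eq_zero]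
  intro t ht
  have : g t = 0 := by
    by_contra h
    exact ht (hg h)
  rw [this, zero_smul]

/-- A test function with compact support inside the open fundamental domain turns the integrals into
integrals over `ℝ^p`, where integration by parts has no boundary terms. -/
lemma integral_smul_fderiv_torus (n : ℕ) {g : (Fin p → ℝ) → ℝ} (hg : ContDiff ℝ ∞ g)
    (hgc : HasCompactSupport g) (hgs : tsupport g ⊆ B.fundInterior n)
    {φ : (Fin p → ℝ) → Fibre N q} (hφ : ContDiff ℝ ∞ φ) (s : Fin p → ℝ) :
    ∫ t, g t • fderiv ℝ φ t s ∂(torusMeasure B q n) =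
      -∫ t, fderiv ℝ g t s • φ t ∂(torusMeasure B q n) := by
  have hsub : tsupport g ⊆ B.fundDom n := hgs.trans (B.fundInterior_subset n)
  have hc1 : Continuous fun t => fderiv ℝ φ t s :=
    (hφ.continuous_fderiv (by simp)).clm_apply continuous_const
  have hc2 : Continuous fun t => fderiv ℝ g t s :=
    (hg.continuous_fderiv (by simp)).clm_apply continuous_const
  have hcs : HasCompactSupport fun t => fderiv ℝ g t s := hgc.fderiv_apply ℝ s
  have hsupp : Function.support (fun t => fderiv ℝ g t s) ⊆ tsupport g := by
    intro t ht
    by_contra h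
    apply ht
    have : fderiv ℝ g t = 0 := by
      by_contra h0
      exact h (support_fderiv_subset ℝ h0)
    simp [this]
  rw [integral_torusMeasure_of_support B n ((subset_tsupport g).trans hsub),
    integral_torusMeasure_of_support B n (hsupp.trans hsub), ← smul_neg]
  congr 1
  refine integral_smul_fderiv_eq_neg_fderiv_smul_of_integrable ?_ ?_ ?_ ?_ ?_
  · exact (hc2.smul hφ.continuous).integrable_of_hasCompactSupport hcs.smul_right
  · exact (hg.continuous.smul hc1).integrable_of_hasCompactSupport hgc.smul_right
  · exact (hg.continuous.smul hφ.continuous).integrable_of_hasCompactSupport hgc.smul_right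
  · exact fun t _ => hg.differentiable (by simp) t
  · exact fun t _ => hφ.differentiable (by simp) t

/-- The Dirac operator on smooth spinors is closable. -/
lemma torusGraph_closable (ε : Fin p → Matrix (Fin N) (Fin N) ℂ) (c : ℝ) (n : ℕ) :
    ∀ z ∈ (Submodule.span ℂ (torusGraph B u ε c n)).topologicalClosure, z.1 = 0 → z.2 = 0 := by
  intro z hz hz1
  have hint : Integrable (z.2 : (Fin p → ℝ) → Fibre N q) (torusMeasure B q n) :=
    (Lp.memLp z.2).integrable (by norm_num)
  have key : ∀ g : (Fin p → ℝ) → ℝ, ContDiff ℝ ∞ g → HasCompactSupport g →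
      tsupport g ⊆ B.fundInterior n →
      ∫ t, g t • (z.2 : (Fin p → ℝ) → Fibre N q) t ∂(torusMeasure B q n) = 0 := by
    intro g hg hgc hgs
    obtain ⟨J, hJ⟩ := exists_integralCLM (N := N) (q := q) B n hg.continuous hgc
    have hex : ∀ a : Fin p, ∃ J' : TorusSpace B N q n →L[ℂ] Fibre N q, ∀ ξ, J' ξ =
        ∫ t, fderiv ℝ g t (Pi.single a 1) • (ξ : (Fin p → ℝ) → Fibre N q) t
          ∂(torusMeasure B q n) := fun a =>
      exists_integralCLM B n ((hg.continuous_fderiv (by simp)).clm_apply continuous_const)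
        (hgc.fderiv_apply ℝ _)
    choose J' hJ' using hex
    -- The weak form of `η = D ξ` against `g`, with the derivative moved to `g`. It is continuous on
    -- pairs and vanishes on smooth ones, hence on the closure.
    let Θ : TorusSpace B N q n × TorusSpace B N q n →L[ℂ] Fibre N q :=
      J ∘L ContinuousLinearMap.snd ℂ _ _ -
        (Complex.I * c) • ∑ a, spinL q (ε a) ∘L J' a ∘L ContinuousLinearMap.fst ℂ _ _
    have hΘ : ∀ z, Θ z = J z.2 - (Complex.I * c) • ∑ a, spinMul (ε a) (J' a z.1) := by
      intro z
      simp [Θ]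
    have hle : Submodule.span ℂ (torusGraph B u ε c n) ≤ LinearMap.ker (Θ : _ →ₗ[ℂ] Fibre N q) := by
      refine Submodule.span_le.2 ?_
      rintro y ⟨φ, hφ, -, h1, h2⟩
      change Θ y = 0
      rw [hΘ, hJ]
      have hbdd : ∀ a : Fin p, Integrable (fun t => g t • fderiv ℝ φ t (Pi.single a 1))
          (torusMeasure B q n) := by
        intro a
        have hc1 : Continuous fun t => fderiv ℝ φ t (Pi.single a 1) :=
          (hφ.continuous_fderiv (by simp)).clm_apply continuous_const
        have := (hg.continuous.smul hc1).integrable_of_hasCompactSupport (μ := volume)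
          hgc.smul_right
        exact (this.restrict).smul_measure (by
          simp [NeZero.ne q, B.det_ne_zero])
      have e1 : ∫ t, g t • (y.2 : (Fin p → ℝ) → Fibre N q) t ∂(torusMeasure B q n) =
          ∫ t, (-Complex.I * c) • ∑ a, spinL q (ε a) (g t • fderiv ℝ φ t (Pi.single a 1))
            ∂(torusMeasure B q n) := by
        refine integral_congr_ae ?_
        filter_upwards [h2] with t ht
        rw [ht, diracExpr, smul_comm, Finset.smul_sum]
        congr 1
        refine Finset.sum_congr rfl fun a _ => ?_
        rw [← spinL_apply]
        exact ((spinL q (ε a)).map_smul_of_tower (g t) _).symm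
      have e2 : ∀ a, ∫ t, spinL q (ε a) (g t • fderiv ℝ φ t (Pi.single a 1)) ∂(torusMeasure B q n) =
          -spinMul (ε a) (J' a y.1) := by
        intro a
        rw [ContinuousLinearMap.integral_comp_comm _ (hbdd a),
          integral_smul_fderiv_torus B n hg hgc hgs hφ, map_neg, spinL_apply, hJ']
        congr 2
        refine integral_congr_ae ?_
        filter_upwards [h1] with t ht
        rw [ht]
      rw [e1, integral_smul, integral_finsetSum _ fun a _ =>
        (spinL q (ε a)).integrable_comp (hbdd a)]
      simp only [e2, Finset.sum_neg_distrib, smul_neg, neg_mul, neg_smul, neg_neg, sub_self]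
    have hcl : z ∈ LinearMap.ker (Θ : _ →ₗ[ℂ] Fibre N q) :=
      Submodule.topologicalClosure_minimal _ hle (ContinuousLinearMap.isClosed_ker Θ) hz
    have h3 : Θ z = 0 := hcl
    rw [hΘ, hz1] at h3
    rw [← hJ]
    have h5 : ∀ a, spinMul (ε a) (J' a 0) = 0 := fun a => by
      rw [map_zero, ← spinL_apply, map_zero]
    change J z.2 - (Complex.I * c) • ∑ a, spinMul (ε a) (J' a 0) = 0 at h3
    simpa only [h5, Finset.sum_const_zero, smul_zero, sub_zero] using h3
  -- The fundamental lemma of the calculus of variations gives zero on the open domain; the rest of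
  -- the fundamental domain is a null set.
  have h4 := (B.isOpen_fundInterior n).ae_eq_zero_of_integral_contDiff_smul_eq_zero
    (hint.locallyIntegrable.locallyIntegrableOn _) key
  apply Lp.ext
  filter_upwards [h4, ae_mem_fundInterior (q := q) B n,
    Lp.coeFn_zero (Fibre N q) 2 (torusMeasure B q n)] with t h5 h6 h7
  rw [h5 h6, h7]
  rfl

lemma isClosed_torusDirac_graph (ε : Fin p → Matrix (Fin N) (Fin N) ℂ) (c : ℝ) (n : ℕ) :
    IsClosed ((torusDirac B u ε c n).graph :
      Set (TorusSpace B N q n × TorusSpace B N q n)) := by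
  rw [torusDirac_eq, opOfGraph_graph (torusGraph_closable B u ε c n)]
  exact Submodule.isClosed_topologicalClosure _

lemma torusDirac_twist (ε : Fin p → Matrix (Fin N) (Fin N) ℂ) (c : ℝ) {n : ℕ} {v : Fin p → ℝ}
    (hv : v ∈ B.group n) (e f : TorusSpace B N q n) (h : (e, f) ∈ (torusDirac B u ε c n).graph) :
    (charOp B N q n v e, charOp B N q n v f +
      vecOp (torusClifford B q ε c n) v (charOp B N q n v e)) ∈ (torusDirac B u ε c n).graph :=
  opOfGraph_twist (torusGraph_closable B u ε c n) (F := vecOp (torusClifford B q ε c n) v ∘L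
    charOp B N q n v) (torusGraph_twist B u ε c hv) e f h

end TorusDirac

/-! ### Common conclusion for the three coverings -/

section CoveringConclusion

variable {p : ℕ} (B : CoveringMatrix p)
  {H : ℕ → Type*} [∀ n, NormedAddCommGroup (H n)] [∀ n, InnerProductSpace ℂ (H n)]
  [∀ n, CompleteSpace (H n)] {A : ∀ n, StarSubalgebra ℂ (H n →L[ℂ] H n)}
  {H' : Type*} [NormedAddCommGroup H'] [InnerProductSpace ℂ H']
  [CompleteSpace H'] {A' : StarSubalgebra ℂ (H' →L[ℂ] H')}

lemma ofReal_length_pos {r : ℝ} (hr : 0 < r) (n : ℕ) :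
    0 < ENNReal.ofReal (r * euclidLength (B.freq n)) :=
  ENNReal.ofReal_pos.2 (mul_pos hr (euclidLength_pos (B.freq_ne_zero n)))

lemma tendsto_ofReal_length (r : ℝ) :
    Tendsto (fun n => ENNReal.ofReal (r * euclidLength (B.freq n))) atTop (𝓝 0) := by
  have := ENNReal.tendsto_ofReal ((tendsto_euclidLength_freq B).const_mul r)
  simpa using this

/-- The conclusions for elements whose seminorms are multiples of the lengths of the frequencies. -/
lemma covering_conclusion {D : ∀ n, H n →ₗ.[ℂ] H n} {D' : H' →ₗ.[ℂ] H'} {x : ∀ n, A n} {x' : ℕ → A'}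
    {r : ℝ} (hr : 0 < r)
    (hx : ∀ n, lipSeminorm (D n) (A n) (x n) = ENNReal.ofReal (r * euclidLength (B.freq n)))
    (hx' : ∀ n, lipSeminorm D' A' (x' n) = ENNReal.ofReal (r * euclidLength (B.freq n)))
    {ξ : ∀ n, H n} (hξ : ∀ n, ‖ξ n‖ = 1)
    (h : ∀ n (a : ℂ), 1 ≤ ‖(x n : H n →L[ℂ] H n) (ξ n) - a • ξ n‖)
    {ξ' : ℕ → H'} (hξ' : ∀ n, ‖ξ' n‖ = 1)
    (h' : ∀ n (a : ℂ), 1 ≤ ‖(x' n : H' →L[ℂ] H') (ξ' n) - a • ξ' n‖) :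
    Tendsto (fun n => normicRadius (lipSeminorm (D n) (A n))) atTop (𝓝 ⊤) ∧
      ((∀ n, lipSeminorm D' A' (x' n) = lipSeminorm (D n) (A n) (x n)) ∧
        UnboundedSeq (fun n => lipSeminorm (D n) (A n)) x ∧
        UnboundedSeqIn (lipSeminorm D' A') x') ∧
      ¬ BallTotallyBounded (lipSeminorm D' A') ∧ ¬ IsLipNorm (lipSeminorm D' A') := by
  have hU : UnboundedSeq (fun n => lipSeminorm (D n) (A n)) x := by
    refine unboundedSeq_of_tendsto (fun n => ?_) ?_ (fun n => ?_) one_pos hξ h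
    · rw [hx]; exact ofReal_length_pos B hr n
    · simp only [hx]; exact tendsto_ofReal_length B r
    · rw [hx]; exact ENNReal.ofReal_lt_top
  have hpos : ∀ n, 0 < lipSeminorm D' A' (x' n) := fun n => by
    rw [hx']; exact ofReal_length_pos B hr n
  have hlim : Tendsto (fun n => lipSeminorm D' A' (x' n)) atTop (𝓝 0) := by
    simp only [hx']; exact tendsto_ofReal_length B r
  have hfin : ∀ n, lipSeminorm D' A' (x' n) < ⊤ := fun n => by
    rw [hx']; exact ENNReal.ofReal_lt_top
  have hU' : UnboundedSeqIn (lipSeminorm D' A') x' :=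
    unboundedSeq_of_tendsto (D := fun _ => D') (A := fun _ => A') hpos hlim hfin one_pos hξ' h'
  exact ⟨tendsto_normicRadius hU, ⟨fun n => (hx' n).trans (hx n).symm, hU, hU'⟩,
    not_ballTotallyBounded hU', not_isLipNorm_of_unboundedSeqIn hpos hlim hfin one_pos hξ' h'⟩

lemma subset_cstarGen {H : Type*} [NormedAddCommGroup H] [InnerProductSpace ℂ H] [CompleteSpace H]
    {S : Set (H →L[ℂ] H)} {T : H →L[ℂ] H} (h : T ∈ S) : T ∈ cstarGen S :=
  StarSubalgebra.le_topologicalClosure _ (StarAlgebra.subset_adjoin ℂ S h)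

end CoveringConclusion

/-! ### Characters as unbounded sequences for tori and rational rotation algebras -/

section TorusMain

variable {p q N : ℕ} (B : CoveringMatrix p) (u : (Fin p → ℤ) → Matrix (Fin q) (Fin q) ℂ)

/-- Conjugation by the unitaries is trivial on scalar functions, so the entry is an average of the
character of frequency `w` over `ℤ^p / B^n ℤ^p`. Orthogonality keeps it exactly when `w ∈ G_0`. -/
lemma matrixEntry_character (hu : ∀ g, u g * (u g)ᴴ = 1) {n : ℕ} {v : Fin p → ℝ}
    (hv : v ∈ B.group n) (j k : Fin n → B.Digit) :
    matrixEntry B u n (fun t => character v t • 1) j k = fun t =>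
      ((open Classical in if v + B.wordSum j - B.wordSum k ∈ B.group 0 then
        character (v + B.wordSum j - B.wordSum k) t else 0) : ℂ) • 1 := by
  set w := v + B.wordSum j - B.wordSum k with hw
  have hwn : w ∈ B.group n :=
    (B.group n).sub_mem ((B.group n).add_mem hv (B.wordSum_mem j)) (B.wordSum_mem k)
  have hr : ((B.mat.det.natAbs ^ n : ℕ) : ℂ) ≠ 0 := by
    exact_mod_cast pow_ne_zero n (Int.natAbs_ne_zero.2 B.det_ne_zero)
  funext t
  unfold matrixEntry
  have hterm : ∀ g : Fin p → ℤ, character (B.wordSum j - B.wordSum k) (t - fun i => (g i : ℝ)) •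
      translate u g (fun t => character v t • (1 : Matrix (Fin q) (Fin q) ℂ)) t =
      (character w t * character w (-fun i => (g i : ℝ))) • 1 := by
    intro g
    rw [translate, Matrix.mul_smul, Matrix.smul_mul, mul_one, hu, smul_smul, ← character_add_left,
      ← character_add_right, ← sub_eq_add_neg]
    congr 2
    rw [hw]
    abel
  simp only [hterm]
  have hsum := B.finsum_character hwn
  rw [finsum_mem_eq_finite_toFinset_sum _ (B.finite_fundDom n)] at hsum ⊢
  rw [← Finset.sum_smul, ← Finset.mul_sum, hsum, smul_smul]
  congr 1
  split_ifs with h0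
  · field_simp
  · simp

/-- The factor `1` matches the parameter `s` of `diracPlus_twist`, which distinguishes tori (`s =
1`) from crossed products (`s = -1`). -/
lemma exists_wordPerm_smul {n : ℕ} {v : Fin p → ℝ} (hv : v ∈ B.group n) :
    ∃ π : Equiv.Perm (Fin n → B.Digit), ∀ j k,
      v + (1 : ℝ) • (B.wordSum j - B.wordSum k) ∈ B.group 0 ↔ k = π j := by
  simpa only [one_smul, add_sub_assoc] using B.exists_wordPerm hv

variable [NeZero q] [NeZero N]

variable (q N) in
/-- The vector `e₀ ⊗ 1`. -/
def unitFibre : Fibre N q :=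
  WithLp.toLp 2 fun i => if i.1 = 0 ∧ i.2.1 = i.2.2 then 1 else 0

lemma unitFibre_ne_zero : unitFibre q N ≠ 0 := by
  intro h
  have := congrArg (fun v : Fibre N q => v (0, 0, 0)) h
  simp [unitFibre] at this

variable (q N) in
/-- The normalised constant spinor. -/
def constSpinor (n : ℕ) : TorusSpace B N q n :=
  ((‖Lp.const 2 (torusMeasure B q n) (unitFibre q N)‖⁻¹ : ℝ) : ℂ) •
    Lp.const 2 (torusMeasure B q n) (unitFibre q N)

lemma norm_constSpinor (n : ℕ) : ‖constSpinor q N B n‖ = 1 := by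
  have h : ‖Lp.const 2 (torusMeasure B q n) (unitFibre q N)‖ ≠ 0 := by
    have h0 : torusMeasure B q n ≠ 0 := fun h =>
      torusMeasure_univ_ne_zero (q := q) B n (by rw [h]; rfl)
    rw [Lp.norm_const' 2 (torusMeasure B q n) _ (by norm_num) (by norm_num)]
    refine mul_ne_zero (norm_ne_zero_iff.2 unitFibre_ne_zero) ?_
    refine (Real.rpow_pos_of_pos ?_ _).ne'
    exact ENNReal.toReal_pos (torusMeasure_univ_ne_zero B n) (measure_ne_top _ _)
  rw [constSpinor, norm_smul, Complex.norm_real, norm_inv, norm_norm, inv_mul_cancel₀ h]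

/-- The matrix part is the identity, which conjugation by unitaries fixes; so the constant spinor is
smooth and invariant, and its derivatives vanish. -/
lemma constSpinor_mem_domain (hu : ∀ g, u g * (u g)ᴴ = 1) (ε : Fin p → Matrix (Fin N) (Fin N) ℂ)
    (c : ℝ) (n : ℕ) : constSpinor q N B n ∈ (torusDirac B u ε c n).domain := by
  refine Submodule.smul_mem _ _ ?_
  rw [torusDirac_eq]
  refine mem_opOfGraph_domain (f := 0) ⟨fun _ => unitFibre q N, contDiff_const, fun i m => ?_,
    Lp.coeFn_const .., ?_⟩
  · funext t
    have h1 : (Matrix.of fun a b => unitFibre q N (i, a, b)) =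
        (if i = 0 then (1 : ℂ) else 0) • (1 : Matrix (Fin q) (Fin q) ℂ) := by
      ext a b
      by_cases hi : i = 0 <;> simp [unitFibre, hi, Matrix.one_apply]
    simp only [translate, h1, Matrix.mul_smul, Matrix.smul_mul, mul_one, hu]
  · filter_upwards [Lp.coeFn_zero (Fibre N q) 2 (torusMeasure B q n)] with t ht
    rw [ht, diracExpr]
    have : ∀ a, spinMul (q := q) (ε a) (0 : Fibre N q) = 0 := fun a => by
      rw [← spinL_apply, map_zero]
    simp [this]

lemma constSpinor_ne_zero (n : ℕ) : constSpinor q N B n ≠ 0 := by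
  intro h
  have := norm_constSpinor (N := N) (q := q) B n
  rw [h, norm_zero] at this
  exact zero_ne_one this

lemma inner_constSpinor_charOp {n : ℕ} {v : Fin p → ℝ} (hv : v ∈ B.group n) (hv0 : v ≠ 0) :
    inner ℂ (constSpinor q N B n) (charOp B N q n v (constSpinor q N B n)) = 0 := by
  have h : inner ℂ (Lp.const 2 (torusMeasure B q n) (unitFibre q N) : TorusSpace B N q n)
      (charOp B N q n v (Lp.const 2 (torusMeasure B q n) (unitFibre q N))) = 0 := by
    rw [L2.inner_def]
    have e1 : ∫ t, inner ℂ ((Lp.const 2 (torusMeasure B q n) (unitFibre q N) :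
          TorusSpace B N q n) t)
        ((charOp B N q n v (Lp.const 2 (torusMeasure B q n) (unitFibre q N)) :
          TorusSpace B N q n) t) ∂(torusMeasure B q n) =
        ∫ t, character v t * inner ℂ (unitFibre q N) (unitFibre q N) ∂(torusMeasure B q n) := by
      refine integral_congr_ae ?_
      filter_upwards [charOp_spec B n v (Lp.const 2 (torusMeasure B q n) (unitFibre q N)),
        Lp.coeFn_const (p := 2) (μ := torusMeasure B q n) (unitFibre q N)] with t h1 h2
      rw [h1, h2, Function.const_apply, inner_smul_right]
    rw [e1, integral_mul_const, integral_torusMeasure, B.integral_character hv hv0, smul_zero,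
      zero_mul]
  rw [constSpinor, map_smul, inner_smul_left, inner_smul_right, h, mul_zero, mul_zero]

lemma commSeminorm_torusDirac (hu : ∀ g, u g * (u g)ᴴ = 1)
    {ε : Fin p → Matrix (Fin N) (Fin N) ℂ} (hε : IsClifford ε) (c : ℝ) {n : ℕ} {v : Fin p → ℝ}
    (hv : v ∈ B.group n) : commSeminorm (torusDirac B u ε c n) (charOp B N q n v) =
      ENNReal.ofReal (|2 * Real.pi * c| * euclidLength v) :=
  commSeminorm_eq_ofReal (torusDirac_twist B u ε c hv)
    (fun e => by rw [norm_vecOp_torusClifford B hε, norm_charOp])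
    ⟨_, constSpinor_mem_domain B u hu ε c n, constSpinor_ne_zero B n⟩

lemma spinOp_seqSum (ε : Fin p → Matrix (Fin N) (Fin N) ℂ) (c : ℝ) (x : ℕ → B.Digit) :
    spinOp (q := q) B 0 (-∑ a, ((2 * Real.pi * c * B.seqSum x a : ℝ) : ℂ) • ε a) =
      -vecOp (torusClifford B q ε c 0) ((1 : ℝ) • B.seqSum x) := by
  rw [one_smul, vecOp_torusClifford, ← spinOpₗ_apply, map_neg]
  rfl

/-- The conclusions for tori and rational rotation algebras. -/
theorem torus_conclusion (hu : ∀ g, u g * (u g)ᴴ = 1) {ε : Fin p → Matrix (Fin N) (Fin N) ℂ}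
    (hε : IsClifford ε) {c : ℝ} (hc : c ≠ 0)
    (L : ∀ n, torusAlg B u N n → ℝ≥0∞) (L' : torusLimitAlg B u N → ℝ≥0∞)
    (hL : ∀ n, L n = lipSeminorm (torusDirac B u ε c n) (torusAlg B u N n))
    (hL' : L' = lipSeminorm (torusLimitDirac B u ε c) (torusLimitAlg B u N)) :
    Tendsto (fun n => normicRadius (L n)) atTop (𝓝 ⊤) ∧
      (∃ (x : ∀ n, torusAlg B u N n) (x' : ℕ → torusLimitAlg B u N),
        (∀ n, (x n : TorusSpace B N q n →L[ℂ] TorusSpace B N q n) =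
          mulOp B N n (fun t => character (B.freq n) t • 1)) ∧
        (∀ n, (x' n : TorusLimitSpace B N q →L[ℂ] TorusLimitSpace B N q) =
          torusEmbed B u N n (fun t => character (B.freq n) t • 1)) ∧
        (∀ n, L' (x' n) = L n (x n)) ∧
        UnboundedSeq L x ∧ UnboundedSeqIn L' x') ∧
      ¬ BallTotallyBounded L' ∧ ¬ IsLipNorm L' := by
  obtain rfl : L = fun n => lipSeminorm (torusDirac B u ε c n) (torusAlg B u N n) := funext hL
  subst hL'
  have hcont : ∀ n, Continuous fun t => character (B.freq n) t • (1 : Matrix (Fin q) (Fin q) ℂ) :=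
    fun n => (continuous_character _).smul continuous_const
  have hinv : ∀ n, IsInvariant B u n fun t => character (B.freq n) t • 1 := by
    intro n m
    funext t
    rw [translate, character_sub_lattice B (B.freq_mem_group n), Matrix.mul_smul, Matrix.smul_mul,
      mul_one, hu]
  let x : ∀ n, torusAlg B u N n := fun n =>
    ⟨mulOp B N n (fun t => character (B.freq n) t • 1),
      subset_cstarGen ⟨_, hcont n, hinv n, rfl⟩⟩
  let x' : ℕ → torusLimitAlg B u N := fun n =>
    ⟨torusEmbed B u N n (fun t => character (B.freq n) t • 1),
      subset_cstarGen ⟨n, _, hcont n, hinv n, rfl⟩⟩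
  have hr : 0 < |2 * Real.pi * c| := abs_pos.2 (mul_ne_zero (by positivity) hc)
  choose π hπ using fun n => exists_wordPerm_smul B (B.freq_mem_group n)
  -- The nonzero entry of row `j`: a character whose frequency the word sums have moved into `G_0`.
  let V : ∀ n, (Fin n → B.Digit) → (TorusSpace B N q 0 →L[ℂ] TorusSpace B N q 0) := fun n j =>
    charOp B N q 0 (B.freq n + (1 : ℝ) • (B.wordSum j - B.wordSum (π n j)))
  have hT : ∀ n j, mulOp B N 0
      (matrixEntry B u n (fun t => character (B.freq n) t • 1) j (π n j)) = V n j := by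
    intro n j
    have h1 := (hπ n j _).2 rfl
    rw [one_smul, ← add_sub_assoc] at h1
    rw [matrixEntry_character B u hu (B.freq_mem_group n)]
    simp only [V, one_smul, ← add_sub_assoc, h1, if_true]
  have hT0 : ∀ n j k, k ≠ π n j → mulOp B N 0
      (matrixEntry B u n (fun t => character (B.freq n) t • 1) j k) = 0 := by
    intro n j k hk
    have h1 := mt (hπ n j k).1 hk
    rw [one_smul, ← add_sub_assoc] at h1
    rw [matrixEntry_character B u hu (B.freq_mem_group n)]
    simp only [h1, if_false]
    exact mulOp_zero B 0
  have hVn : ∀ n j e, ‖V n j e‖ = ‖e‖ := fun n j e => norm_charOp B 0 _ e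
  have key := covering_conclusion B (A := torusAlg B u N) (A' := torusLimitAlg B u N)
    (D := torusDirac B u ε c) (D' := torusLimitDirac B u ε c) (x := x) (x' := x') hr
    (fun n => commSeminorm_torusDirac B u hu hε c (B.freq_mem_group n))
    (fun n => commSeminorm_diracPlus (s := 1) (π := π n) (V := V n) (v := B.freq n)
      (C := torusClifford B q ε c 0) (isClosed_torusDirac_graph B u ε c 0)
      (spinOp_seqSum B ε c) (hT n) (hT0 n)
      (fun j e f h => torusDirac_twist B u ε c ((hπ n j _).2 rfl) e f h)
      (fun a j e => spinOp_charOp B 0 _ _ e) (hVn n)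
      (mul_nonneg hr.le (euclidLength_pos (B.freq_ne_zero n)).le)
      (fun e => norm_vecOp_torusClifford B hε c 0 _ e)
      ⟨_, constSpinor_mem_domain B u hu ε c 0, constSpinor_ne_zero B 0⟩)
    (ξ := fun n => constSpinor q N B n) (fun n => norm_constSpinor B n)
    (fun n a => one_le_norm_sub_smul
      (by
        change ‖charOp B N q n (B.freq n) _‖ = 1
        rw [norm_charOp, norm_constSpinor])
      (inner_constSpinor_charOp B (B.freq_mem_group n) (B.freq_ne_zero n)) a)
    (ξ' := fun _ => diagVector (constSpinor q N B 0))
    (fun n => by rw [norm_diagVector, norm_constSpinor])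
    (fun n a => one_le_norm_amplify_sub n (π n) (V n) (hT n) (hT0 n) (hVn n) (norm_constSpinor B 0)
      (fun j hj => by
        -- At a fixed word the corrections cancel, so the entry is the character of `B.freq n`
        -- itself, which then lies in `G_0` and is not zero.
        have h1 := (hπ n j _).2 rfl
        simp only [V]
        rw [hj] at h1 ⊢
        simp only [sub_self, smul_zero, add_zero] at h1 ⊢
        exact inner_constSpinor_charOp B h1 (B.freq_ne_zero n)) a)
  exact ⟨key.1, ⟨x, x', fun _ => rfl, fun _ => rfl, key.2.1⟩, key.2.2⟩

end TorusMain

/-! ### The unitaries of the rational rotation algebras -/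

lemma rotU_mem_unitary (m q : ℕ) : rotU m q ∈ Matrix.unitaryGroup (Fin q) ℂ := by
  rw [Matrix.mem_unitaryGroup_iff, rotU, Matrix.star_eq_conjTranspose, Matrix.diagonal_conjTranspose,
    Matrix.diagonal_mul_diagonal, ← Matrix.diagonal_one]
  congr 1
  funext k
  rw [Pi.star_apply, RCLike.star_def, Complex.mul_conj, Complex.normSq_eq_norm_sq]
  have : (2 * Real.pi * Complex.I * ((k : ℕ) * m / q) : ℂ) =
      ((2 * Real.pi * ((k : ℕ) * m / q) : ℝ) : ℂ) * Complex.I := by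
    push_cast; ring
  rw [this, Complex.norm_exp_ofReal_mul_I]
  simp

lemma rotV_mem_unitary (q : ℕ) : rotV q ∈ Matrix.unitaryGroup (Fin q) ℂ := by
  rw [Matrix.mem_unitaryGroup_iff, Matrix.star_eq_conjTranspose]
  ext h k
  have hq : 0 < q := h.pos
  have hlt : ((h : ℕ) + 1) % q < q := Nat.mod_lt _ hq
  rw [Matrix.mul_apply, Finset.sum_eq_single (⟨((h : ℕ) + 1) % q, hlt⟩ : Fin q)]
  · simp only [rotV, Matrix.of_apply, Matrix.conjTranspose_apply, if_true, one_mul, Matrix.one_apply]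
    have : ((h : ℕ) + 1) % q = ((k : ℕ) + 1) % q ↔ h = k := by
      constructor
      · intro e
        have h1 : (h : ℕ) ≡ k [MOD q] := Nat.ModEq.add_right_cancel' 1 e
        exact Fin.ext (Nat.ModEq.eq_of_lt_of_lt h1 h.2 k.2)
      · rintro rfl; rfl
    simp only [this]
    split_ifs <;> simp
  · intro b _ hb
    have : ¬ (b : ℕ) = ((h : ℕ) + 1) % q := fun e => hb (Fin.ext e)
    simp [rotV, this]
  · intro h
    exact absurd (Finset.mem_univ _) h

lemma matrix_zpow_mem_unitary {q : ℕ} {M : Matrix (Fin q) (Fin q) ℂ}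
    (hM : M ∈ Matrix.unitaryGroup (Fin q) ℂ) (k : ℤ) : M ^ k ∈ Matrix.unitaryGroup (Fin q) ℂ := by
  have hinv : M⁻¹ = star M := Matrix.inv_eq_right_inv (Matrix.mem_unitaryGroup_iff.1 hM)
  rcases Int.le_total 0 k with hk | hk
  · lift k to ℕ using hk
    rw [zpow_natCast]
    exact Submonoid.pow_mem _ hM k
  · obtain ⟨l, rfl⟩ : ∃ l : ℕ, k = -(l : ℤ) := ⟨k.natAbs, by omega⟩
    rw [Matrix.zpow_neg_natCast, ← Matrix.inv_pow', hinv]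
    exact Submonoid.pow_mem _ (Unitary.star_mem hM) l

lemma rotTwist_mul_conjTranspose (m q : ℕ) (g : Fin 2 → ℤ) :
    rotTwist m q g * (rotTwist m q g)ᴴ = 1 :=
  Matrix.mem_unitaryGroup_iff.1 (Submonoid.mul_mem _
    (matrix_zpow_mem_unitary (rotV_mem_unitary q) _)
    (matrix_zpow_mem_unitary (rotU_mem_unitary m q) _))

/-! ### Matrices and shifts on `H ⊗ ℂ^N ⊗ ℓ²(G)` -/

/-- Injectivity of `σ` bounds the sum over the image by the full sum. Matrices (`σ = id`) and shifts
(`A = id`) are both of this type. -/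
lemma exists_lp_comp {ι F : Type*} [NormedAddCommGroup F] [NormedSpace ℂ F] (A : F →L[ℂ] F)
    {σ : ι → ι} (hσ : Function.Injective σ) :
    ∃ T : lp (fun _ : ι => F) 2 →L[ℂ] lp (fun _ : ι => F) 2, ∀ ξ g, T ξ g = A (ξ (σ g)) := by
  have h2 : (0 : ℝ) < (2 : ℝ≥0∞).toReal := by norm_num
  have hle : ∀ (ξ : lp (fun _ : ι => F) 2) g, ‖A (ξ (σ g))‖ ^ (2 : ℝ≥0∞).toReal ≤
      ‖A‖ ^ (2 : ℝ≥0∞).toReal * ‖ξ (σ g)‖ ^ (2 : ℝ≥0∞).toReal := fun ξ g => by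
    rw [← Real.mul_rpow (norm_nonneg _) (norm_nonneg _)]
    exact Real.rpow_le_rpow (norm_nonneg _) (A.le_opNorm _) h2.le
  have hs : ∀ ξ : lp (fun _ : ι => F) 2, Summable fun g => ‖ξ (σ g)‖ ^ (2 : ℝ≥0∞).toReal :=
    fun ξ => (lp.hasSum_norm h2 ξ).summable.comp_injective hσ
  have hs' : ∀ ξ : lp (fun _ : ι => F) 2,
      Summable fun g => ‖A (ξ (σ g))‖ ^ (2 : ℝ≥0∞).toReal := fun ξ =>
    Summable.of_nonneg_of_le (fun g => by positivity) (hle ξ) ((hs ξ).mul_left _)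
  refine ⟨LinearMap.mkContinuous
    { toFun := fun ξ => ⟨fun g => A (ξ (σ g)), memℓp_gen (hs' ξ)⟩
      map_add' := fun ξ η => by
        ext g
        exact map_add A _ _
      map_smul' := fun c ξ => by
        ext g
        exact map_smul A _ _ } ‖A‖ fun ξ => ?_, fun ξ g => rfl⟩
  refine lp.norm_le_of_tsum_le h2 (by positivity) ?_
  rw [Real.mul_rpow (norm_nonneg _) (norm_nonneg _), lp.norm_rpow_eq_tsum h2 ξ]
  refine ((hs' ξ).tsum_le_tsum (hle ξ) ((hs ξ).mul_left _)).trans ?_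
  rw [tsum_mul_left]
  refine mul_le_mul_of_nonneg_left ?_ (by positivity)
  exact tsum_comp_le_tsum_of_inj (lp.hasSum_norm h2 ξ).summable (fun g => by positivity) hσ

lemma vecOp_neg {p : ℕ} {E : Type*} [NormedAddCommGroup E] [InnerProductSpace ℂ E]
    (C : Fin p → (E →L[ℂ] E)) (v : Fin p → ℝ) : vecOp C (-v) = -vecOp C v := by
  simp [vecOp]

section Crossed

variable {H : Type*} [NormedAddCommGroup H] [InnerProductSpace ℂ H] [CompleteSpace H]
  {p N : ℕ} (B : CoveringMatrix p) (G : AddSubgroup (Fin p → ℝ))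

variable (H) in
/-- The action of a matrix on `H ⊗ ℂ^N`. -/
def matFibre (M : Matrix (Fin N) (Fin N) ℂ) :
    PiLp 2 (fun _ : Fin N => H) →L[ℂ] PiLp 2 (fun _ : Fin N => H) where
  toFun v := WithLp.toLp 2 fun i => ∑ j, M i j • v j
  map_add' v w := by
    ext i
    simp [smul_add, Finset.sum_add_distrib]
  map_smul' c v := by
    ext i
    simp [Finset.smul_sum, smul_comm c]
  cont := by fun_prop

lemma matFibre_apply (M : Matrix (Fin N) (Fin N) ℂ) (v : PiLp 2 (fun _ : Fin N => H)) (i : Fin N) :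
    matFibre H M v i = ∑ j, M i j • v j := rfl

lemma matFibre_mul (M M' : Matrix (Fin N) (Fin N) ℂ) (v : PiLp 2 (fun _ : Fin N => H)) :
    matFibre H (M * M') v = matFibre H M (matFibre H M' v) := by
  ext i
  simp only [matFibre_apply, Matrix.mul_apply, Finset.sum_smul, Finset.smul_sum, mul_smul]
  exact Finset.sum_comm

lemma matFibre_one (v : PiLp 2 (fun _ : Fin N => H)) : matFibre H 1 v = v := by
  ext i
  simp [matFibre_apply, Matrix.one_apply]

lemma matFibre_add (M M' : Matrix (Fin N) (Fin N) ℂ) (v : PiLp 2 (fun _ : Fin N => H)) :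
    matFibre H (M + M') v = matFibre H M v + matFibre H M' v := by
  ext i
  simp [matFibre_apply, add_smul, Finset.sum_add_distrib]

lemma matFibre_smul (c : ℂ) (M : Matrix (Fin N) (Fin N) ℂ) (v : PiLp 2 (fun _ : Fin N => H)) :
    matFibre H (c • M) v = c • matFibre H M v := by
  ext i
  simp [matFibre_apply, mul_smul, Finset.smul_sum]

lemma inner_matFibre {M : Matrix (Fin N) (Fin N) ℂ} (hM : M.IsHermitian)
    (v w : PiLp 2 (fun _ : Fin N => H)) :
    inner ℂ (matFibre H M v) w = inner ℂ v (matFibre H M w) := by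
  simp only [PiLp.inner_apply, matFibre_apply, sum_inner, inner_sum, inner_smul_left,
    inner_smul_right]
  rw [Finset.sum_comm]
  refine Finset.sum_congr rfl fun i _ => Finset.sum_congr rfl fun j _ => ?_
  rw [← hM.apply i j]
  rfl

variable (H) in
/-- The operator `I ⊗ M ⊗ I` for a matrix `M`. -/
def matOp (M : Matrix (Fin N) (Fin N) ℂ) : CrossedSpace H N G →L[ℂ] CrossedSpace H N G :=
  opOf fun T => ∀ (ξ : CrossedSpace H N G) (g : G) (i : Fin N), T ξ g i = ∑ j, M i j • ξ g j

lemma matOp_apply (M : Matrix (Fin N) (Fin N) ℂ) (ξ : CrossedSpace H N G) (g : G) :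
    matOp H G M ξ g = matFibre H M (ξ g) := by
  have h := opOf_spec (P := fun T : CrossedSpace H N G →L[ℂ] CrossedSpace H N G =>
    ∀ (ξ : CrossedSpace H N G) (g : G) (i : Fin N), T ξ g i = ∑ j, M i j • ξ g j) <| by
      obtain ⟨T, hT⟩ := exists_lp_comp (ι := G) (matFibre H M) Function.injective_id
      exact ⟨T, fun ξ g i => by rw [hT]; rfl⟩
  ext i
  exact h ξ g i

lemma shiftOp_apply {h : Fin p → ℝ} (hh : h ∈ G) (ξ : CrossedSpace H N G) (g : G) :
    shiftOp N G h ξ g = ξ (g - ⟨h, hh⟩) := by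
  have h := opOf_spec (P := fun T : CrossedSpace H N G →L[ℂ] CrossedSpace H N G =>
    ∀ (ξ : CrossedSpace H N G) (g g' : G), (g' : Fin p → ℝ) = (g : Fin p → ℝ) - h →
      T ξ g = ξ g') <| by
      obtain ⟨T, hT⟩ := exists_lp_comp (ι := G)
        (ContinuousLinearMap.id ℂ (PiLp 2 (fun _ : Fin N => H)))
        (sub_left_injective (b := (⟨h, hh⟩ : G)))
      refine ⟨T, fun ξ g g' hg => ?_⟩
      rw [hT, ContinuousLinearMap.id_apply]
      have : g' = g - ⟨h, hh⟩ := Subtype.ext hg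
      rw [this]
  exact h ξ g _ rfl

lemma norm_shiftOp {h : Fin p → ℝ} (hh : h ∈ G) (ξ : CrossedSpace H N G) :
    ‖shiftOp N G h ξ‖ = ‖ξ‖ := by
  have h2 : (0 : ℝ) < (2 : ℝ≥0∞).toReal := by norm_num
  have h1 : ‖shiftOp N G h ξ‖ ^ (2 : ℝ≥0∞).toReal = ‖ξ‖ ^ (2 : ℝ≥0∞).toReal := by
    rw [lp.norm_rpow_eq_tsum h2, lp.norm_rpow_eq_tsum h2]
    simp only [shiftOp_apply G hh]
    exact (Equiv.subRight (⟨h, hh⟩ : G)).tsum_eq fun g => ‖ξ g‖ ^ (2 : ℝ≥0∞).toReal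
  exact (Real.rpow_left_inj (norm_nonneg _) (norm_nonneg _) h2.ne').1 h1

lemma matOp_shiftOp (M : Matrix (Fin N) (Fin N) ℂ) {h : Fin p → ℝ} (hh : h ∈ G)
    (ξ : CrossedSpace H N G) :
    matOp H G M (shiftOp N G h ξ) = shiftOp N G h (matOp H G M ξ) := by
  ext g : 2
  rw [matOp_apply, shiftOp_apply G hh, shiftOp_apply G hh, matOp_apply]

lemma vecOp_matOp (ε : Fin (p + 1) → Matrix (Fin N) (Fin N) ℂ) (v : Fin p → ℝ) :
    vecOp (fun μ : Fin p => matOp H G (ε μ.succ)) v = matOp H G (cliffordLength ε v) := by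
  ext1 ξ
  ext g i
  rw [vecOp_apply, matOp_apply, matFibre_apply]
  have h : ∀ μ : Fin p, matOp H G (ε μ.succ) ξ g i = ∑ j, ε μ.succ i j • ξ g j := fun μ => by
    rw [matOp_apply]; rfl
  rw [lp.coeFn_sum, Finset.sum_apply]
  simp only [lp.coeFn_smul, Pi.smul_apply, WithLp.ofLp_sum, Finset.sum_apply, PiLp.smul_apply, h,
    cliffordLength, Matrix.sum_apply, Matrix.smul_apply, Finset.sum_smul, Finset.smul_sum,
    smul_assoc]
  exact Finset.sum_comm

variable {ε : Fin (p + 1) → Matrix (Fin N) (Fin N) ℂ}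

lemma IsClifford.mul_self {m : ℕ} {ε : Fin m → Matrix (Fin N) (Fin N) ℂ} (hε : IsClifford ε)
    (a : Fin m) : ε a * ε a = 1 := by
  have h := hε.2 a a
  rw [if_pos rfl, ← two_smul ℂ (ε a * ε a)] at h
  have h3 : (2 : Matrix (Fin N) (Fin N) ℂ) = (2 : ℂ) • 1 := by
    rw [← Algebra.algebraMap_eq_smul_one]
    exact (map_ofNat (algebraMap ℂ (Matrix (Fin N) (Fin N) ℂ)) 2).symm
  rw [h3] at h
  exact smul_right_injective _ (two_ne_zero' ℂ) h

lemma norm_vecOp_matOp (hε : IsClifford ε) (v : Fin p → ℝ) (ξ : CrossedSpace H N G) :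
    ‖vecOp (fun μ : Fin p => matOp H G (ε μ.succ)) v ξ‖ = 1 * euclidLength v * ‖ξ‖ := by
  refine norm_vecOp zero_le_one (fun a x y => ?_) (fun a b x => ?_) v ξ
  · rw [lp.inner_eq_tsum, lp.inner_eq_tsum]
    refine tsum_congr fun g => ?_
    rw [matOp_apply, matOp_apply, inner_matFibre (hε.1 _)]
  · ext g : 2
    rw [lp.coeFn_add, Pi.add_apply, matOp_apply, matOp_apply, matOp_apply, matOp_apply,
      ← matFibre_mul, ← matFibre_mul, ← matFibre_add]
    by_cases hab : a = b
    · subst hab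
      rw [if_pos rfl, hε.mul_self, ← two_smul ℂ (1 : Matrix (Fin N) (Fin N) ℂ), matFibre_smul,
        matFibre_one]
      simp
    · rw [if_neg hab, hε.2, if_neg (fun h => hab (Fin.succ_injective _ h))]
      ext i
      simp [matFibre_apply]

/-! ### The Dirac operator of a crossed product -/

variable (D : H →ₗ.[ℂ] H)

/-- Since `ε 0` squares to one, `ζ` can be solved for. This replaces the existential by a condition
that is visibly linear and closed when `D` is. -/
lemma crossedDirac_graph_iff (hε : IsClifford ε) {n : ℕ}
    (z : CrossedSpace H N (B.group n) × CrossedSpace H N (B.group n)) :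
    (∀ g : B.group n, ∃ ζ : Fin N → H, (∀ j, (z.1 g j, ζ j) ∈ D.graph) ∧
      ∀ i, z.2 g i = ∑ j, ε 0 i j • ζ j + ∑ j, cliffordLength ε (g : Fin p → ℝ) i j • z.1 g j) ↔
    ∀ (g : B.group n) j, (z.1 g j,
      matFibre H (ε 0) (z.2 g - matFibre H (cliffordLength ε (g : Fin p → ℝ)) (z.1 g)) j) ∈
        D.graph := by
  refine forall_congr' fun g => ⟨?_, fun h => ?_⟩
  · rintro ⟨ζ, h1, h2⟩ j
    have h3 : z.2 g - matFibre H (cliffordLength ε (g : Fin p → ℝ)) (z.1 g) =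
        matFibre H (ε 0) (WithLp.toLp 2 ζ) := by
      rw [sub_eq_iff_eq_add]
      ext i
      exact h2 i
    rw [h3, ← matFibre_mul, hε.mul_self, matFibre_one]
    exact h1 j
  · refine ⟨_, h, fun i => ?_⟩
    have h3 := matFibre_mul (ε 0) (ε 0)
      (z.2 g - matFibre H (cliffordLength ε (g : Fin p → ℝ)) (z.1 g))
    rw [hε.mul_self, matFibre_one, sub_eq_iff_eq_add] at h3
    conv_lhs => rw [h3]
    rfl

/-- The graph of `D ⊗ ε_1 ⊗ I + I ⊗ M_ℓ`. -/
def crossedGraph (ε : Fin (p + 1) → Matrix (Fin N) (Fin N) ℂ) (n : ℕ) :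
    Submodule ℂ (CrossedSpace H N (B.group n) × CrossedSpace H N (B.group n)) :=
  ⨅ (g : B.group n) (j : Fin N), D.graph.comap
    (((PiLp.proj 2 (fun _ : Fin N => H) j).comp
        ((lp.evalCLM ℂ (fun _ : B.group n => PiLp 2 fun _ : Fin N => H) 2 g).comp
          (ContinuousLinearMap.fst ℂ _ _))).prod
      ((PiLp.proj 2 (fun _ : Fin N => H) j).comp ((matFibre H (ε 0)).comp
        ((lp.evalCLM ℂ (fun _ : B.group n => PiLp 2 fun _ : Fin N => H) 2 g).comp
            (ContinuousLinearMap.snd ℂ _ _) -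
          (matFibre H (cliffordLength ε (g : Fin p → ℝ))).comp
            ((lp.evalCLM ℂ (fun _ : B.group n => PiLp 2 fun _ : Fin N => H) 2 g).comp
              (ContinuousLinearMap.fst ℂ _ _)))))).toLinearMap

lemma mem_crossedGraph {n : ℕ}
    {z : CrossedSpace H N (B.group n) × CrossedSpace H N (B.group n)} :
    z ∈ crossedGraph B D ε n ↔ ∀ (g : B.group n) j, (z.1 g j,
      matFibre H (ε 0) (z.2 g - matFibre H (cliffordLength ε (g : Fin p → ℝ)) (z.1 g)) j) ∈
        D.graph := by
  simp only [crossedGraph, Submodule.mem_iInf]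
  rfl

lemma isClosed_crossedGraph (hD : D.IsClosed) (n : ℕ) :
    IsClosed (crossedGraph B D ε n :
      Set (CrossedSpace H N (B.group n) × CrossedSpace H N (B.group n))) := by
  simp only [crossedGraph, Submodule.coe_iInf]
  refine isClosed_iInter fun g => isClosed_iInter fun j => ?_
  exact IsClosed.preimage (ContinuousLinearMap.continuous _) hD

/-- The defining set is already a closed subspace, and it is single-valued because `ε 0` is
invertible, so no closure is needed. -/
lemma mem_crossedDirac_graph (hD : D.IsClosed) (hε : IsClifford ε) {n : ℕ}
    {z : CrossedSpace H N (B.group n) × CrossedSpace H N (B.group n)} :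
    z ∈ (crossedDirac B D ε n).graph ↔ z ∈ crossedGraph B D ε n := by
  have hset : (crossedGraph B D ε n :
      Set (CrossedSpace H N (B.group n) × CrossedSpace H N (B.group n))) =
      {z | ∀ g : B.group n, ∃ ζ : Fin N → H, (∀ j, (z.1 g j, ζ j) ∈ D.graph) ∧
        ∀ i, z.2 g i =
          ∑ j, ε 0 i j • ζ j + ∑ j, cliffordLength ε (g : Fin p → ℝ) i j • z.1 g j} := by
    ext z
    exact (mem_crossedGraph B D).trans (crossedDirac_graph_iff B D hε z).symm
  rw [crossedDirac, opOfGraph_graph_of_isClosed _ hset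
    (by rw [← hset]; exact isClosed_crossedGraph B D hD n)]
  · rw [← hset]; rfl
  · rw [← hset]
    intro z hz h0
    ext g : 2
    have h1 : ∀ j, matFibre H (ε 0) (z.2 g) j = 0 := fun j => by
      have := (mem_crossedGraph B D).1 hz g j
      rw [h0, lp.coeFn_zero, Pi.zero_apply, map_zero, sub_zero] at this
      exact D.graph_fst_eq_zero_snd this rfl
    have h2 : matFibre H (ε 0) (z.2 g) = 0 := by
      ext j
      exact h1 j
    rw [← matFibre_one (z.2 g), ← hε.mul_self 0, matFibre_mul, h2, map_zero]
    rfl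

lemma isClosed_crossedDirac_graph (hD : D.IsClosed) (hε : IsClifford ε) (n : ℕ) :
    IsClosed ((crossedDirac B D ε n).graph :
      Set (CrossedSpace H N (B.group n) × CrossedSpace H N (B.group n))) := by
  have : ((crossedDirac B D ε n).graph :
      Set (CrossedSpace H N (B.group n) × CrossedSpace H N (B.group n))) =
      crossedGraph B D ε n := by
    ext z
    exact mem_crossedDirac_graph B D hD hε
  rw [this]
  exact isClosed_crossedGraph B D hD n

lemma cliffordLength_sub (ε : Fin (p + 1) → Matrix (Fin N) (Fin N) ℂ) (v w : Fin p → ℝ) :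
    cliffordLength ε v = cliffordLength ε (v - w) + cliffordLength ε w := by
  simp [cliffordLength, sub_smul, Finset.sum_sub_distrib]

/-- The part with `D` commutes with shifts, and `ℓ(g) = ℓ(g - h) + ℓ(h)` leaves `ℓ(h)` as the
commutator. -/
lemma crossedDirac_twist (hD : D.IsClosed) (hε : IsClifford ε) {n : ℕ} {h : Fin p → ℝ}
    (hh : h ∈ B.group n) (e f : CrossedSpace H N (B.group n))
    (hef : (e, f) ∈ (crossedDirac B D ε n).graph) :
    (shiftOp N (B.group n) h e, shiftOp N (B.group n) h f +
      vecOp (fun μ : Fin p => matOp H (B.group n) (ε μ.succ)) h (shiftOp N (B.group n) h e)) ∈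
      (crossedDirac B D ε n).graph := by
  rw [mem_crossedDirac_graph B D hD hε, mem_crossedGraph] at hef ⊢
  intro g j
  have := hef (g - ⟨h, hh⟩) j
  rw [vecOp_matOp]
  simp only [lp.coeFn_add, Pi.add_apply, matOp_apply, shiftOp_apply _ hh]
  rw [cliffordLength_sub ε (g : Fin p → ℝ) h, matFibre_add, add_sub_add_right_eq_sub]
  exact this

/-- The vector `x ⊗ e_0 ⊗ δ_0`. -/
def crossedVec [NeZero N] (x : H) : CrossedSpace H N G :=
  lp.single 2 (0 : G) (WithLp.toLp 2 (Pi.single 0 x))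

lemma norm_crossedVec [NeZero N] (x : H) : ‖crossedVec (N := N) G x‖ = ‖x‖ := by
  rw [crossedVec, lp.norm_single (by norm_num)]
  exact PiLp.norm_single 2 (fun _ : Fin N => H) 0 x

lemma inner_crossedVec [NeZero N] (x : H) {h : Fin p → ℝ} (hh : h ∈ G) (h0 : h ≠ 0) :
    inner ℂ (crossedVec (N := N) G x) (shiftOp N G h (crossedVec G x)) = 0 := by
  rw [crossedVec, lp.inner_single_left, shiftOp_apply G hh, lp.single_apply, Pi.single_eq_of_ne,
    inner_zero_right]
  rw [zero_sub, Ne, neg_eq_zero]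
  exact fun h1 => h0 (congrArg Subtype.val h1)

/-- The vector is supported at `g = 0`, where `ℓ` vanishes, so its image is `ε 0` applied to `D x`
at the same point. -/
lemma crossedVec_mem_domain [NeZero N] (ε : Fin (p + 1) → Matrix (Fin N) (Fin N) ℂ) {x : H}
    (hx : x ∈ D.domain) (n : ℕ) :
    crossedVec (B.group n) x ∈ (crossedDirac B D ε n).domain := by
  refine mem_opOfGraph_domain
    (f := lp.single 2 0 (matFibre H (ε 0) (WithLp.toLp 2 (Pi.single 0 (D ⟨x, hx⟩))))) fun g => ?_
  by_cases hg : g = 0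
  · subst hg
    refine ⟨Pi.single 0 (D ⟨x, hx⟩), fun j => ?_, fun i => ?_⟩
    · by_cases hj : j = 0
      · subst hj
        simp only [crossedVec, lp.single_apply, Pi.single_eq_same]
        exact D.mem_graph ⟨x, hx⟩
      · simp only [crossedVec, lp.single_apply, Pi.single_eq_same, Pi.single_eq_of_ne hj]
        exact D.graph.zero_mem
    · rw [lp.single_apply, Pi.single_eq_same, matFibre_apply]
      simp [cliffordLength]
  · refine ⟨0, fun j => ?_, fun i => ?_⟩
    · simp only [crossedVec, lp.single_apply, Pi.single_eq_of_ne hg]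
      exact D.graph.zero_mem
    · simp [crossedVec, lp.single_apply, Pi.single_eq_of_ne hg]

/-- The matrix of a shift carries the word sums with the sign opposite to that for characters, which
amounts to the inverse permutation. -/
lemma exists_wordPerm_neg {n : ℕ} {v : Fin p → ℝ} (hv : v ∈ B.group n) :
    ∃ π : Equiv.Perm (Fin n → B.Digit), ∀ j k,
      v + B.wordSum k - B.wordSum j ∈ B.group 0 ↔ k = π j := by
  obtain ⟨π, hπ⟩ := B.exists_wordPerm hv
  refine ⟨π.symm, fun j k => ?_⟩
  rw [hπ, Equiv.eq_symm_apply, eq_comm]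

/-- The conclusions for crossed products. -/
theorem crossed_conclusion [NeZero N] {Z : StarSubalgebra ℂ (H →L[ℂ] H)} (ρ : LimitAction B Z)
    (hD : D.IsClosed) (hD' : ∃ e ∈ D.domain, ‖e‖ = 1) (hε : IsClifford ε)
    (Φ : Z → (CrossedLimitSpace B H N →L[ℂ] CrossedLimitSpace B H N))
    (L : ∀ n, crossedAlg ρ N n → ℝ≥0∞) (L' : crossedLimitAlg N Φ → ℝ≥0∞)
    (hL : ∀ n, L n = lipSeminorm (crossedDirac B D ε n) (crossedAlg ρ N n))
    (hL' : L' = lipSeminorm (crossedLimitDirac B D ε) (crossedLimitAlg N Φ)) :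
    Tendsto (fun n => normicRadius (L n)) atTop (𝓝 ⊤) ∧
      (∃ (x : ∀ n, crossedAlg ρ N n) (x' : ℕ → crossedLimitAlg N Φ),
        (∀ n, (x n : CrossedSpace H N (B.group n) →L[ℂ] CrossedSpace H N (B.group n)) =
          shiftOp N (B.group n) (B.freq n)) ∧
        (∀ n, (x' n : CrossedLimitSpace B H N →L[ℂ] CrossedLimitSpace B H N) =
          limitShift B H N n (B.freq n)) ∧
        (∀ n, L' (x' n) = L n (x n)) ∧
        UnboundedSeq L x ∧ UnboundedSeqIn L' x') ∧
      ¬ BallTotallyBounded L' ∧ ¬ IsLipNorm L' := by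
  obtain ⟨e, he, he1⟩ := hD'
  obtain rfl : L = fun n => lipSeminorm (crossedDirac B D ε n) (crossedAlg ρ N n) := funext hL
  subst hL'
  let x : ∀ n, crossedAlg ρ N n := fun n =>
    ⟨shiftOp N (B.group n) (B.freq n), subset_cstarGen (Or.inr ⟨_, B.freq_mem_group n, rfl⟩)⟩
  let x' : ℕ → crossedLimitAlg N Φ := fun n =>
    ⟨limitShift B H N n (B.freq n),
      subset_cstarGen (Or.inr ⟨n, _, B.freq_mem_group n, rfl⟩)⟩
  choose π hπ using fun n => exists_wordPerm_neg B (B.freq_mem_group n)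
  -- Here `s = -1`, because the diagonal part of the limit operator is `+ℓ(∑ s_h)`, while
  -- `commSeminorm_diracPlus` expects `-vecOp C (s • seqSum)`.
  have hmem : ∀ n j,
      B.freq n + (-1 : ℝ) • (B.wordSum j - B.wordSum (π n j)) ∈ B.group 0 := fun n j => by
    have h := (hπ n j _).2 rfl
    rwa [neg_one_smul, neg_sub, ← add_sub_assoc]
  let V : ∀ n, (Fin n → B.Digit) →
      (CrossedSpace H N (B.group 0) →L[ℂ] CrossedSpace H N (B.group 0)) := fun n j =>
    shiftOp N (B.group 0) (B.freq n + (-1 : ℝ) • (B.wordSum j - B.wordSum (π n j)))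
  -- The entries in the definition of `limitShift`, so that `amplify n (T n)` is the limit image by
  -- unfolding.
  let T : ∀ n, (Fin n → B.Digit) → (Fin n → B.Digit) →
      (CrossedSpace H N (B.group 0) →L[ℂ] CrossedSpace H N (B.group 0)) := fun n j k =>
    open Classical in
    if B.freq n + B.wordSum k - B.wordSum j ∈ B.group 0 then
      shiftOp N (B.group 0) (B.freq n + B.wordSum k - B.wordSum j)
    else 0
  have hT : ∀ n j, T n j (π n j) = V n j := fun n j => by
    simp only [T, V, if_pos ((hπ n j _).2 rfl), neg_one_smul, neg_sub, ← add_sub_assoc]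
  have hT0 : ∀ n j k, k ≠ π n j → T n j k = 0 := fun n j k hk =>
    if_neg (mt (hπ n j k).1 hk)
  have hVn : ∀ n j e, ‖V n j e‖ = ‖e‖ := fun n j e => norm_shiftOp _ (hmem n j) e
  have hξ : ∀ n, ‖crossedVec (N := N) (B.group n) e‖ = 1 := fun n => by
    rw [norm_crossedVec, he1]
  have hdom : ∀ n, ∃ e ∈ (crossedDirac B D ε n).domain, e ≠ 0 := fun n =>
    ⟨_, crossedVec_mem_domain B D ε he n, norm_ne_zero_iff.1 (by rw [hξ]; exact one_ne_zero)⟩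
  have key := covering_conclusion B (A := crossedAlg ρ N) (A' := crossedLimitAlg N Φ)
    (D := crossedDirac B D ε) (D' := crossedLimitDirac B D ε) (x := x) (x' := x') one_pos
    (fun n => commSeminorm_eq_ofReal (crossedDirac_twist B D hD hε (B.freq_mem_group n))
      (fun e => by rw [norm_vecOp_matOp _ hε, norm_shiftOp _ (B.freq_mem_group n)]) (hdom n))
    (fun n => commSeminorm_diracPlus (s := -1) (π := π n) (V := V n) (v := B.freq n) (T := T n)
      (C := fun μ : Fin p => matOp H (B.group 0) (ε μ.succ))
      (isClosed_crossedDirac_graph B D hD hε 0)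
      (fun x => by rw [neg_one_smul, vecOp_neg, neg_neg, vecOp_matOp]; rfl) (hT n) (hT0 n)
      (fun j e f h => crossedDirac_twist B D hD hε (hmem n j) e f h)
      (fun a j e => matOp_shiftOp _ _ (hmem n j) e) (hVn n)
      (mul_nonneg zero_le_one (euclidLength_pos (B.freq_ne_zero n)).le)
      (fun e => norm_vecOp_matOp _ hε _ e) (hdom 0))
    (ξ := fun n => crossedVec (B.group n) e) hξ
    (fun n a => one_le_norm_sub_smul
      (by
        change ‖shiftOp N (B.group n) (B.freq n) _‖ = 1
        rw [norm_shiftOp _ (B.freq_mem_group n), hξ])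
      (inner_crossedVec _ e (B.freq_mem_group n) (B.freq_ne_zero n)) a)
    (ξ' := fun _ => diagVector (crossedVec (B.group 0) e))
    (fun n => by rw [norm_diagVector, hξ])
    (fun n a => one_le_norm_amplify_sub n (π n) (V n) (hT n) (hT0 n) (hVn n) (hξ 0)
      (fun j hj => by
        have h1 := hmem n j
        simp only [V]
        rw [hj] at h1 ⊢
        simp only [sub_self, smul_zero, add_zero] at h1 ⊢
        exact inner_crossedVec _ e h1 (B.freq_ne_zero n)) a)
  exact ⟨key.1, ⟨x, x', fun _ => rfl, fun _ => rfl, key.2.1⟩, key.2.2⟩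

end Crossed

/-! ### Operators that are diagonal with respect to a filtration -/

section Filtration

variable {H : Type*} [NormedAddCommGroup H] [InnerProductSpace ℂ H] [CompleteSpace H]

/-- Invariance of `K` under `star x` gives invariance of its orthogonal complement under `x`, so `x`
respects the decomposition. -/
lemma starProjection_apply_commute {K : Submodule ℂ H} [K.HasOrthogonalProjection] {x : H →L[ℂ] H}
    (hx : ∀ v ∈ K, x v ∈ K) (hx' : ∀ v ∈ K, star x v ∈ K) (v : H) :
    K.starProjection (x v) = x (K.starProjection v) := by
  refine Submodule.eq_starProjection_of_mem_orthogonal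
    (hx _ (K.starProjection_apply_mem v)) ?_
  rw [← map_sub, Submodule.mem_orthogonal]
  intro u hu
  rw [← ContinuousLinearMap.adjoint_inner_left]
  exact (Submodule.mem_orthogonal _ _).1 (K.sub_starProjection_mem_orthogonal v) _ (hx' u hu)

variable (K : ℤ → Submodule ℂ H) [∀ k, (K k).HasOrthogonalProjection]

/-- The projections onto the successive differences of a filtration. -/
def stepProj (k : ℤ) : H →L[ℂ] H := (K k).starProjection - (K (k - 1)).starProjection

lemma stepProj_apply (k : ℤ) (v : H) :
    stepProj K k v = (K k).starProjection v - (K (k - 1)).starProjection v := rfl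

lemma norm_stepProj_le (k : ℤ) : ‖stepProj K k‖ ≤ 2 := by
  refine (norm_sub_le _ _).trans ?_
  linarith [(K k).starProjection_norm_le, (K (k - 1)).starProjection_norm_le]

lemma inner_stepProj (k : ℤ) (v w : H) : inner ℂ (stepProj K k v) w = inner ℂ v (stepProj K k w) := by
  rw [stepProj_apply, stepProj_apply, inner_sub_left, inner_sub_right,
    Submodule.inner_starProjection_left_eq_right, Submodule.inner_starProjection_left_eq_right]

variable {K}

lemma starProjection_starProjection_le (hK : Monotone K) {j k : ℤ} (h : j ≤ k) (v : H) :
    (K k).starProjection ((K j).starProjection v) = (K j).starProjection v :=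
  Submodule.starProjection_eq_self_iff.2 (hK h ((K j).starProjection_apply_mem v))

lemma starProjection_starProjection_ge (hK : Monotone K) {j k : ℤ} (h : j ≤ k) (v : H) :
    (K j).starProjection ((K k).starProjection v) = (K j).starProjection v :=
  congrArg (fun T : H →L[ℂ] H => T v) (Submodule.starProjection_comp_starProjection_of_le (hK h))

lemma stepProj_stepProj (hK : Monotone K) (j k : ℤ) (v : H) :
    stepProj K j (stepProj K k v) = if j = k then stepProj K k v else 0 := by
  simp only [stepProj_apply, map_sub]
  rcases lt_trichotomy j k with h | rfl | h
  · rw [if_neg h.ne, starProjection_starProjection_ge hK h.le,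
      starProjection_starProjection_ge hK (by omega : j ≤ k - 1),
      starProjection_starProjection_ge hK (by omega : j - 1 ≤ k),
      starProjection_starProjection_ge hK (by omega : j - 1 ≤ k - 1)]
    abel
  · rw [if_pos rfl, starProjection_starProjection_le hK le_rfl,
      starProjection_starProjection_le hK (by omega : j - 1 ≤ j),
      starProjection_starProjection_ge hK (by omega : j - 1 ≤ j),
      starProjection_starProjection_le hK le_rfl]
    abel
  · rw [if_neg h.ne', starProjection_starProjection_le hK h.le,
      starProjection_starProjection_le hK (by omega : k - 1 ≤ j),
      starProjection_starProjection_le hK (by omega : k ≤ j - 1),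
      starProjection_starProjection_le hK (by omega : k - 1 ≤ j - 1)]
    abel

variable (K) in
/-- The pairs `(ξ, η)` with `η = ∑_k w_k Q_k ξ`. -/
def diagGraph (w : ℤ → ℝ) : Set (H × H) :=
  {z | HasSum (fun k : ℤ => ((w k : ℝ) : ℂ) • stepProj K k z.1) z.2}

/-- Applying the continuous `Q_j` to the series kills every term except the one with index `j`. -/
lemma stepProj_of_mem_diagGraph (hK : Monotone K) {w : ℤ → ℝ} {z : H × H} (hz : z ∈ diagGraph K w)
    (j : ℤ) : stepProj K j z.2 = (w j : ℂ) • stepProj K j z.1 := by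
  refine ((stepProj K j).hasSum hz).unique
    ((hasSum_ite_eq j ((w j : ℂ) • stepProj K j z.1)).congr_fun fun k => ?_)
  rw [map_smul, stepProj_stepProj hK]
  by_cases h : j = k
  · subst h
    rw [if_pos rfl, if_pos rfl]
  · rw [if_neg h, if_neg (Ne.symm h), smul_zero]

lemma inner_eq_zero_of_mem_diagGraph {w : ℤ → ℝ} {z : H × H} (hz : z ∈ diagGraph K w) {v : H}
    (hv : ∀ k, stepProj K k v = 0) : inner ℂ v z.2 = 0 := by
  have h := (innerSL ℂ v).hasSum hz
  refine h.unique (hasSum_zero.congr_fun fun k => ?_)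
  rw [innerSL_apply_apply, inner_smul_right, ← inner_stepProj, hv, inner_zero_left, mul_zero]

/-- Two continuous linear relations pass to the closure. The first, `Q_j z.2 = w_j Q_j z.1`, shows
that every `Q_j` kills `z.2` if `z.1 = 0`. The second says that a vector killed by all `Q_j` is
orthogonal to every second component, in particular `z.2` to itself. It is not necessary that the
`Q_j` sum to the identity. -/
lemma diagGraph_closable (hK : Monotone K) (w : ℤ → ℝ) :
    ∀ z ∈ (Submodule.span ℂ (diagGraph K w)).topologicalClosure, z.1 = 0 → z.2 = 0 := by
  have h1 : ∀ (T : H × H →L[ℂ] H), (∀ z ∈ diagGraph K w, T z = 0) →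
      ∀ z ∈ (Submodule.span ℂ (diagGraph K w)).topologicalClosure, T z = 0 := fun T hT =>
    Submodule.topologicalClosure_minimal (t := T.ker) _
      (Submodule.span_le.2 fun z hz => hT z hz) T.isClosed_ker
  have h2 : ∀ (T : H × H →L[ℂ] ℂ), (∀ z ∈ diagGraph K w, T z = 0) →
      ∀ z ∈ (Submodule.span ℂ (diagGraph K w)).topologicalClosure, T z = 0 := fun T hT =>
    Submodule.topologicalClosure_minimal (t := T.ker) _
      (Submodule.span_le.2 fun z hz => hT z hz) T.isClosed_ker
  intro z hz h0
  have h3 : ∀ j, stepProj K j z.2 = 0 := by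
    intro j
    have := h1 ((stepProj K j).comp (ContinuousLinearMap.snd ℂ H H) -
      (w j : ℂ) • (stepProj K j).comp (ContinuousLinearMap.fst ℂ H H))
      (fun z hz => sub_eq_zero.2 (stepProj_of_mem_diagGraph hK hz j)) z hz
    have h4 : stepProj K j z.2 - (w j : ℂ) • stepProj K j z.1 = 0 := this
    rwa [h0, map_zero, smul_zero, sub_zero] at h4
  have := h2 ((innerSL ℂ z.2).comp (ContinuousLinearMap.snd ℂ H H))
    (fun y hy => inner_eq_zero_of_mem_diagGraph hy h3) z hz
  exact inner_self_eq_zero.1 this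

lemma norm_stepProj_commutator_le (x : H →L[ℂ] H) (k : ℤ) :
    ‖stepProj K k * x - x * stepProj K k‖ ≤ 4 * ‖x‖ := by
  refine (norm_sub_le _ _).trans ?_
  have h1 := norm_mul_le (stepProj K k) x
  have h2 := norm_mul_le x (stepProj K k)
  nlinarith [norm_stepProj_le K k, norm_nonneg x]

/-- An operator that is compatible with the filtration from `i` on has a bounded commutator with the
diagonal operator. -/
lemma exists_commutator_diagGraph {w : ℤ → ℝ} (hw : ∀ k, 0 ≤ w k) {i : ℤ} {S : ℝ}
    (hS : HasSum (fun k => if k ≤ i then w k else 0) S) {x : H →L[ℂ] H}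
    (hx : ∀ k ≥ i, ∀ v ∈ K k, x v ∈ K k) (hx' : ∀ k ≥ i, ∀ v ∈ K k, star x v ∈ K k) :
    ∃ F : H →L[ℂ] H, ‖F‖ ≤ 4 * ‖x‖ * S ∧
      ∀ z ∈ diagGraph K w, (x z.1, x z.2 + F z.1) ∈ diagGraph K w := by
  let f : ℤ → (H →L[ℂ] H) := fun k => (w k : ℂ) • (stepProj K k * x - x * stepProj K k)
  have hf : ∀ k, ‖f k‖ ≤ 4 * ‖x‖ * (if k ≤ i then w k else 0) := by
    intro k
    split_ifs with h
    · rw [norm_smul, Complex.norm_real, Real.norm_of_nonneg (hw k), mul_comm]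
      exact mul_le_mul_of_nonneg_right (norm_stepProj_commutator_le x k) (hw k)
    -- For `k > i` both `k` and `k - 1` are at least `i`, so `x` commutes with both projections in
    -- `Q_k`.
    · have h0 : stepProj K k * x - x * stepProj K k = 0 := by
        rw [sub_eq_zero]
        ext v
        change stepProj K k (x v) = x (stepProj K k v)
        rw [stepProj_apply, stepProj_apply, map_sub,
          starProjection_apply_commute (hx k (by omega)) (hx' k (by omega)),
          starProjection_apply_commute (hx (k - 1) (by omega)) (hx' (k - 1) (by omega))]
      simp [f, h0]
  have hs := hS.mul_left (4 * ‖x‖)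
  have hsum : HasSum f (∑' k, f k) := (Summable.of_norm_bounded hs.summable hf).hasSum
  refine ⟨_, hsum.norm_le_of_bounded hs hf, fun z hz => ?_⟩
  have h1 := (x.hasSum hz).add ((ContinuousLinearMap.apply ℂ H z.1).hasSum hsum)
  refine h1.congr_fun fun k => ?_
  change _ = x ((w k : ℂ) • stepProj K k z.1) +
    (w k : ℂ) • (stepProj K k (x z.1) - x (stepProj K k z.1))
  rw [map_smul, ← smul_add, add_sub_cancel]

/-- Estimates for the commutator of an operator with a diagonal operator. -/
lemma commSeminorm_diagGraph (hK : Monotone K) {w : ℤ → ℝ} (hw : ∀ k, 0 < w k) {i : ℤ} {S : ℝ}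
    (hS : HasSum (fun k => if k ≤ i then w k else 0) S) {x : H →L[ℂ] H}
    (hx : ∀ k ≥ i, ∀ v ∈ K k, x v ∈ K k) (hx' : ∀ k ≥ i, ∀ v ∈ K k, star x v ∈ K k) {e : H}
    (he : ∀ k, e ∈ K k) (he1 : ‖e‖ = 1) (hxe : x e ∉ K (i - 1)) :
    0 < commSeminorm (opOfGraph (diagGraph K w)) x ∧
      commSeminorm (opOfGraph (diagGraph K w)) x ≤ ENNReal.ofReal (4 * ‖x‖ * S) := by
  obtain ⟨F, hF, hF'⟩ := exists_commutator_diagGraph (fun k => (hw k).le) hS hx hx'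
  have htwist := opOfGraph_twist (diagGraph_closable hK w) hF'
  -- `e` lies in every `K k`, so all `Q_k e` vanish and the operator kills `e`; its commutator with
  -- `x` sends `e` to the image of `x e`.
  have hmem : (e, (0 : H)) ∈ diagGraph K w := by
    refine hasSum_zero.congr_fun fun k => ?_
    rw [stepProj_apply, Submodule.starProjection_eq_self_iff.2 (he k),
      Submodule.starProjection_eq_self_iff.2 (he (k - 1)), sub_self, smul_zero]
  constructor
  · refine commSeminorm_pos htwist (mem_opOfGraph_domain hmem) he1.le fun h0 => hxe ?_
    -- If `F e = 0`, the component of `x e` at level `i` vanishes because `w i ≠ 0`, and `x e ∈ K i`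
    -- would already lie in `K (i - 1)`.
    have h1 := stepProj_of_mem_diagGraph hK (hF' _ hmem) i
    rw [map_zero, zero_add, h0, map_zero, eq_comm, smul_eq_zero, stepProj_apply,
      Submodule.starProjection_eq_self_iff.2 (hx i le_rfl e (he i)), sub_eq_zero] at h1
    exact Submodule.starProjection_eq_self_iff.1
      (h1.resolve_left (by exact_mod_cast (hw i).ne')).symm
  · have hS0 : 0 ≤ S := hS.nonneg fun k => by
      split_ifs
      exacts [(hw k).le, le_rfl]
    exact commSeminorm_le htwist (by positivity) fun e =>
      (F.le_opNorm e).trans (mul_le_mul_of_nonneg_right hF (norm_nonneg e))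

end Filtration

/-- The partial sums of a two-sided geometric progression. -/
lemma hasSum_geometric_le {a : ℝ} (ha : 1 < a) (i : ℤ) :
    HasSum (fun k : ℤ => if k ≤ i then a ^ k else 0) (a ^ i * (1 - a⁻¹)⁻¹) := by
  have ha0 : 0 < a := one_pos.trans ha
  have hinj : Function.Injective fun m : ℕ => i - (m : ℤ) := fun m m' h => by
    simpa using h
  rw [← hinj.hasSum_iff]
  · refine ((hasSum_geometric_of_lt_one (inv_nonneg.2 ha0.le) (inv_lt_one_of_one_lt₀ ha)).mul_left
      (a ^ i)).congr_fun fun m => ?_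
    simp only [Function.comp_apply]
    rw [if_pos (by omega), zpow_sub₀ ha0.ne', zpow_natCast, inv_pow, div_eq_mul_inv]
  · intro k hk
    refine if_neg fun h => hk ⟨(i - k).toNat, ?_⟩
    simp only
    omega

/-! ### Matrices at one site of a UHF algebra -/

lemma integral_comp_measurePreserving {α F : Type*} [MeasurableSpace α] {μ : Measure α}
    [NormedAddCommGroup F] [NormedSpace ℝ F] {σ : α → α} (hσ : MeasurePreserving σ μ μ) {g : α → F}
    (hg : AEStronglyMeasurable g μ) : ∫ w, g (σ w) ∂μ = ∫ w, g w ∂μ := by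
  rw [← integral_map hσ.measurable.aemeasurable (by rwa [hσ.map_eq]), hσ.map_eq]

section UHF

variable {r : ℕ} [NeZero r] {P : Set ℤ}

/-- The weighted translation `ξ ↦ f · ξ(· + (a, b))`. -/
def shiftMul (f : (P → Fin r) × (P →₀ Fin r) → ℂ) (a : P → Fin r) (b : P →₀ Fin r) :
    UHFSpace r P →L[ℂ] UHFSpace r P :=
  opOf fun T => ∀ ξ : UHFSpace r P, ∀ᵐ w ∂(tailMeasure P (Fin r)),
    (T ξ : (P → Fin r) × (P →₀ Fin r) → ℂ) w =
      f w * (ξ : (P → Fin r) × (P →₀ Fin r) → ℂ) (w.1 + a, w.2 + b)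

variable {f g : (P → Fin r) × (P →₀ Fin r) → ℂ} {C C' : ℝ} (a a' : P → Fin r) (b b' : P →₀ Fin r)

lemma shiftMul_spec (hf : Measurable f) (hC : ∀ w, ‖f w‖ ≤ C) (ξ : UHFSpace r P) : ∀ᵐ w ∂(tailMeasure P (Fin r)),
    (shiftMul f a b ξ : (P → Fin r) × (P →₀ Fin r) → ℂ) w =
      f w * (ξ : (P → Fin r) × (P →₀ Fin r) → ℂ) (w.1 + a, w.2 + b) :=
  opOf_spec (P := fun T : UHFSpace r P →L[ℂ] UHFSpace r P =>
    ∀ ξ : UHFSpace r P, ∀ᵐ w ∂(tailMeasure P (Fin r)),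
    (T ξ : (P → Fin r) × (P →₀ Fin r) → ℂ) w =
      f w * (ξ : (P → Fin r) × (P →₀ Fin r) → ℂ) (w.1 + a, w.2 + b))
    (exists_lpOp (A := fun w e => f w * e) (fun _ _ _ => mul_add _ _ _)
      (fun _ _ _ => mul_smul_comm _ _ _)
      (fun w e => (norm_mul_le _ _).trans (mul_le_mul_of_nonneg_right (hC w) (norm_nonneg e)))
      (measurePreserving_shift a b) fun _ hξ => hf.aestronglyMeasurable.mul hξ) ξ

lemma ae_shift {p : (P → Fin r) × (P →₀ Fin r) → Prop} (h : ∀ᵐ w ∂(tailMeasure P (Fin r)), p w) :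
    ∀ᵐ w ∂(tailMeasure P (Fin r)), p (w.1 + a, w.2 + b) :=
  (measurePreserving_shift a b).quasiMeasurePreserving.ae h

lemma norm_shiftMul_le (hf : Measurable f) (hC : ∀ w, ‖f w‖ ≤ C) (hC0 : 0 ≤ C) : ‖shiftMul f a b‖ ≤ C := by
  refine ContinuousLinearMap.opNorm_le_bound _ hC0 fun ξ => ?_
  rw [← Lp.norm_compMeasurePreserving ξ (measurePreserving_shift a b)]
  refine Lp.norm_le_mul_norm_of_ae_le_mul ?_
  filter_upwards [shiftMul_spec a b hf hC ξ,
    Lp.coeFn_compMeasurePreserving ξ (measurePreserving_shift a b)] with w h1 h2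
  rw [h1, h2]
  exact (norm_mul_le _ _).trans (mul_le_mul_of_nonneg_right (hC w) (norm_nonneg _))

lemma shiftMul_commute (hf : Measurable f) (hC : ∀ w, ‖f w‖ ≤ C) (hg : Measurable g)
    (hC' : ∀ w, ‖g w‖ ≤ C')
    (h : ∀ w, f w * g (w.1 + a, w.2 + b) = g w * f (w.1 + a', w.2 + b')) :
    Commute (shiftMul f a b) (shiftMul g a' b') := by
  ext1 ξ
  apply Lp.ext
  filter_upwards [shiftMul_spec a b hf hC (shiftMul g a' b' ξ), shiftMul_spec a' b' hg hC'
    (shiftMul f a b ξ), ae_shift a b (shiftMul_spec a' b' hg hC' ξ),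
    ae_shift a' b' (shiftMul_spec a b hf hC ξ)] with w h1 h2 h3 h4
  change (shiftMul f a b (shiftMul g a' b' ξ) : _ → ℂ) w =
    (shiftMul g a' b' (shiftMul f a b ξ) : _ → ℂ) w
  rw [h1, h2, h3, h4, ← mul_assoc, ← mul_assoc, h]
  simp only [add_assoc, add_comm a a', add_comm b b']

/-- Translating the integration variable by `(a, b)` in the inner product moves the operator to the
other side. -/
lemma star_shiftMul (hf : Measurable f) (hC : ∀ w, ‖f w‖ ≤ C) : star (shiftMul f a b) =
    shiftMul (fun w => (starRingEnd ℂ) (f (w.1 - a, w.2 - b))) (-a) (-b) := by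
  have hf' : Measurable fun w : (P → Fin r) × (P →₀ Fin r) =>
      (starRingEnd ℂ) (f (w.1 - a, w.2 - b)) := by
    refine Complex.continuous_conj.measurable.comp (hf.comp ?_)
    have := (measurePreserving_shift (P := P) (-a) (-b)).measurable
    simpa only [← sub_eq_add_neg] using this
  have hC' : ∀ w : (P → Fin r) × (P →₀ Fin r),
      ‖(starRingEnd ℂ) (f (w.1 - a, w.2 - b))‖ ≤ C := fun w => by
    rw [RCLike.norm_conj]; exact hC _
  rw [ContinuousLinearMap.star_eq_adjoint, eq_comm, ContinuousLinearMap.eq_adjoint_iff]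
  intro ξ η
  have hσ := measurePreserving_shift (P := P) a b
  rw [L2.inner_def, L2.inner_def]
  have hm : AEStronglyMeasurable (fun w => inner ℂ
      ((shiftMul (fun w => (starRingEnd ℂ) (f (w.1 - a, w.2 - b))) (-a) (-b) ξ :
        UHFSpace r P) w) ((η : UHFSpace r P) w)) (tailMeasure P (Fin r)) :=
    (L2.integrable_inner _ _).aestronglyMeasurable
  rw [← integral_comp_measurePreserving hσ hm]
  refine integral_congr_ae ?_
  filter_upwards [ae_shift a b (shiftMul_spec (-a) (-b) hf' hC' ξ), shiftMul_spec a b hf hC η]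
    with w h1 h2
  rw [h1, h2]
  simp only [add_sub_cancel_right, add_neg_cancel_right, RCLike.inner_apply, map_mul,
    Complex.conj_conj]
  ring

/-! ### Matrices at one site -/

variable (M : Matrix (Fin r) (Fin r) ℂ) (i : P)

/-- A bound for the entries of a matrix. -/
def entryBound : ℝ := ∑ s, ∑ t, ‖M s t‖

lemma entryBound_nonneg : 0 ≤ entryBound M :=
  Finset.sum_nonneg fun _ _ => Finset.sum_nonneg fun _ _ => norm_nonneg _

lemma norm_le_entryBound (s t : Fin r) : ‖M s t‖ ≤ entryBound M :=
  (Finset.single_le_sum (f := fun t => ‖M s t‖) (fun _ _ => norm_nonneg _)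
    (Finset.mem_univ t)).trans
    (Finset.single_le_sum (f := fun s => ∑ t, ‖M s t‖)
      (fun _ _ => Finset.sum_nonneg fun _ _ => norm_nonneg _) (Finset.mem_univ s))

lemma measurable_site (h : Fin r → ℂ) :
    Measurable fun w : (P → Fin r) × (P →₀ Fin r) => h (w.1 i) :=
  (measurable_of_countable h).comp ((measurable_pi_apply i).comp measurable_fst)

/-- One of the diagonals of a matrix at a site. -/
def siteDiag (d : Fin r) : UHFSpace r P →L[ℂ] UHFSpace r P :=
  shiftMul (fun w => M (w.1 i) (w.1 i + d)) (Pi.single i d) (Finsupp.single i d)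

lemma siteDiag_spec (d : Fin r) (ξ : UHFSpace r P) : ∀ᵐ w ∂(tailMeasure P (Fin r)),
    (siteDiag M i d ξ : (P → Fin r) × (P →₀ Fin r) → ℂ) w = M (w.1 i) (w.1 i + d) *
      (ξ : (P → Fin r) × (P →₀ Fin r) → ℂ) (w.1 + Pi.single i d, w.2 + Finsupp.single i d) :=
  shiftMul_spec _ _ (measurable_site i fun s => M s (s + d)) (fun _ => norm_le_entryBound M _ _) ξ

/-- Sorting the sum over `c` by `d = c - x_i` splits the matrix into weighted translations. These
exist as bounded operators, which also shows that `siteOp` is not the default `0`. -/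
lemma siteOp_eq : siteOp P M i = ∑ d, siteDiag M i d := by
  have hspec : ∀ ξ : UHFSpace r P, ∀ᵐ w ∂(tailMeasure P (Fin r)),
      ((∑ d, siteDiag M i d) ξ : (P → Fin r) × (P →₀ Fin r) → ℂ) w =
      ∑ c : Fin r, M (w.1 i) c * (ξ : (P → Fin r) × (P →₀ Fin r) → ℂ)
        (open Classical in Function.update w.1 i c, w.2 + Finsupp.single i (c - w.1 i)) := by
    intro ξ
    rw [_root_.sum_apply]
    filter_upwards [Lp.coeFn_finsetSum Finset.univ fun d => siteDiag M i d ξ,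
      ae_all_iff.2 fun d => siteDiag_spec M i d ξ] with w h1 h2
    rw [h1, Finset.sum_apply]
    refine Eq.trans (Finset.sum_congr rfl fun d _ => ?_) (Equiv.sum_comp (Equiv.addLeft (w.1 i)) _)
    rw [h2]
    simp only [Equiv.coe_addLeft, add_sub_cancel_left]
    congr 3
    funext j
    by_cases h : j = i
    · subst h; simp
    · simp [h]
  have h2 := opOf_spec (P := fun T : UHFSpace r P →L[ℂ] UHFSpace r P =>
    ∀ ξ : UHFSpace r P, ∀ᵐ w ∂(tailMeasure P (Fin r)),
    (T ξ : (P → Fin r) × (P →₀ Fin r) → ℂ) w = ∑ c : Fin r, M (w.1 i) c *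
      (ξ : (P → Fin r) × (P →₀ Fin r) → ℂ)
        (open Classical in Function.update w.1 i c, w.2 + Finsupp.single i (c - w.1 i)))
    ⟨_, hspec⟩
  ext1 ξ
  apply Lp.ext
  filter_upwards [hspec ξ, h2 ξ] with w h3 h4
  rw [h3]
  exact h4

/-- A crude bound, but independent of the site and of `P`, as needed to let the site tend to `-∞`.
-/
lemma norm_siteOp_le : ‖siteOp P M i‖ ≤ r * entryBound M := by
  rw [siteOp_eq]
  refine (norm_sum_le _ _).trans ?_
  refine (Finset.sum_le_sum (g := fun _ => entryBound M) fun d _ => norm_shiftMul_le _ _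
    (measurable_site i fun s => M s (s + d)) (fun _ => norm_le_entryBound M _ _)
    (entryBound_nonneg M)).trans ?_
  simp

/-- The sequences with `x_i = s`, `y_i = t` and `x_j = y_j` elsewhere. -/
def entrySet (s t : Fin r) : Set ((P → Fin r) × (P →₀ Fin r)) :=
  {x | x i = s} ×ˢ {Finsupp.single i (s - t)}

lemma measurableSet_entrySet (s t : Fin r) : MeasurableSet (entrySet i s t) :=
  (measurableSet_eq_fun (measurable_pi_apply i) measurable_const).prod (measurableSet_singleton _)

lemma tailMeasure_entrySet (s t : Fin r) :
    tailMeasure P (Fin r) (entrySet i s t) = (r : ℝ≥0∞)⁻¹ := by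
  rw [entrySet, tailMeasure_prod_singleton]
  have h := uniform_singleton (κ := Fin r) s
  rw [← Measure.infinitePi_map_eval (fun _ : P => (PMF.uniformOfFintype (Fin r)).toMeasure) i,
    Measure.map_apply (measurable_pi_apply i) (measurableSet_singleton s), Fintype.card_fin] at h
  exact h

lemma tailMeasure_entrySet_ne_zero (s t : Fin r) :
    tailMeasure P (Fin r) (entrySet i s t) ≠ 0 := by
  rw [tailMeasure_entrySet]
  simp

lemma exists_mem_entrySet (s t : Fin r) {p : (P → Fin r) × (P →₀ Fin r) → Prop}
    (h : ∀ᵐ w ∂(tailMeasure P (Fin r)), p w) : ∃ w ∈ entrySet i s t, p w := by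
  by_contra! hc
  refine tailMeasure_entrySet_ne_zero i s t (measure_mono_null ?_ h)
  exact fun w hw => hc w hw

variable (r P) in
/-- The vector of the trace. -/
def traceVec : UHFSpace r P := diagVector 1

lemma norm_traceVec : ‖traceVec r P‖ = 1 := by
  rw [traceVec, norm_diagVector, norm_one]

lemma traceVec_spec : ∀ᵐ w ∂(tailMeasure P (Fin r)),
    (traceVec r P : (P → Fin r) × (P →₀ Fin r) → ℂ) w = if w.2 = 0 then 1 else 0 := by
  filter_upwards [diagVector_coe (P := P) (κ := Fin r) (1 : ℂ)] with w h
  rw [traceVec, h]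
  simp [Set.indicator, diagSet]

/-- Only the translation with `d = t - s` takes a point of the entry set to the diagonal, where the
trace vector equals one; so the matrix entries can be read off. -/
lemma siteOp_traceVec : ∀ᵐ w ∂(tailMeasure P (Fin r)), ∀ s t, w ∈ entrySet i s t →
    (siteOp P M i (traceVec r P) : (P → Fin r) × (P →₀ Fin r) → ℂ) w = M s t := by
  rw [siteOp_eq, _root_.sum_apply]
  filter_upwards [Lp.coeFn_finsetSum Finset.univ fun d => siteDiag M i d (traceVec r P),
    ae_all_iff.2 fun d => siteDiag_spec M i d (traceVec r P),
    ae_all_iff.2 fun d : Fin r =>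
      ae_shift (Pi.single i d) (Finsupp.single i d) (traceVec_spec (r := r) (P := P))]
    with w h1 h2 h3 s t hw
  have hs : w.1 i = s := hw.1
  have ht : w.2 = Finsupp.single i (s - t) := hw.2
  rw [h1, Finset.sum_apply, Finset.sum_eq_single (t - s)]
  · rw [h2, h3, hs, ht, ← Finsupp.single_add]
    simp
  · intro d _ hd
    rw [h2, h3, ht, ← Finsupp.single_add, if_neg, mul_zero]
    rw [Finsupp.single_eq_zero]
    intro h
    apply hd
    rw [← sub_eq_zero, ← h]
    abel
  · intro h
    exact absurd (Finset.mem_univ _) h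

/-- Cauchy–Schwarz against the indicator of the entry set, whose measure is `1 / r` and whose norm
is at most one. -/
lemma norm_le_of_entrySet {η : UHFSpace r P} {z : ℂ} {s t : Fin r}
    (h : ∀ᵐ w ∂(tailMeasure P (Fin r)), w ∈ entrySet i s t →
      (η : (P → Fin r) × (P →₀ Fin r) → ℂ) w = z) : ‖z‖ / r ≤ ‖η‖ := by
  have hr : (1 : ℝ) ≤ r := by exact_mod_cast NeZero.one_le
  have hfin : tailMeasure P (Fin r) (entrySet i s t) ≠ ⊤ := by
    rw [tailMeasure_entrySet]
    simp [NeZero.ne]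
  have hreal : (tailMeasure P (Fin r)).real (entrySet i s t) = (r : ℝ)⁻¹ := by
    rw [measureReal_def, tailMeasure_entrySet, ENNReal.toReal_inv, ENNReal.toReal_natCast]
  have h1 := L2.inner_indicatorConstLp_one (𝕜 := ℂ) (measurableSet_entrySet i s t) hfin η
  rw [setIntegral_congr_ae (measurableSet_entrySet i s t) h, setIntegral_const, hreal] at h1
  have h2 := norm_inner_le_norm (𝕜 := ℂ)
    (indicatorConstLp 2 (measurableSet_entrySet i s t) hfin (1 : ℂ)) η
  rw [h1, norm_smul, norm_inv, Real.norm_natCast, norm_indicatorConstLp (by simp) (by simp), hreal,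
    norm_one, one_mul] at h2
  rw [div_eq_inv_mul]
  refine h2.trans (mul_le_of_le_one_left (norm_nonneg _) ?_)
  exact Real.rpow_le_one (by positivity) (inv_le_one_of_one_le₀ hr) (by positivity)

variable {M}

lemma exists_entry_ne (hM : ∀ c : ℂ, M ≠ c • 1) :
    (∃ s t, s ≠ t ∧ M s t ≠ 0) ∨ ∃ s t, M s s ≠ M t t := by
  by_contra! h
  refine hM (M 0 0) ?_
  ext s t
  by_cases hst : s = t
  · subst hst
    simp [h.2 s 0]
  · simp [hst, h.1 s t hst]

/-- A nonzero off-diagonal entry is untouched by scalars. Otherwise two diagonal entries differ, and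
no scalar is closer than half their distance to both. -/
lemma exists_entry_sub (hM : ∀ c : ℂ, M ≠ c • 1) :
    ∃ c > 0, ∀ a : ℂ, ∃ s t, c ≤ ‖M s t - if s = t then a else 0‖ := by
  rcases exists_entry_ne hM with ⟨s, t, hst, h⟩ | ⟨s, t, h⟩
  · exact ⟨‖M s t‖, norm_pos_iff.2 h, fun a => ⟨s, t, by simp [hst]⟩⟩
  · refine ⟨‖M s s - M t t‖ / 2, half_pos (norm_pos_iff.2 (sub_ne_zero.2 h)), fun a => ?_⟩
    by_contra! hc
    have h1 := hc s s
    have h2 := hc t t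
    rw [if_pos rfl] at h1 h2
    have h3 := norm_sub_le (M s s - a) (M t t - a)
    rw [sub_sub_sub_cancel_right] at h3
    linarith

/-- The quantifiers matter: one constant serves all sites and all index sets, hence every `n` and
the limit. -/
lemma exists_le_norm_siteOp_sub (hM : ∀ c : ℂ, M ≠ c • 1) : ∃ c > 0, ∀ (P : Set ℤ) (i : P) (a : ℂ),
    c ≤ ‖siteOp P M i (traceVec r P) - a • traceVec r P‖ := by
  obtain ⟨c, hc, h⟩ := exists_entry_sub hM
  have hr : (0 : ℝ) < r := by exact_mod_cast NeZero.pos r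
  refine ⟨c / r, div_pos hc hr, fun P i a => ?_⟩
  obtain ⟨s, t, hst⟩ := h a
  refine (div_le_div_of_nonneg_right hst hr.le).trans (norm_le_of_entrySet i (s := s) (t := t) ?_)
  filter_upwards [siteOp_traceVec M i, traceVec_spec (r := r) (P := P),
    Lp.coeFn_sub (siteOp P M i (traceVec r P)) (a • traceVec r P),
    Lp.coeFn_smul a (traceVec r P)] with w h1 h2 h3 h4 hw
  have ht : w.2 = Finsupp.single i (s - t) := hw.2
  rw [h3, Pi.sub_apply, h1 s t hw, h4, Pi.smul_apply, h2, ht]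
  by_cases h : s = t
  · subst h
    simp
  · have h5 : Finsupp.single i (s - t) ≠ 0 := by
      rwa [Ne, Finsupp.single_eq_zero, sub_eq_zero]
    rw [if_neg h5, if_neg h, smul_zero]

/-! ### The filtration by local subspaces -/

lemma eq_traceVec {Ω : UHFSpace r P} (h : (Ω : (P → Fin r) × (P →₀ Fin r) → ℂ) =ᵐ[tailMeasure P (Fin r)]
    fun w => if w.2 = 0 then 1 else 0) : Ω = traceVec r P := by
  apply Lp.ext
  filter_upwards [h, traceVec_spec (r := r) (P := P)] with w h1 h2
  rw [h1, h2]

variable (r P) in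
/-- The algebra generated by the matrices at the sites `i ≤ k`. -/
def localAlg (k : ℤ) : StarSubalgebra ℂ (UHFSpace r P →L[ℂ] UHFSpace r P) :=
  StarAlgebra.adjoin ℂ {T | ∃ b, ∃ i : P, (i : ℤ) ≤ k ∧ T = siteOp P b i}

lemma localSubspace_eq (k : ℤ) : localSubspace r P k =
    (Submodule.span ℂ {v | ∃ a ∈ localAlg r P k, v = a (traceVec r P)}).topologicalClosure := by
  unfold localSubspace
  congr 2
  ext v
  constructor
  · rintro ⟨a, ha, Ω, hΩ, rfl⟩
    exact ⟨a, ha, by rw [eq_traceVec hΩ]⟩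
  · rintro ⟨a, ha, rfl⟩
    exact ⟨a, ha, _, traceVec_spec, rfl⟩

lemma monotone_localSubspace : Monotone (localSubspace r P) := by
  intro k l h
  rw [localSubspace_eq, localSubspace_eq]
  refine Submodule.topologicalClosure_mono (Submodule.span_mono ?_)
  rintro v ⟨a, ha, rfl⟩
  refine ⟨a, StarAlgebra.adjoin_mono ?_ ha, rfl⟩
  rintro T ⟨b, i, hi, rfl⟩
  exact ⟨b, i, hi.trans h, rfl⟩

lemma traceVec_mem_localSubspace (k : ℤ) : traceVec r P ∈ localSubspace r P k := by
  rw [localSubspace_eq]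
  exact Submodule.le_topologicalClosure _ (Submodule.subset_span ⟨1, one_mem _, rfl⟩)

/-- A closed subspace that contains the vectors `a Ω` contains the local subspace. -/
lemma localSubspace_le {k : ℤ} {S : Submodule ℂ (UHFSpace r P)}
    (hS : IsClosed (S : Set (UHFSpace r P))) (h : ∀ a ∈ localAlg r P k, a (traceVec r P) ∈ S) :
    localSubspace r P k ≤ S := by
  rw [localSubspace_eq]
  refine Submodule.topologicalClosure_minimal _ (Submodule.span_le.2 ?_) hS
  rintro v ⟨a, ha, rfl⟩
  exact h a ha

lemma apply_mem_localSubspace {k : ℤ} {x : UHFSpace r P →L[ℂ] UHFSpace r P}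
    (hx : x ∈ localAlg r P k) : ∀ v ∈ localSubspace r P k, x v ∈ localSubspace r P k := by
  refine localSubspace_le (S := (localSubspace r P k).comap x.toLinearMap) ?_ fun a ha => ?_
  · exact (Submodule.isClosed_topologicalClosure _ :
      IsClosed (localSubspace r P k : Set (UHFSpace r P))).preimage x.continuous
  · change x (a (traceVec r P)) ∈ localSubspace r P k
    rw [localSubspace_eq]
    exact Submodule.le_topologicalClosure _ (Submodule.subset_span ⟨x * a, mul_mem hx ha, rfl⟩)

lemma siteOp_mem_localAlg {k : ℤ} (h : (i : ℤ) ≤ k) : siteOp P M i ∈ localAlg r P k :=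
  StarAlgebra.subset_adjoin ℂ _ ⟨M, i, h, rfl⟩

/-- `T a Ω = a T Ω = a Ω` for local `a`, and such vectors span a dense subspace. Commutation of
`star T` is needed because the local algebra is generated as a star algebra. -/
lemma apply_eq_self_of_commute {k : ℤ} {T : UHFSpace r P →L[ℂ] UHFSpace r P}
    (h1 : ∀ b (j : P), (j : ℤ) ≤ k → Commute T (siteOp P b j))
    (h2 : ∀ b (j : P), (j : ℤ) ≤ k → Commute (star T) (siteOp P b j))
    (hT : T (traceVec r P) = traceVec r P) : ∀ v ∈ localSubspace r P k, T v = v := by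
  have h3 : localAlg r P k ≤ StarSubalgebra.centralizer ℂ {T} := by
    refine StarAlgebra.adjoin_le ?_
    rintro _ ⟨b, j, hj, rfl⟩
    rw [SetLike.mem_coe, StarSubalgebra.mem_centralizer_iff]
    rintro _ rfl
    exact ⟨h1 b j hj, h2 b j hj⟩
  have h4 : localSubspace r P k ≤ (T - 1).ker := by
    refine localSubspace_le (T - 1).isClosed_ker fun a ha => ?_
    have h5 := ((StarSubalgebra.mem_centralizer_iff ℂ).1 (h3 ha) T rfl).1
    have h6 : T (a (traceVec r P)) = a (T (traceVec r P)) :=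
      congrArg (fun S : UHFSpace r P →L[ℂ] UHFSpace r P => S (traceVec r P)) h5
    rw [LinearMap.mem_ker]
    change T (a (traceVec r P)) - a (traceVec r P) = 0
    rw [h6, hT, sub_self]
  intro v hv
  exact sub_eq_zero.1 (h4 hv)

/-- The projection onto the functions that live on `x_i = y_i`. -/
def diagRestrict : UHFSpace r P →L[ℂ] UHFSpace r P :=
  shiftMul (fun w => if w.2 i = 0 then 1 else 0) 0 0

lemma measurable_diagRestrict :
    Measurable fun w : (P → Fin r) × (P →₀ Fin r) => if w.2 i = 0 then (1 : ℂ) else 0 :=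
  (Measurable.of_discrete (f := fun f : P →₀ Fin r => if f i = 0 then (1 : ℂ) else 0)).comp
    measurable_snd

lemma norm_diagRestrict_le (w : (P → Fin r) × (P →₀ Fin r)) :
    ‖if w.2 i = 0 then (1 : ℂ) else 0‖ ≤ 1 := by
  split_ifs <;> simp

/-- Translation of `x` by `a`, together with the translation of `y`. -/
def diagShift (a : P → Fin r) : UHFSpace r P →L[ℂ] UHFSpace r P := shiftMul (fun _ => 1) a 0

lemma star_diagRestrict : star (diagRestrict i) = diagRestrict (r := r) i := by
  rw [diagRestrict, star_shiftMul _ _ (measurable_diagRestrict i) (norm_diagRestrict_le i), neg_zero,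
    neg_zero]
  congr 1
  funext w
  simp only [sub_zero]
  split_ifs <;> simp

lemma star_diagShift : star (diagShift a) = diagShift (-a) := by
  rw [diagShift, star_shiftMul (C := 1) _ _ measurable_const (by simp), neg_zero, map_one]
  rfl

lemma diagRestrict_commute {j : P} (h : j ≠ i) : Commute (diagRestrict i) (siteOp P M j) := by
  rw [siteOp_eq]
  refine Commute.sum_right _ _ _ fun d _ => shiftMul_commute _ _ _ _ (measurable_diagRestrict i)
    (norm_diagRestrict_le i) (measurable_site j fun s => M s (s + d))
    (fun _ => norm_le_entryBound M _ _) fun w => ?_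
  simp [h, mul_comm]

lemma diagShift_commute {j : P} (h : a j = 0) : Commute (diagShift a) (siteOp P M j) := by
  rw [siteOp_eq]
  refine Commute.sum_right _ _ _ fun d _ => shiftMul_commute (C := 1) _ _ _ _ measurable_const
    (by simp) (measurable_site j fun s => M s (s + d)) (fun _ => norm_le_entryBound M _ _)
    fun w => ?_
  simp [h]

lemma diagRestrict_traceVec : diagRestrict i (traceVec r P) = traceVec r P := by
  apply Lp.ext
  filter_upwards [shiftMul_spec 0 0 (measurable_diagRestrict i) (norm_diagRestrict_le i)
    (traceVec r P), traceVec_spec (r := r) (P := P)] with w h1 h2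
  rw [diagRestrict, h1, add_zero, add_zero, h2]
  by_cases h : w.2 = 0 <;> simp [h]

lemma diagShift_traceVec : diagShift a (traceVec r P) = traceVec r P := by
  apply Lp.ext
  filter_upwards [shiftMul_spec (C := 1) a 0 measurable_const (f := fun _ => 1) (by simp)
    (traceVec r P), ae_shift a 0 (traceVec_spec (r := r) (P := P)),
    traceVec_spec (r := r) (P := P)] with w h1 h2 h3
  rw [diagShift, h1, h2, h3, add_zero, one_mul]

/-- Vectors of the lower local subspace are supported on `x_i = y_i` and are invariant under
translating `x_i` and `y_i` together. A nonzero off-diagonal entry violates the first property, two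
different diagonal entries the second. -/
lemma siteOp_traceVec_notMem (hM : ∀ c : ℂ, M ≠ c • 1) :
    siteOp P M i (traceVec r P) ∉ localSubspace r P ((i : ℤ) - 1) := by
  intro hmem
  have hne : ∀ j : P, (j : ℤ) ≤ (i : ℤ) - 1 → j ≠ i := by
    rintro j hj rfl
    omega
  rcases exists_entry_ne hM with ⟨s, t, hst, h⟩ | ⟨s, t, h⟩
  · have h1 := apply_eq_self_of_commute (T := diagRestrict i)
      (fun b j hj => diagRestrict_commute i (hne j hj))
      (fun b j hj => by rw [star_diagRestrict]; exact diagRestrict_commute i (hne j hj))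
      (diagRestrict_traceVec i) _ hmem
    obtain ⟨w, hw, h2, h3⟩ := exists_mem_entrySet i s t
      ((siteOp_traceVec M i).and (shiftMul_spec 0 0 (measurable_diagRestrict i)
        (norm_diagRestrict_le i) (siteOp P M i (traceVec r P))))
    have ht : w.2 = Finsupp.single i (s - t) := hw.2
    have h4 : ¬ w.2 i = 0 := by
      rw [ht, Finsupp.single_eq_same]
      exact sub_ne_zero.2 hst
    rw [← diagRestrict, h1, h2 s t hw, if_neg h4, zero_mul] at h3
    exact h h3
  · have h1 := apply_eq_self_of_commute (T := diagShift (Pi.single i (t - s)))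
      (fun b j hj => diagShift_commute _ (Pi.single_eq_of_ne (hne j hj) _))
      (fun b j hj => by
        rw [star_diagShift]
        exact diagShift_commute _ (by simp [Pi.single_eq_of_ne (hne j hj)]))
      (diagShift_traceVec _) _ hmem
    obtain ⟨w, hw, h2, h3, h4⟩ := exists_mem_entrySet i s s
      ((siteOp_traceVec M i).and ((shiftMul_spec (C := 1) (Pi.single i (t - s)) 0 measurable_const
        (f := fun _ => 1) (by simp) (siteOp P M i (traceVec r P))).and
        (ae_shift (Pi.single i (t - s)) 0 (siteOp_traceVec M i))))
    have hs : w.1 i = s := hw.1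
    have h5 : (w.1 + Pi.single i (t - s), w.2 + 0) ∈ entrySet i t t := by
      have ht : w.2 = Finsupp.single i (s - s) := hw.2
      refine ⟨?_, ?_⟩
      · simp [hs]
      · simp [ht]
    rw [← diagShift, h1, h2 s s hw, h4 t t h5, one_mul] at h3
    exact h h3

/-! ### The conclusions for UHF algebras -/

/-- The bound is the total weight of the levels up to the site `i`, a geometric series with ratio
`r^s`; at `i = -n` it decays like `r^{-ns}`. -/
lemma commSeminorm_uhfDirac {s : ℝ} (hr : 2 ≤ r) (hs : 1 < s) (hM : ∀ c : ℂ, M ≠ c • 1) :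
    0 < commSeminorm (uhfDirac r P s) (siteOp P M i) ∧
      commSeminorm (uhfDirac r P s) (siteOp P M i) ≤ ENNReal.ofReal
        (4 * (r * entryBound M) * (((r : ℝ) ^ s) ^ (i : ℤ) * (1 - ((r : ℝ) ^ s)⁻¹)⁻¹)) := by
  have hr1 : (1 : ℝ) < r := by exact_mod_cast hr
  have ha : 1 < (r : ℝ) ^ s := Real.one_lt_rpow hr1 (by linarith)
  have hw : ∀ k : ℤ, (r : ℝ) ^ ((k : ℝ) * s) = ((r : ℝ) ^ s) ^ k := fun k => by
    rw [mul_comm, Real.rpow_mul (by linarith), Real.rpow_intCast]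
  have hS := hasSum_geometric_le ha i
  have key := commSeminorm_diagGraph monotone_localSubspace
    (w := fun k => (r : ℝ) ^ ((k : ℝ) * s)) (i := i)
    (fun k => by positivity) (by simpa only [hw] using hS) (x := siteOp P M i)
    (fun k hk => apply_mem_localSubspace (siteOp_mem_localAlg i hk))
    (fun k hk => apply_mem_localSubspace (star_mem (siteOp_mem_localAlg i hk)))
    traceVec_mem_localSubspace norm_traceVec (siteOp_traceVec_notMem i hM)
  refine ⟨key.1, key.2.trans (ENNReal.ofReal_le_ofReal ?_)⟩
  have h1 : 0 ≤ ((r : ℝ) ^ s) ^ (i : ℤ) * (1 - ((r : ℝ) ^ s)⁻¹)⁻¹ := hS.nonneg fun k => by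
    split_ifs <;> positivity
  exact mul_le_mul_of_nonneg_right
    (mul_le_mul_of_nonneg_left (norm_siteOp_le M i) (by norm_num)) h1

lemma tendsto_uhf_bound {a : ℝ} (ha : 1 < a) (C C' : ℝ) :
    Tendsto (fun n : ℕ => ENNReal.ofReal (C * (a ^ (-(n : ℤ)) * C'))) atTop (𝓝 0) := by
  have h1 : Tendsto (fun n : ℕ => a ^ (-(n : ℤ))) atTop (𝓝 0) := by
    have := tendsto_pow_atTop_nhds_zero_of_lt_one (inv_nonneg.2 (one_pos.trans ha).le)
      (inv_lt_one_of_one_lt₀ ha)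
    refine this.congr fun n => ?_
    rw [zpow_neg, zpow_natCast, inv_pow]
  have h2 := ENNReal.tendsto_ofReal ((h1.mul_const C').const_mul C)
  simpa using h2

lemma exists_ne_smul_one (hr : 2 ≤ r) : ∃ b : Matrix (Fin r) (Fin r) ℂ, ∀ c : ℂ, b ≠ c • 1 := by
  refine ⟨Matrix.single 0 ⟨1, hr⟩ 1, fun c h => ?_⟩
  have h0 : (0 : Fin r) ≠ ⟨1, hr⟩ := by
    rw [Ne, Fin.ext_iff]
    simp
  have := congrFun (congrFun h 0) ⟨1, hr⟩
  simp [h0] at this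

/-- The conclusions for UHF algebras. -/
theorem uhf_conclusion (hr : 2 ≤ r) {s : ℝ} (hs : 1 < s)
    (L : ∀ n : ℕ, uhfAlg r (Set.Ici (-(n : ℤ))) → ℝ≥0∞) (L' : uhfAlg r Set.univ → ℝ≥0∞)
    (hL : ∀ n : ℕ, L n =
      lipSeminorm (uhfDirac r (Set.Ici (-(n : ℤ))) s) (uhfAlg r (Set.Ici (-(n : ℤ)))))
    (hL' : L' = lipSeminorm (uhfDirac r Set.univ s) (uhfAlg r Set.univ)) :
    Tendsto (fun n => normicRadius (L n)) atTop (𝓝 ⊤) ∧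
      (∀ b : Matrix (Fin r) (Fin r) ℂ, (∀ c : ℂ, b ≠ c • 1) →
        ∃ (x : ∀ n : ℕ, uhfAlg r (Set.Ici (-(n : ℤ)))) (x' : ℕ → uhfAlg r Set.univ),
          (∀ n : ℕ, (x n : UHFSpace r (Set.Ici (-(n : ℤ))) →L[ℂ] UHFSpace r (Set.Ici (-(n : ℤ)))) =
            siteOp (Set.Ici (-(n : ℤ))) b ⟨-(n : ℤ), Set.self_mem_Ici⟩) ∧
          (∀ n : ℕ, (x' n : UHFSpace r Set.univ →L[ℂ] UHFSpace r Set.univ) =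
            siteOp Set.univ b ⟨-(n : ℤ), Set.mem_univ _⟩) ∧
          UnboundedSeq L x ∧ UnboundedSeqIn L' x') ∧
      ¬ BallTotallyBounded L' ∧ ¬ IsLipNorm L' := by
  obtain rfl : L = fun n : ℕ =>
    lipSeminorm (uhfDirac r (Set.Ici (-(n : ℤ))) s) (uhfAlg r (Set.Ici (-(n : ℤ)))) := funext hL
  subst hL'
  have ha : 1 < (r : ℝ) ^ s := Real.one_lt_rpow (by exact_mod_cast hr) (by linarith)
  let x : ∀ (_ : Matrix (Fin r) (Fin r) ℂ) (n : ℕ), uhfAlg r (Set.Ici (-(n : ℤ))) := fun b n =>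
    ⟨siteOp (Set.Ici (-(n : ℤ))) b ⟨-(n : ℤ), Set.self_mem_Ici⟩, subset_cstarGen ⟨_, _, rfl⟩⟩
  let x' : ∀ (_ : Matrix (Fin r) (Fin r) ℂ), ℕ → uhfAlg r Set.univ := fun b n =>
    ⟨siteOp Set.univ b ⟨-(n : ℤ), Set.mem_univ _⟩, subset_cstarGen ⟨_, _, rfl⟩⟩
  have main : ∀ b : Matrix (Fin r) (Fin r) ℂ, (∀ c : ℂ, b ≠ c • 1) →
      UnboundedSeq (fun n : ℕ => lipSeminorm (uhfDirac r (Set.Ici (-(n : ℤ))) s)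
        (uhfAlg r (Set.Ici (-(n : ℤ))))) (x b) ∧
      UnboundedSeqIn (lipSeminorm (uhfDirac r Set.univ s) (uhfAlg r Set.univ)) (x' b) ∧
      ¬ IsLipNorm (lipSeminorm (uhfDirac r Set.univ s) (uhfAlg r Set.univ)) := by
    intro b hb
    obtain ⟨c, hc, hle⟩ := exists_le_norm_siteOp_sub hb
    have hlim := tendsto_uhf_bound ha (4 * (r * entryBound b)) (1 - ((r : ℝ) ^ s)⁻¹)⁻¹
    set bd : ℕ → ℝ≥0∞ := fun n => ENNReal.ofReal (4 * (r * entryBound b) *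
      (((r : ℝ) ^ s) ^ (-(n : ℤ)) * (1 - ((r : ℝ) ^ s)⁻¹)⁻¹))
    have hx : ∀ n : ℕ, 0 < lipSeminorm (uhfDirac r (Set.Ici (-(n : ℤ))) s)
          (uhfAlg r (Set.Ici (-(n : ℤ)))) (x b n) ∧
        lipSeminorm (uhfDirac r (Set.Ici (-(n : ℤ))) s)
          (uhfAlg r (Set.Ici (-(n : ℤ)))) (x b n) ≤ bd n := fun n =>
      commSeminorm_uhfDirac (P := Set.Ici (-(n : ℤ))) ⟨-(n : ℤ), Set.self_mem_Ici⟩ hr hs hb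
    have hx' : ∀ n : ℕ, 0 < lipSeminorm (uhfDirac r Set.univ s) (uhfAlg r Set.univ) (x' b n) ∧
        lipSeminorm (uhfDirac r Set.univ s) (uhfAlg r Set.univ) (x' b n) ≤ bd n := fun n =>
      commSeminorm_uhfDirac (P := Set.univ) ⟨-(n : ℤ), Set.mem_univ _⟩ hr hs hb
    have h0 := tendsto_of_tendsto_of_tendsto_of_le_of_le tendsto_const_nhds hlim
      (fun _ => zero_le) fun n => (hx n).2
    have h0' := tendsto_of_tendsto_of_tendsto_of_le_of_le tendsto_const_nhds hlim
      (fun _ => zero_le) fun n => (hx' n).2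
    have hfin' : ∀ n : ℕ, lipSeminorm (uhfDirac r Set.univ s) (uhfAlg r Set.univ) (x' b n) < ⊤ :=
      fun n => (hx' n).2.trans_lt ENNReal.ofReal_lt_top
    have hle' : ∀ (n : ℕ) (a : ℂ), c ≤ ‖(x' b n : UHFSpace r Set.univ →L[ℂ] UHFSpace r Set.univ)
        (traceVec r Set.univ) - a • traceVec r Set.univ‖ := fun n a => hle _ _ a
    exact ⟨unboundedSeq_of_tendsto (fun n => (hx n).1) h0
        (fun n => (hx n).2.trans_lt ENNReal.ofReal_lt_top) hc
        (ξ := fun n : ℕ => traceVec r (Set.Ici (-(n : ℤ)))) (fun n => norm_traceVec)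
        fun n a => hle _ _ a,
      unboundedSeq_of_tendsto (D := fun _ => uhfDirac r Set.univ s)
        (A := fun _ => uhfAlg r Set.univ) (fun n => (hx' n).1) h0' hfin' hc
        (ξ := fun _ : ℕ => traceVec r Set.univ) (fun n => norm_traceVec) hle',
      not_isLipNorm_of_unboundedSeqIn (fun n => (hx' n).1) h0' hfin' hc
        (ξ := fun _ : ℕ => traceVec r Set.univ) (fun n => norm_traceVec) hle'⟩
  -- The statements about radii and balls do not mention `b`; a matrix unit off the diagonal serves
  -- as witness.
  obtain ⟨b, hb⟩ := exists_ne_smul_one hr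
  exact ⟨tendsto_normicRadius (main b hb).1,
    fun b hb => ⟨x b, x' b, fun _ => rfl, fun _ => rfl, (main b hb).1, (main b hb).2.1⟩,
    not_ballTotallyBounded (main b hb).2.1, (main b hb).2.2⟩

end UHF

/-- A dense subspace of a nontrivial space contains unit vectors. -/
lemma exists_norm_eq_one_mem_of_dense {H : Type*} [NormedAddCommGroup H] [NormedSpace ℂ H]
    [Nontrivial H] {S : Submodule ℂ H} (hS : Dense (S : Set H)) : ∃ e ∈ S, ‖e‖ = 1 := by
  obtain ⟨e, he, he0⟩ := hS.exists_mem_open isOpen_compl_singleton (exists_ne (0 : H))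
  refine ⟨((‖e‖⁻¹ : ℝ) : ℂ) • e, S.smul_mem _ he, ?_⟩
  rw [norm_smul, Complex.norm_real, norm_inv, norm_norm, inv_mul_cancel₀ (norm_ne_zero_iff.2 he0)]

end SelfCovering

end

/-! ### Assembly of the four cases -/

theorem mainTheorem6 :
    -- self-coverings of tori
    (∀ (p : ℕ) (B : CoveringMatrix p)
      (ε : Fin p → Matrix (Fin (2 ^ (p / 2))) (Fin (2 ^ (p / 2))) ℂ), IsClifford ε →
      ∀ (u : (Fin p → ℤ) → Matrix (Fin 1) (Fin 1) ℂ), (∀ g, u g = 1) →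
      ∀ (L : ∀ n, torusAlg B u (2 ^ (p / 2)) n → ℝ≥0∞)
        (L' : torusLimitAlg B u (2 ^ (p / 2)) → ℝ≥0∞),
      (∀ n, L n = lipSeminorm (torusDirac B u ε 1 n) (torusAlg B u (2 ^ (p / 2)) n)) →
      L' = lipSeminorm (torusLimitDirac B u ε 1) (torusLimitAlg B u (2 ^ (p / 2))) →
      Tendsto (fun n => normicRadius (L n)) atTop (𝓝 ⊤) ∧
      (∃ (x : ∀ n, torusAlg B u (2 ^ (p / 2)) n) (x' : ℕ → torusLimitAlg B u (2 ^ (p / 2))),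
        (∀ n, (x n : TorusSpace B (2 ^ (p / 2)) 1 n →L[ℂ] TorusSpace B (2 ^ (p / 2)) 1 n) =
          mulOp B (2 ^ (p / 2)) n (fun t => character (B.freq n) t • 1)) ∧
        (∀ n, (x' n : TorusLimitSpace B (2 ^ (p / 2)) 1 →L[ℂ] TorusLimitSpace B (2 ^ (p / 2)) 1) =
          torusEmbed B u (2 ^ (p / 2)) n (fun t => character (B.freq n) t • 1)) ∧
        (∀ n, L' (x' n) = L n (x n)) ∧
        UnboundedSeq L x ∧ UnboundedSeqIn L' x') ∧
      ¬ BallTotallyBounded L' ∧ ¬ IsLipNorm L') ∧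
    -- self-coverings of rational rotation algebras, `θ = m / q`
    (∀ (m q : ℕ), 0 < q → m < q → m.Coprime q →
      ∀ (B : CoveringMatrix 2), B.mat.det ≡ 1 [ZMOD q] →
      ∀ (ε : Fin 2 → Matrix (Fin 2) (Fin 2) ℂ), IsClifford ε →
      ∀ (c : ℝ), c ≠ 0 →
      ∀ (u : (Fin 2 → ℤ) → Matrix (Fin q) (Fin q) ℂ), u = rotTwist m q →
      ∀ (L : ∀ n, torusAlg B u 2 n → ℝ≥0∞) (L' : torusLimitAlg B u 2 → ℝ≥0∞),
      (∀ n, L n = lipSeminorm (torusDirac B u ε c n) (torusAlg B u 2 n)) →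
      L' = lipSeminorm (torusLimitDirac B u ε c) (torusLimitAlg B u 2) →
      Tendsto (fun n => normicRadius (L n)) atTop (𝓝 ⊤) ∧
      (∃ (x : ∀ n, torusAlg B u 2 n) (x' : ℕ → torusLimitAlg B u 2),
        (∀ n, (x n : TorusSpace B 2 q n →L[ℂ] TorusSpace B 2 q n) =
          mulOp B 2 n (fun t => character (B.freq n) t • 1)) ∧
        (∀ n, (x' n : TorusLimitSpace B 2 q →L[ℂ] TorusLimitSpace B 2 q) =
          torusEmbed B u 2 n (fun t => character (B.freq n) t • 1)) ∧
        (∀ n, L' (x' n) = L n (x n)) ∧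
        UnboundedSeq L x ∧ UnboundedSeqIn L' x') ∧
      ¬ BallTotallyBounded L' ∧ ¬ IsLipNorm L') ∧
    -- self-coverings of crossed products `Z ⋊ ℤ^p`
    (∀ (H : Type*) [NormedAddCommGroup H] [InnerProductSpace ℂ H] [CompleteSpace H] [Nontrivial H]
      (Z ℒ : StarSubalgebra ℂ (H →L[ℂ] H)) (D : H →ₗ.[ℂ] H), IsSpectralTriple Z ℒ D →
      ∀ (p : ℕ) (B : CoveringMatrix p) (ρ : LimitAction B Z) (β : Z ≃⋆ₐ[ℂ] Z),
      (∀ g g' : B.groupLimit, (g' : Fin p → ℝ) = B.dual *ᵥ (g : Fin p → ℝ) →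
        ∀ z, β (ρ (Multiplicative.ofAdd g') (β.symm z)) = ρ (Multiplicative.ofAdd g) z) →
      (∀ (n : ℕ) (a : Z), (a : H →L[ℂ] H) ∈ ℒ →
        ⨆ (g : B.groupLimit) (_ : (g : Fin p → ℝ) ∈ B.group n),
          commSeminorm D (ρ (Multiplicative.ofAdd g) a : H →L[ℂ] H) < ⊤) →
      ∀ (N : ℕ), N = 2 ^ ((p + 1) / 2) →
      ∀ (ε : Fin (p + 1) → Matrix (Fin N) (Fin N) ℂ), IsClifford ε →
      ∀ (Φ : Z → (CrossedLimitSpace B H N →L[ℂ] CrossedLimitSpace B H N)),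
      (Φ = limitRep ρ N ∨
        ∃ Ψ : Z →⋆ₐ[ℂ] (CrossedLimitSpace B H N →L[ℂ] CrossedLimitSpace B H N),
          Function.Injective Ψ ∧ IsCovariant ρ N Ψ ∧ Φ = Ψ) →
      ∀ (L : ∀ n, crossedAlg ρ N n → ℝ≥0∞) (L' : crossedLimitAlg N Φ → ℝ≥0∞),
      (∀ n, L n = lipSeminorm (crossedDirac B D ε n) (crossedAlg ρ N n)) →
      L' = lipSeminorm (crossedLimitDirac B D ε) (crossedLimitAlg N Φ) →
      Tendsto (fun n => normicRadius (L n)) atTop (𝓝 ⊤) ∧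
      (∃ (x : ∀ n, crossedAlg ρ N n) (x' : ℕ → crossedLimitAlg N Φ),
        (∀ n, (x n : CrossedSpace H N (B.group n) →L[ℂ] CrossedSpace H N (B.group n)) =
          shiftOp N (B.group n) (B.freq n)) ∧
        (∀ n, (x' n : CrossedLimitSpace B H N →L[ℂ] CrossedLimitSpace B H N) =
          limitShift B H N n (B.freq n)) ∧
        (∀ n, L' (x' n) = L n (x n)) ∧
        UnboundedSeq L x ∧ UnboundedSeqIn L' x') ∧
      ¬ BallTotallyBounded L' ∧ ¬ IsLipNorm L') ∧
    -- the shift on UHF algebras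
    (∀ (r : ℕ) [NeZero r], 2 ≤ r → ∀ (s : ℝ), 1 < s →
      ∀ (L : ∀ n : ℕ, uhfAlg r (Set.Ici (-(n : ℤ))) → ℝ≥0∞) (L' : uhfAlg r Set.univ → ℝ≥0∞),
      (∀ n : ℕ, L n =
        lipSeminorm (uhfDirac r (Set.Ici (-(n : ℤ))) s) (uhfAlg r (Set.Ici (-(n : ℤ))))) →
      L' = lipSeminorm (uhfDirac r Set.univ s) (uhfAlg r Set.univ) →
      Tendsto (fun n => normicRadius (L n)) atTop (𝓝 ⊤) ∧
      (∀ b : Matrix (Fin r) (Fin r) ℂ, (∀ c : ℂ, b ≠ c • 1) →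
        ∃ (x : ∀ n : ℕ, uhfAlg r (Set.Ici (-(n : ℤ)))) (x' : ℕ → uhfAlg r Set.univ),
          (∀ n : ℕ, (x n : UHFSpace r (Set.Ici (-(n : ℤ))) →L[ℂ] UHFSpace r (Set.Ici (-(n : ℤ)))) =
            siteOp (Set.Ici (-(n : ℤ))) b ⟨-(n : ℤ), Set.self_mem_Ici⟩) ∧
          (∀ n : ℕ, (x' n : UHFSpace r Set.univ →L[ℂ] UHFSpace r Set.univ) =
            siteOp Set.univ b ⟨-(n : ℤ), Set.mem_univ _⟩) ∧
          UnboundedSeq L x ∧ UnboundedSeqIn L' x') ∧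
      ¬ BallTotallyBounded L' ∧ ¬ IsLipNorm L') := by
  refine ⟨fun p B ε hε u hu L L' hL hL' => ?_, fun m q hq _ _ B _ ε hε c hc u hu L L' hL hL' => ?_,
    ?_, fun r _ hr s hs L L' hL hL' => uhf_conclusion hr hs L L' hL hL'⟩
  · have : NeZero (2 ^ (p / 2)) := ⟨pow_ne_zero _ two_ne_zero⟩
    exact torus_conclusion B u (fun g => by rw [hu]; simp) hε one_ne_zero L L' hL hL'
  · have : NeZero q := ⟨hq.ne'⟩
    subst hu
    exact torus_conclusion B _ (rotTwist_mul_conjTranspose m q) hε hc L L' hL hL'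
  · intro H _ _ _ _ Z ℒ D hD p B ρ _ _ _ N hN ε hε Φ _ L L' hL hL'
    have : NeZero N := ⟨by rw [hN]; exact pow_ne_zero _ two_ne_zero⟩
    exact crossed_conclusion B D ρ hD.selfAdjoint.isClosed
      (exists_norm_eq_one_mem_of_dense hD.dense_domain) hε Φ L L' hL hL'
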